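/- Let $n\ge 2$, $M=S^{n-1}$, and let $\mathrm{Imm}(M,\mathbb R^n)$ be the set of smooth immersions $f:M\to\mathbb R^n$. For $f\in \mathrm{Imm}(M,\mathbb R^n)$ let $\mathrm{vol}(g)$ be the volume density of the pullback metric $g=f^*\bar g$ of the Euclidean metric $\bar g$, $\mathrm{Vol}(f)=\int_M\mathrm{vol}(g)$, $\nu$ the unit normal field determined by the orientations (the outward normal for round spheres), $s(X,Y)=\bar g(\nabla_X Tf.Y,\nu)$ the scalar second fundamental form and $\mathrm{Tr}(L)=\mathrm{Tr}(g^{-1}s)$ the mean curvature. Let $\Phi=\Phi(v,y)$ be real-valued, smooth and positive for $v>0$, $y<0$ (the range of $(\mathrm{Vol},\mathrm{Tr}(L))$ near round spheres), and let $$G^\Phi_f(h,k)=\int_M\Phi(\mathrm{Vol}(f),\mathrm{Tr}(L))\,\bar g(h,k)\,\mathrm{vol}(g),\qquad h,k\in C^\infty(M,\mathbb R^n).$$ Define $H_f(h,k)$ and $K_f(m,h)$ by $D_{(f,m)}G^\Phi_f(h,k)=G^\Phi_f(m,H_f(h,k))=G^\Phi_f(K_f(m,h),k)$ for all $h,k,m\in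 C^\infty(M,\mathbb R^n)$. A horizontal geodesic is a smooth path of immersions $f(t,\cdot)$ with $f_t$ pointwise normal to $f$ and $f_{tt}=\tfrac12H_f(f_t,f_t)-K_f(f_t,f_t)$; the geodesics of shape space (immersions modulo orientation preserving diffeomorphisms of $M$) are the images of horizontal geodesics. Fix $x_0\in\mathbb R^n$, let $S_r(x)=x_0+rx$ for $r>0$, $x\in M$, and put $V(r)=\dfrac{n\pi^{n/2}r^{n-1}}{\Gamma(1+\frac n2)}$. 1. Each $S_r$ is an immersion with image the sphere of center $x_0$ and radius $r$, $\mathrm{Vol}(S_r)=V(r)$ and $\mathrm{Tr}(L)=-(n-1)/r$; $S_r$ and $S_{r'}$ represent the same shape iff $r=r'$. 2. Let $r$ be a smooth positive function on an open set of times. The path $t\mapsto S_{r(t)}$ in shape space is a geodesic of $G^\Phi$ iff $$r_{tt}=-r_t^2\,\frac{n-1}{\Phi}\Big[\frac1{2r}\Phi+\frac{\partial_1\Phi}{2}\,\frac{n\pi^{n/2}r^{n-2}}{\Gamma(1+\frac n2)}+\frac1{2r^2}\,\partial_2\Phi\Big],$$ where $\Phi$ and its partial derivatives are evaluated at $(V(r),-(n-1)/r)$.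 3. The space of spheres with center $x_0$ is geodesically complete for $G^\Phi$ (for each initial sphere and each initial velocity there is a geodesic of concentric spheres defined for all $t\in\mathbb R$) iff for all $r_0,r_1>0$ $$\int_0^{r_1}r^{\frac{n-1}2}\sqrt{\Phi\big(V(r),-(n-1)/r\big)}\,dr=\infty\quad\text{and}\quad\int_{r_0}^{\infty}r^{\frac{n-1}2}\sqrt{\Phi\big(V(r),-(n-1)/r\big)}\,dr=\infty .$$ 4. In the following cases $\Phi$ takes the indicated value on $S_r$, and the space of spheres with center $x_0$ behaves as indicated: * $\Phi=\mathrm{Vol}^k=\dfrac{n^k\pi^{kn/2}}{\Gamma(1+\frac n2)^k}r^{k(n-1)}$ for real $k$: incomplete if $k\ne\frac{1+n}{1-n}$. * $\Phi=e^{\mathrm{Vol}}=\exp\Big(\dfrac{n\pi^{n/2}}{\Gamma(1+\frac n2)}r^{n-1}\Big)$: incomplete. * $\Phi=1+A|\mathrm{Tr}(L)|^{2k}=1+A\dfrac{(n-1)^{2k}}{r^{2k}}$ for $A>0$ and real $k$: complete iff $k\ge\frac{n+1}2$. * $\Phi=\mathrm{Vol}^{\frac{1+n}{1-n}}+A\dfrac{\mathrm{Tr}(L)^2}{\mathrm{Vol}}=\dfrac{C}{r^{n+1}}$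 for $A\ge0$, with a constant $C=C(n,A)>0$: complete. -/

import Mathlib

open Set Metric MeasureTheory
open scoped Manifold ContDiff

noncomputable section

namespace AlmostLocal

/-- The ambient Euclidean space `ℝⁿ` with `n = d + 1`. -/
abbrev Amb (d : ℕ) : Type := EuclideanSpace ℝ (Fin (d + 1))

/-- The manifold `M = S^{n-1}`, i.e. the unit sphere of `ℝⁿ`, of dimension `d = n - 1`. -/
abbrev Sph (d : ℕ) : Type := Metric.sphere (0 : Amb d) 1

variable {d : ℕ}

/-- `C^∞(M, ℝⁿ)`. -/
def IsSmooth (h : Sph d → Amb d) : Prop :=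
  ContMDiff (𝓡 d) 𝓘(ℝ, Amb d) ∞ h

/-- `f ∈ Imm(M, ℝⁿ)`: a smooth map whose tangent map is injective at every point. -/
def IsImm (f : Sph d → Amb d) : Prop :=
  IsSmooth f ∧ ∀ x : Sph d, Function.Injective (mfderiv (𝓡 d) 𝓘(ℝ, Amb d) f x)

open Classical in
/-- The extension of a map on the unit sphere to `ℝⁿ` that is constant on rays from the origin
(the value at the origin is irrelevant). -/
def radialExt (f : Sph d → Amb d) : Amb d → Amb d := fun y =>
  if h : y = 0 then 0
  else f ⟨‖y‖⁻¹ • y, by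
    rw [mem_sphere_zero_iff_norm, norm_smul, norm_inv, norm_norm,
      inv_mul_cancel₀ (norm_ne_zero_iff.mpr h)]⟩

/-- The `i`-th standard basis vector of `ℝⁿ`. -/
def stdVec (i : Fin (d + 1)) : Amb d := EuclideanSpace.single i 1

/-- `∂ᵢF(y)` for the radial extension `F` of `f`. At a point `x` of the sphere, `DF(x)` is `T_x f`
on `T_x M = x^⊥`, and `DF(x) x = 0`. -/
def partialD (f : Sph d → Amb d) (y : Amb d) (i : Fin (d + 1)) : Amb d :=
  fderiv ℝ (radialExt f) y (stdVec i)

/-- The pullback metric `g = f^*ḡ` at `x`, as the matrix `DF(x)ᵀ DF(x) + x xᵀ`. In an orthonormal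
basis of `ℝⁿ` that consists of `x` and a basis of `T_x M = x^⊥`, this is the block matrix
`diag(1, (g_ij))`. -/
def pullbackMetric (f : Sph d → Amb d) (x : Sph d) :
    Matrix (Fin (d + 1)) (Fin (d + 1)) ℝ :=
  Matrix.of fun i j =>
    inner ℝ (partialD f (x : Amb d) i) (partialD f (x : Amb d) j)
      + (x : Amb d) i * (x : Amb d) j

/-- The density of `vol(f^*ḡ)` with respect to the standard surface measure of `S^{n-1}`: the square
root of `det (g_ij)`, taken in an orthonormal basis of `T_x M`. -/
def volDensity (f : Sph d → Amb d) (x : Sph d) : ℝ :=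
  Real.sqrt (pullbackMetric f x).det

/-- The standard surface measure of the unit sphere. -/
def surf (d : ℕ) : Measure (Sph d) := (volume : Measure (Amb d)).toSphere

/-- `Vol(f) = ∫_M vol(f^*ḡ)`. -/
def Vol (f : Sph d → Amb d) : ℝ := ∫ x, volDensity f x ∂(surf d)

/-- The vector `N` with `⟪N, w⟫ = det (DF(x) + w xᵀ)`, that is,
`⟪N, w⟫ = det (w, Tf.X₁, …, Tf.X_{n-1})` for any orthonormal basis `X₁, …, X_{n-1}` of `T_x M` such
that `(x, X₁, …, X_{n-1})` is positively oriented in `ℝⁿ`. -/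
def normalVec (f : Sph d → Amb d) (x : Sph d) : Amb d :=
  WithLp.toLp 2 fun k : Fin (d + 1) =>
    (Matrix.of fun a b : Fin (d + 1) =>
      partialD f (x : Amb d) b a + (if a = k then (x : Amb d) b else 0)).det

/-- The unit normal field `ν^f`: orthogonal to the image of `T_x f`, of length one, and such that
`(ν, Tf.X₁, …, Tf.X_{n-1})` is positively oriented for positively oriented `(X₁, …, X_{n-1})`. The
sphere carries its usual orientation, for which `ν` is the outward normal of round spheres. -/
def unitNormal (f : Sph d → Amb d) (x : Sph d) : Amb d :=
  ‖normalVec f x‖⁻¹ • normalVec f x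

/-- The scalar second fundamental form `s(X, Y) = ⟪D²F(x)(X, Y), ν⟫`, as a matrix on `ℝⁿ`. The
direction `x` lies in its kernel, so in an orthonormal basis of `ℝⁿ` that consists of `x` and a
basis of `T_x M` it is the block matrix `diag(0, (s_ij))`. -/
def secondForm (f : Sph d → Amb d) (x : Sph d) :
    Matrix (Fin (d + 1)) (Fin (d + 1)) ℝ :=
  Matrix.of fun i j =>
    inner ℝ (fderiv ℝ (fun y => partialD f y j) (x : Amb d) (stdVec i)) (unitNormal f x)

/-- The mean curvature `Tr(L) = Tr(g⁻¹ s) = ∑ g^{ij} s_ij`. -/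
def trL (f : Sph d → Amb d) (x : Sph d) : ℝ :=
  ((pullbackMetric f x)⁻¹ * secondForm f x).trace

/-- The almost local metric
`G^Φ_f(h, k) = ∫_M Φ(Vol(f), Tr(L^f)) ḡ(h, k) vol(f^*ḡ)` on `Imm(M, ℝⁿ)`. -/
def G (Φ : ℝ → ℝ → ℝ) (f h k : Sph d → Amb d) : ℝ :=
  ∫ x, Φ (Vol f) (trL f x) * inner ℝ (h x) (k x) * volDensity f x ∂(surf d)

/-- `H = H_f(h, k)` is the metric gradient given by `D_{(f,m)} G_f(h, k) = G_f(m, H_f(h, k))`. -/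
def IsHGradient (Φ : ℝ → ℝ → ℝ) (f h k H : Sph d → Amb d) : Prop :=
  IsSmooth H ∧ ∀ m : Sph d → Amb d, IsSmooth m →
    HasDerivAt (fun s : ℝ => G Φ (f + s • m) h k) (G Φ f m H) 0

/-- `K = K_f(m, h)` is the metric gradient given by `D_{(f,m)} G_f(h, k) = G_f(K_f(m, h), k)`. -/
def IsKGradient (Φ : ℝ → ℝ → ℝ) (f m h K : Sph d → Amb d) : Prop :=
  IsSmooth K ∧ ∀ k : Sph d → Amb d, IsSmooth k →
    HasDerivAt (fun s : ℝ => G Φ (f + s • m) h k) (G Φ f K k) 0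

/-- The time derivative `f_t` of a path of maps. -/
def timeD (f : ℝ → Sph d → Amb d) : ℝ → Sph d → Amb d :=
  fun t x => deriv (fun τ => f τ x) t

/-- The path `f : I → Imm(M, ℝⁿ)` is a horizontal geodesic of `G^Φ`: it is smooth, its velocity is
pointwise normal to `f`, and `f_tt = ½ H_f(f_t, f_t) - K_f(f_t, f_t)`. -/
structure IsHorizontalGeodesic (Φ : ℝ → ℝ → ℝ) (f : ℝ → Sph d → Amb d) (I : Set ℝ) : Prop where
  smooth : ContMDiffOn (𝓘(ℝ, ℝ).prod (𝓡 d)) 𝓘(ℝ, Amb d) ∞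
    (fun p : ℝ × Sph d => f p.1 p.2) (I ×ˢ univ)
  imm : ∀ t ∈ I, IsImm (f t)
  horizontal : ∀ t ∈ I, ∀ (x : Sph d) (X : TangentSpace (𝓡 d) x),
    inner ℝ (timeD f t x) (mfderiv (𝓡 d) 𝓘(ℝ, Amb d) (f t) x X : Amb d) = 0
  equation : ∀ t ∈ I, ∃ H K : Sph d → Amb d,
    IsHGradient Φ (f t) (timeD f t) (timeD f t) H ∧
    IsKGradient Φ (f t) (timeD f t) (timeD f t) K ∧
    ∀ x, timeD (timeD f) t x = (1 / 2 : ℝ) • H x - K x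

/-- Orientation preserving diffeomorphisms of the sphere: `det (φ(x), Tφ.X₁, …, Tφ.X_{n-1}) > 0`
whenever `(x, X₁, …, X_{n-1})` is a positively oriented orthonormal basis. -/
def IsOrientationPreserving (φ : Sph d ≃ₘ^∞⟮𝓡 d, 𝓡 d⟯ Sph d) : Prop :=
  ∀ x, 0 < inner ℝ (normalVec (fun y => (φ y : Amb d)) x) (φ x : Amb d)

/-- `f` and `g` represent the same element of shape space, `f = g ∘ φ`. The reparametrizations
preserve the orientation, since the sign of `Tr(L)` depends on it. -/
def SameShape (f g : Sph d → Amb d) : Prop :=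
  ∃ φ : Sph d ≃ₘ^∞⟮𝓡 d, 𝓡 d⟯ Sph d, IsOrientationPreserving φ ∧ ∀ x, f x = g (φ x)

/-- The standard parametrization `x ↦ x₀ + r x` of the sphere with center `x₀` and radius `r`. -/
def roundSphere (x₀ : Amb d) (r : ℝ) : Sph d → Amb d := fun x => x₀ + r • (x : Amb d)

/-- The path in shape space that consists of the spheres with center `x₀` and radius `r(t)`, `t ∈ I`,
is a geodesic of shape space: the image of a horizontal geodesic in `Imm(M, ℝⁿ)`. -/
def IsConcentricGeodesic (Φ : ℝ → ℝ → ℝ) (x₀ : Amb d) (r : ℝ → ℝ) (I : Set ℝ) : Prop :=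
  ∃ f : ℝ → Sph d → Amb d, IsHorizontalGeodesic Φ f I ∧
    ∀ t ∈ I, SameShape (f t) (roundSphere x₀ (r t))

/-- The space of spheres with center `x₀` is geodesically complete for `G^Φ`: for every initial sphere
and every initial velocity there is a geodesic of concentric spheres that is defined for all times. -/
def ConcentricComplete (Φ : ℝ → ℝ → ℝ) (x₀ : Amb d) : Prop :=
  ∀ r₀ : ℝ, 0 < r₀ → ∀ v : ℝ, ∃ r : ℝ → ℝ,
    ContDiff ℝ ∞ r ∧ (∀ t, 0 < r t) ∧ r 0 = r₀ ∧ deriv r 0 = v ∧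
      IsConcentricGeodesic Φ x₀ r univ

/-- Weight functions: smooth and positive on `(0, ∞) × (-∞, 0)`, the quadrant where `(Vol, Tr(L))`
lies for spheres and for immersions near them. -/
structure IsWeight (Φ : ℝ → ℝ → ℝ) : Prop where
  smooth : ContDiffOn ℝ ∞ (fun p : ℝ × ℝ => Φ p.1 p.2) (Ioi 0 ×ˢ Iio 0)
  pos : ∀ v y : ℝ, 0 < v → y < 0 → 0 < Φ v y

/-- `n π^{n/2} r^{n-1} / Γ(1 + n/2)`. -/
def sphereVol (n : ℕ) (r : ℝ) : ℝ :=
  n * Real.pi ^ ((n : ℝ) / 2) * r ^ (n - 1) / Real.Gamma (1 + (n : ℝ) / 2)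

/-- The integrand `r^{(n-1)/2} √Φ(n π^{n/2} r^{n-1} / Γ(1 + n/2), -(n-1)/r)`. -/
def lengthDensity (Φ : ℝ → ℝ → ℝ) (n : ℕ) (r : ℝ) : ℝ :=
  r ^ (((n : ℝ) - 1) / 2) * Real.sqrt (Φ (sphereVol n r) (-((n : ℝ) - 1) / r))

end AlmostLocal

end

noncomputable section

namespace AlmostLocal

variable {d : ℕ}

open Filter Topology

/-! Put d = n - 1 and W(ρ) = Φ(V(ρ), -d/ρ) V(ρ). The spheres with center x₀ form a one-parameter
family, and G^Φ induces on it the metric W dρ². Indeed, for every orientation preserving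
diffeomorphism φ, the map f = x₀ + ρφ has constant mean curvature and volume V(ρ), so G_f(aφ, bφ) =
ab W(ρ) (`G_reparametrized_normal`). The geodesic equation should therefore be r'' = -½ (log W)'(r)
r'², and expanding (log W)' gives the stated formula (`logDerivWeight_eq`).

That a solution r gives a geodesic requires the gradients H and K at a round sphere against
arbitrary test fields, so the family must be totally geodesic. The first variation of G involves the
variations of volume density and mean curvature, which contain div m and the normal part of the
Laplacian of m. After integration over the sphere the divergence theorem reduces both to ∫⟨x, m⟩
(`integral_divergence_radialExt`, `integral_radialLaplacian`). Hence the gradient is a constant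
multiple of the normal field x, with H = K = r'² (log W)' x, and ½H - K is the right-hand side of
the equation.

Conversely, a geodesic lying over the concentric spheres is f(t) = x₀ + r(t) φ_t, where nothing is
known about how φ_t depends on t. Horizontality forces f_t = r' φ_t, which also determines f_tt.
Pairing the geodesic equation with φ_t uses only variations that remain among reparametrized
spheres, so knowing W suffices.

The equation says that √W(r) r' is constant, and `lengthDensity` is √W up to a constant factor.
Completeness is therefore infinite length towards both ends of (0, ∞). For the special weights, the
density is a power of r or is compared with powers of r or constants.

The geometry is done in ambient coordinates. The extension constant on rays supplies derivatives;
the extension homogeneous of degree one (`coneMap`) turns a diffeomorphism of the sphere into a norm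
preserving bijection of ℝⁿ, to which the usual change of variables and polar coordinates apply. -/

/-! ### Radial extensions of maps on the sphere -/

theorem norm_coe_sph (x : Sph d) : ‖(x : Amb d)‖ = 1 := mem_sphere_zero_iff_norm.1 x.2

theorem coe_sph_ne_zero (x : Sph d) : (x : Amb d) ≠ 0 := by
  intro h; have := norm_coe_sph x; rw [h] at this; simp at this

/-- The direction `y / ‖y‖` of a nonzero vector, as a point of the sphere. -/
def direction (y : Amb d) (hy : y ≠ 0) : Sph d :=
  ⟨‖y‖⁻¹ • y, by
    rw [mem_sphere_zero_iff_norm, norm_smul, norm_inv, norm_norm,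
      inv_mul_cancel₀ (norm_ne_zero_iff.mpr hy)]⟩

theorem radialExt_of_ne (f : Sph d → Amb d) {y : Amb d} (hy : y ≠ 0) :
    radialExt f y = f (direction y hy) := by
  simp only [radialExt, hy, dif_neg, not_false_eq_true, direction]

theorem direction_smul {t : ℝ} (ht : 0 < t) {y : Amb d} (hy : y ≠ 0) (hty : t • y ≠ 0) :
    direction (t • y) hty = direction y hy := by
  ext1
  simp only [direction, norm_smul, smul_smul, Real.norm_of_nonneg ht.le]
  congr 1
  field_simp

theorem direction_coe (x : Sph d) : direction (x : Amb d) (coe_sph_ne_zero x) = x := by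
  ext1
  simp [direction]

theorem radialExt_coe (f : Sph d → Amb d) (x : Sph d) : radialExt f (x : Amb d) = f x := by
  rw [radialExt_of_ne f (coe_sph_ne_zero x), direction_coe]

theorem radialExt_smul (f : Sph d → Amb d) {t : ℝ} (ht : 0 < t) (y : Amb d) :
    radialExt f (t • y) = radialExt f y := by
  by_cases hy : y = 0
  · simp [hy]
  · have hty : t • y ≠ 0 := smul_ne_zero ht.ne' hy
    rw [radialExt_of_ne f hty, radialExt_of_ne f hy, direction_smul ht hy]

/-- Normalization is singular at 0, whereas smooth maps into the sphere are obtained here by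
restricting the codomain of a globally smooth map. A bump function pulls y back towards y₀, so that
the vector being normalized stays within ‖y₀‖/2 of y₀ and never vanishes. -/
theorem exists_smooth_direction (y₀ : Amb d) (hy₀ : y₀ ≠ 0) :
    ∃ g : Amb d → Sph d, ContMDiff 𝓘(ℝ, Amb d) (𝓡 d) ∞ g ∧
      ∀ᶠ y in 𝓝 y₀, ∃ hy : y ≠ 0, g y = direction y hy := by
  have hpos : 0 < ‖y₀‖ := norm_pos_iff.2 hy₀
  let χ : ContDiffBump y₀ := ⟨‖y₀‖ / 4, ‖y₀‖ / 2, by positivity, by linarith⟩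
  let z : Amb d → Amb d := fun y => y₀ + χ y • (y - y₀)
  have hz : ∀ y, z y ≠ 0 := by
    intro y h
    have h1 : y₀ = - (χ y • (y - y₀)) := eq_neg_of_add_eq_zero_left h
    have h2 : ‖y₀‖ = χ y * ‖y - y₀‖ := by
      conv_lhs => rw [h1]
      rw [norm_neg, norm_smul, Real.norm_of_nonneg (χ.nonneg)]
    by_cases hy : dist y y₀ < ‖y₀‖ / 2
    · rw [dist_eq_norm] at hy
      have : χ y * ‖y - y₀‖ ≤ 1 * ‖y - y₀‖ :=
        mul_le_mul_of_nonneg_right χ.le_one (norm_nonneg _)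
      linarith
    · have : χ y = 0 := χ.zero_of_le_dist (not_lt.1 hy)
      rw [this] at h2; linarith
  have hzs : ContDiff ℝ ∞ z := contDiff_const.add (χ.contDiff.smul (contDiff_id.sub contDiff_const))
  have hw : ContDiff ℝ ∞ (fun y => ‖z y‖⁻¹ • z y) :=
    ((hzs.norm ℝ hz).inv fun y => norm_ne_zero_iff.2 (hz y)).smul hzs
  refine ⟨fun y => direction (z y) (hz y), ?_, ?_⟩
  · have := Fact.mk (@finrank_euclideanSpace_fin ℝ _ (d + 1))
    exact ContMDiff.codRestrict_sphere hw.contMDiff (fun y => (direction (z y) (hz y)).2)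
  · have h1 : ∀ᶠ y in 𝓝 y₀, y ≠ 0 := isOpen_ne.mem_nhds hy₀
    filter_upwards [h1, χ.eventuallyEq_one] with y hy hχ
    refine ⟨hy, ?_⟩
    have : z y = y := by simp [z, hχ]
    simp [this]

/-- One local model g of the direction map serves all f, so manifold smoothness of f passes to its
radial extension by composition. -/
theorem exists_radialExt_eventuallyEq (y₀ : Amb d) (hy₀ : y₀ ≠ 0) :
    ∃ g : Amb d → Sph d, ContMDiff 𝓘(ℝ, Amb d) (𝓡 d) ∞ g ∧ g y₀ = direction y₀ hy₀ ∧
      (∀ᶠ y in 𝓝 y₀, ∃ hy : y ≠ 0, g y = direction y hy) ∧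
      ∀ f : Sph d → Amb d, radialExt f =ᶠ[𝓝 y₀] f ∘ g := by
  obtain ⟨g, hg, he⟩ := exists_smooth_direction y₀ hy₀
  refine ⟨g, hg, he.self_of_nhds.2, he, fun f => ?_⟩
  filter_upwards [he] with y hy
  obtain ⟨h, hy⟩ := hy
  rw [radialExt_of_ne f h, Function.comp_apply, hy]

theorem contDiffAt_radialExt {f : Sph d → Amb d} (hf : IsSmooth f) {y : Amb d} (hy : y ≠ 0) :
    ContDiffAt ℝ ∞ (radialExt f) y := by
  obtain ⟨g, hg, -, -, h⟩ := exists_radialExt_eventuallyEq y hy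
  exact (ContMDiff.comp hf hg).contDiff.contDiffAt.congr_of_eventuallyEq (h f)

theorem differentiableAt_radialExt {f : Sph d → Amb d} (hf : IsSmooth f) {y : Amb d} (hy : y ≠ 0) :
    DifferentiableAt ℝ (radialExt f) y :=
  (contDiffAt_radialExt hf hy).differentiableAt (by simp)

theorem contDiffAt_partialD {f : Sph d → Amb d} (hf : IsSmooth f) {y : Amb d} (hy : y ≠ 0)
    (i : Fin (d + 1)) : ContDiffAt ℝ ∞ (fun y => partialD f y i) y :=
  ((contDiffAt_radialExt hf hy).fderiv_right (m := ∞) (by simp)).clm_apply contDiffAt_const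

theorem isSmooth_continuous {f : Sph d → Amb d} (hf : IsSmooth f) : Continuous f :=
  ContMDiff.continuous hf

theorem isSmooth_coe : IsSmooth (fun x : Sph d => (x : Amb d)) := by
  have := Fact.mk (@finrank_euclideanSpace_fin ℝ _ (d + 1))
  exact contMDiff_coe_sphere

theorem IsSmooth.add {f g : Sph d → Amb d} (hf : IsSmooth f) (hg : IsSmooth g) :
    IsSmooth (f + g) := ContMDiff.add hf hg

theorem IsSmooth.const_smul {f : Sph d → Amb d} (hf : IsSmooth f) (c : ℝ) :
    IsSmooth (c • f) := (contDiff_id.const_smul c).contMDiff.comp hf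

theorem isSmooth_const (c : Amb d) : IsSmooth (fun _ : Sph d => c) := contMDiff_const

theorem fderiv_radialExt_smul (f : Sph d → Amb d) {t : ℝ} (ht : 0 < t) (y : Amb d) :
    fderiv ℝ (radialExt f) (t • y) = t⁻¹ • fderiv ℝ (radialExt f) y := by
  have h : (fun z => radialExt f (t • z)) = radialExt f := funext fun z => radialExt_smul f ht z
  have h2 := fderiv_comp_smul (𝕜 := ℝ) (f := radialExt f) (x := y) t
  rw [h] at h2
  rw [h2, smul_smul, inv_mul_cancel₀ ht.ne', one_smul]

theorem fderiv_radialExt_self {f : Sph d → Amb d} (hf : IsSmooth f) {y : Amb d} (hy : y ≠ 0) :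
    fderiv ℝ (radialExt f) y y = 0 := by
  have h1 : HasDerivAt (fun t : ℝ => radialExt f (t • y)) (fderiv ℝ (radialExt f) y y) 1 := by
    have h3 : HasFDerivAt (radialExt f) (fderiv ℝ (radialExt f) y) ((1 : ℝ) • y) := by
      simpa using (differentiableAt_radialExt hf hy).hasFDerivAt
    have h4 := h3.comp_hasDerivAt (1 : ℝ) ((hasDerivAt_id' (1 : ℝ)).smul_const y)
    rw [one_smul] at h4
    exact h4
  have h2 : (fun t : ℝ => radialExt f (t • y)) =ᶠ[𝓝 1] fun _ => radialExt f y := by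
    filter_upwards [lt_mem_nhds (zero_lt_one' ℝ)] with t ht using radialExt_smul f ht y
  exact h1.unique ((hasDerivAt_const (1 : ℝ) _).congr_of_eventuallyEq h2)

theorem sum_smul_stdVec (v : Amb d) : ∑ i, v i • stdVec i = v := by
  ext k
  simp [stdVec, Pi.single_apply]

theorem fderiv_radialExt_eq_sum (f : Sph d → Amb d) (y v : Amb d) :
    fderiv ℝ (radialExt f) y v = ∑ i, v i • partialD f y i := by
  conv_lhs => rw [← sum_smul_stdVec v]
  simp [partialD]

theorem sum_smul_partialD {f : Sph d → Amb d} (hf : IsSmooth f) {y : Amb d} (hy : y ≠ 0) :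
    ∑ i, y i • partialD f y i = 0 := by
  rw [← fderiv_radialExt_eq_sum, fderiv_radialExt_self hf hy]

/-- Along the sphere, the derivative of the radial extension takes values in the image of the
tangent map. -/
theorem exists_fderiv_radialExt_eq_mfderiv {f : Sph d → Amb d} (hf : IsSmooth f) (x : Sph d)
    (v : Amb d) : ∃ p : Sph d, p = x ∧ ∃ X : TangentSpace (𝓡 d) p,
      fderiv ℝ (radialExt f) (x : Amb d) v = mfderiv (𝓡 d) 𝓘(ℝ, Amb d) f p X := by
  obtain ⟨g, hg, hgx, -, h⟩ := exists_radialExt_eventuallyEq (x : Amb d) (coe_sph_ne_zero x)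
  refine ⟨g x, by rw [hgx, direction_coe], mfderiv 𝓘(ℝ, Amb d) (𝓡 d) g (x : Amb d) v, ?_⟩
  rw [(h f).fderiv_eq, ← mfderiv_eq_fderiv,
    mfderiv_comp (x : Amb d) (hf.mdifferentiable (by simp) _) (hg.mdifferentiable (by simp) _)]
  rfl

/-! ### Determinants of rank one perturbations -/

open Matrix in
theorem det_one_add_vecMulVec {ι : Type*} [Fintype ι] [DecidableEq ι] (a b : ι → ℝ) :
    (1 + vecMulVec a b).det = 1 + b ⬝ᵥ a := by
  rw [vecMulVec_eq Unit, det_one_add_replicateCol_mul_replicateRow]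

-- With B = A + u xᵀ one has A + w xᵀ = B (1 + B⁻¹(w - u) xᵀ), and x = Bᵀu because u lies in the
-- left kernel of A. The rank one determinant formula then leaves 1 + uᵀ(w - u). Taking w to be a
-- basis vector computes `normalVec`.
open Matrix in
theorem det_add_vecMulVec_of_mulVec_eq {ι : Type*} [Fintype ι] [DecidableEq ι]
    {A : Matrix ι ι ℝ} {x u : ι → ℝ} (hAu : Aᵀ *ᵥ u = 0)
    (hu : u ⬝ᵥ u = 1) (hB : (A + vecMulVec u x).det ≠ 0) (w : ι → ℝ) :
    (A + vecMulVec w x).det = (A + vecMulVec u x).det * (u ⬝ᵥ w) := by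
  set B := A + vecMulVec u x with hBdef
  have hBu : Bᵀ *ᵥ u = x := by
    rw [hBdef, transpose_add, add_mulVec, hAu, transpose_vecMulVec, vecMulVec_mulVec, hu]
    simp
  have hunit : IsUnit B.det := isUnit_iff_ne_zero.2 hB
  have h1 : A + vecMulVec w x = B * (1 + vecMulVec (B⁻¹ *ᵥ (w - u)) x) := by
    rw [mul_add, mul_one, mul_vecMulVec, mulVec_mulVec, mul_nonsing_inv _ hunit, one_mulVec, hBdef,
      sub_vecMulVec]
    abel
  have h2 : x ⬝ᵥ (B⁻¹ *ᵥ (w - u)) = u ⬝ᵥ (w - u) := by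
    conv_lhs => rw [← hBu]
    rw [mulVec_transpose, ← dotProduct_mulVec, mulVec_mulVec, mul_nonsing_inv _ hunit, one_mulVec]
  rw [h1, det_mul, det_one_add_vecMulVec, h2, dotProduct_sub, hu]
  ring

-- Since A kills x, the left matrix is A + u xᵀ composed with the map that is ρ on the complement of
-- x and 1 on x; that map has determinant ρ^d.
open Matrix in
theorem det_smul_add_vecMulVec {A : Matrix (Fin (d + 1)) (Fin (d + 1)) ℝ} {x u : Fin (d + 1) → ℝ}
    (hx : x ⬝ᵥ x = 1) (hAx : A *ᵥ x = 0) {ρ : ℝ} (hρ : 0 < ρ) :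
    (ρ • A + vecMulVec u x).det = ρ ^ d * (A + vecMulVec u x).det := by
  have h1 : ρ • A + vecMulVec u x =
      (A + vecMulVec u x) * (ρ • (1 + vecMulVec ((ρ⁻¹ * (1 - ρ)) • x) x)) := by
    rw [Matrix.mul_smul, mul_add, mul_one, mul_vecMulVec, mulVec_smul, add_mulVec, hAx, vecMulVec_mulVec,
      hx]
    simp only [zero_add, smul_add, MulOpposite.op_one, one_smul, smul_vecMulVec, smul_smul]
    rw [add_assoc, ← add_smul]
    congr 1
    have : ρ + ρ * (ρ⁻¹ * (1 - ρ)) = 1 := by field_simp; ring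
    rw [this, one_smul]
  rw [h1, det_mul, det_smul, det_one_add_vecMulVec, dotProduct_smul, hx, Fintype.card_fin]
  simp only [smul_eq_mul, mul_one]
  field_simp
  ring

/-- The matrix whose columns are the partial derivatives of the radial extension. -/
def diffMatrix (f : Sph d → Amb d) (x : Sph d) : Matrix (Fin (d + 1)) (Fin (d + 1)) ℝ :=
  Matrix.of fun a b => partialD f (x : Amb d) b a

/-- The Jacobian at the point `x` of the sphere of the positively homogeneous extension of `u`. -/
def coneMatrix (u : Sph d → Amb d) (x : Sph d) : Matrix (Fin (d + 1)) (Fin (d + 1)) ℝ :=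
  diffMatrix u x + Matrix.vecMulVec (u x) (x : Amb d)

theorem inner_eq_dotProduct (v w : Amb d) : inner ℝ v w = (v : Fin (d + 1) → ℝ) ⬝ᵥ w := by
  simp [PiLp.inner_apply, dotProduct, mul_comm]

theorem dotProduct_self_coe (x : Sph d) :
    ((x : Amb d) : Fin (d + 1) → ℝ) ⬝ᵥ (x : Amb d) = 1 := by
  rw [← inner_eq_dotProduct, real_inner_self_eq_norm_sq, norm_coe_sph, one_pow]

open Matrix in
theorem pullbackMetric_eq (f : Sph d → Amb d) (x : Sph d) :
    pullbackMetric f x =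
      (diffMatrix f x)ᵀ * diffMatrix f x + vecMulVec (x : Amb d) (x : Amb d) := by
  ext i j
  simp [pullbackMetric, diffMatrix, Matrix.mul_apply, inner_eq_dotProduct, dotProduct, vecMulVec]

open Matrix in
theorem normalVec_apply (f : Sph d → Amb d) (x : Sph d) (k : Fin (d + 1)) :
    normalVec f x k = (diffMatrix f x + vecMulVec (Pi.single k 1) (x : Amb d)).det := by
  simp only [normalVec]
  congr 1
  ext a b
  simp [diffMatrix, vecMulVec, Pi.single_apply]

open Matrix in
theorem diffMatrix_mulVec_self {f : Sph d → Amb d} (hf : IsSmooth f) (x : Sph d) :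
    diffMatrix f x *ᵥ (x : Amb d) = 0 := by
  ext a
  have := congrArg (fun v : Amb d => v a) (sum_smul_partialD hf (coe_sph_ne_zero x))
  simpa [diffMatrix, mulVec, dotProduct, mul_comm] using this

theorem radialExt_add_smul (f m : Sph d → Amb d) (s : ℝ) :
    radialExt (f + s • m) = radialExt f + s • radialExt m := by
  ext1 y
  by_cases hy : y = 0
  · simp [hy, radialExt]
  · simp [radialExt_of_ne _ hy]

theorem partialD_add_smul {f m : Sph d → Amb d} (hf : IsSmooth f) (hm : IsSmooth m) (s : ℝ)
    {y : Amb d} (hy : y ≠ 0) (i : Fin (d + 1)) :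
    partialD (f + s • m) y i = partialD f y i + s • partialD m y i := by
  have h1 := differentiableAt_radialExt hf hy
  have h2 := differentiableAt_radialExt hm hy
  simp only [partialD, radialExt_add_smul]
  rw [fderiv_add h1 (h2.const_smul s), fderiv_const_smul h2]
  rfl

theorem radialExt_const_eventuallyEq (c : Amb d) {y : Amb d} (hy : y ≠ 0) :
    radialExt (fun _ => c) =ᶠ[𝓝 y] fun _ => c := by
  filter_upwards [isOpen_ne.mem_nhds hy] with z hz
  rw [radialExt_of_ne _ hz]

theorem partialD_const (c : Amb d) {y : Amb d} (hy : y ≠ 0) (i : Fin (d + 1)) :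
    partialD (fun _ => c) y i = 0 := by
  rw [partialD, (radialExt_const_eventuallyEq c hy).fderiv_eq]
  simp

theorem partialD_const_add_smul (c : Amb d) {u : Sph d → Amb d} (hu : IsSmooth u) (ρ : ℝ)
    {y : Amb d} (hy : y ≠ 0) (i : Fin (d + 1)) :
    partialD (fun x => c + ρ • u x) y i = ρ • partialD u y i := by
  have := partialD_add_smul (isSmooth_const c) hu ρ hy i
  rw [partialD_const c hy, zero_add] at this
  exact this

theorem isSmooth_const_add_smul (c : Amb d) {u : Sph d → Amb d} (hu : IsSmooth u) (ρ : ℝ) :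
    IsSmooth (fun x => c + ρ • u x) :=
  (isSmooth_const c).add (hu.const_smul ρ)

/-! ### Geometry of c + ρu for a map u into the unit sphere -/

section UnitMap

variable {u : Sph d → Amb d}

theorem inner_partialD_self (hu : IsSmooth u) (h1 : ∀ x, ‖u x‖ = 1) {y : Amb d} (hy : y ≠ 0)
    (i : Fin (d + 1)) : inner ℝ (partialD u y i) (radialExt u y) = 0 := by
  have hd := differentiableAt_radialExt hu hy
  have h2 : (fun z => inner ℝ (radialExt u z) (radialExt u z)) =ᶠ[𝓝 y] fun _ => (1 : ℝ) := by
    filter_upwards [isOpen_ne.mem_nhds hy] with z hz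
    rw [radialExt_of_ne _ hz, real_inner_self_eq_norm_sq, h1, one_pow]
  have h3 := congrArg (fun L : Amb d →L[ℝ] ℝ => L (stdVec i)) h2.fderiv_eq
  simp only [fderiv_inner_apply ℝ hd hd, fderiv_fun_const, Pi.zero_apply,
    _root_.zero_apply] at h3
  rw [real_inner_comm] at h3
  simp only [partialD]
  linarith

/-- Differentiating ⟨∂ⱼu, u⟩ = 0 once more trades second derivatives for the first fundamental form.
This is the umbilicity of spheres, in any parametrization. -/
theorem inner_fderiv_partialD (hu : IsSmooth u) (h1 : ∀ x, ‖u x‖ = 1) (x : Sph d)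
    (i j : Fin (d + 1)) :
    inner ℝ (fderiv ℝ (fun y => partialD u y j) (x : Amb d) (stdVec i)) (u x) =
      - inner ℝ (partialD u (x : Amb d) i) (partialD u (x : Amb d) j) := by
  have hx := coe_sph_ne_zero x
  have hd := differentiableAt_radialExt hu hx
  have hp := (contDiffAt_partialD hu hx j).differentiableAt (by simp)
  have h2 : (fun z => inner ℝ (partialD u z j) (radialExt u z)) =ᶠ[𝓝 (x : Amb d)]
      fun _ => (0 : ℝ) := by
    filter_upwards [isOpen_ne.mem_nhds hx] with z hz using inner_partialD_self hu h1 hz j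
  have h3 := congrArg (fun L : Amb d →L[ℝ] ℝ => L (stdVec i)) h2.fderiv_eq
  simp only [fderiv_inner_apply ℝ hp hd, fderiv_fun_const, Pi.zero_apply,
    _root_.zero_apply, radialExt_coe] at h3
  rw [real_inner_comm (partialD u (x : Amb d) j)]
  simp only [partialD] at h3 ⊢
  linarith

open Matrix in
theorem diffMatrix_transpose_mulVec (hu : IsSmooth u) (h1 : ∀ x, ‖u x‖ = 1) (x : Sph d) :
    (diffMatrix u x)ᵀ *ᵥ (u x) = 0 := by
  ext i
  have := inner_partialD_self hu h1 (coe_sph_ne_zero x) i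
  rw [radialExt_coe, inner_eq_dotProduct] at this
  exact this

theorem diffMatrix_const_add_smul (hu : IsSmooth u) (c : Amb d) (ρ : ℝ) (x : Sph d) :
    diffMatrix (fun x => c + ρ • u x) x = ρ • diffMatrix u x := by
  ext a b
  simp [diffMatrix, partialD_const_add_smul c hu ρ (coe_sph_ne_zero x)]

theorem dotProduct_self_of_norm (h1 : ∀ x, ‖u x‖ = 1) (x : Sph d) :
    (u x : Fin (d + 1) → ℝ) ⬝ᵥ u x = 1 := by
  rw [← inner_eq_dotProduct, real_inner_self_eq_norm_sq, h1, one_pow]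

-- All ∂ᵢu are orthogonal to u, so the linear form w ↦ det(ρA + w xᵀ) is a multiple of ⟨u, w⟩.
open Matrix in
theorem normalVec_const_add_smul (hu : IsSmooth u) (h1 : ∀ x, ‖u x‖ = 1) (c : Amb d) {ρ : ℝ}
    (hρ : 0 < ρ) (x : Sph d) (hB : (coneMatrix u x).det ≠ 0) :
    normalVec (fun x => c + ρ • u x) x = (ρ ^ d * (coneMatrix u x).det) • u x := by
  have hAx := diffMatrix_mulVec_self hu x
  have hx := dotProduct_self_coe x
  have hdet := det_smul_add_vecMulVec (u := u x) hx hAx hρ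
  ext k
  rw [normalVec_apply, diffMatrix_const_add_smul hu,
    det_add_vecMulVec_of_mulVec_eq (u := u x)
      (by rw [transpose_smul, smul_mulVec, diffMatrix_transpose_mulVec hu h1, smul_zero])
      (dotProduct_self_of_norm h1 x) ?_, hdet]
  · simp [coneMatrix]
  · rw [hdet]
    exact mul_ne_zero (pow_ne_zero _ hρ.ne') hB

-- The mixed terms vanish because uᵀA = 0, and the square of the rank one term is x xᵀ. Having the
-- metric as a Gram matrix makes the volume density the absolute value of a determinant.
open Matrix in
theorem pullbackMetric_const_add_smul (hu : IsSmooth u) (h1 : ∀ x, ‖u x‖ = 1) (c : Amb d) (ρ : ℝ)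
    (x : Sph d) :
    pullbackMetric (fun x => c + ρ • u x) x =
      (ρ • diffMatrix u x + vecMulVec (u x) (x : Amb d))ᵀ *
        (ρ • diffMatrix u x + vecMulVec (u x) (x : Amb d)) := by
  have hAu := diffMatrix_transpose_mulVec hu h1 x
  have hAu' : (u x : Fin (d + 1) → ℝ) ᵥ* diffMatrix u x = 0 := by rw [← mulVec_transpose, hAu]
  rw [pullbackMetric_eq, diffMatrix_const_add_smul hu]
  simp only [transpose_add, transpose_smul, transpose_vecMulVec, add_mul, mul_add, Matrix.smul_mul,
    Matrix.mul_smul, mul_vecMulVec, vecMulVec_mul, smul_mulVec, hAu, hAu',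
    smul_zero]
  simp [vecMulVec_mulVec, dotProduct_self_of_norm h1 x]

theorem volDensity_const_add_smul (hu : IsSmooth u) (h1 : ∀ x, ‖u x‖ = 1) (c : Amb d) {ρ : ℝ}
    (hρ : 0 < ρ) (x : Sph d) :
    volDensity (fun x => c + ρ • u x) x = ρ ^ d * |(coneMatrix u x).det| := by
  rw [volDensity, pullbackMetric_const_add_smul hu h1, Matrix.det_mul, Matrix.det_transpose,
    Real.sqrt_mul_self_eq_abs, det_smul_add_vecMulVec (dotProduct_self_coe x)
      (diffMatrix_mulVec_self hu x) hρ, abs_mul, abs_of_pos (pow_pos hρ d), coneMatrix]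

-- The unit normal is u, and umbilicity gives s = -ρ⁻¹(g - x xᵀ). As g fixes x, the matrix g⁻¹s is
-- -ρ⁻¹ times 1 - x xᵀ, whose trace is (d + 1) - 1.
open Matrix in
theorem trL_const_add_smul (hu : IsSmooth u) (h1 : ∀ x, ‖u x‖ = 1) (c : Amb d) {ρ : ℝ}
    (hρ : 0 < ρ) (x : Sph d) (hB : 0 < (coneMatrix u x).det) :
    trL (fun x => c + ρ • u x) x = -(d : ℝ) / ρ := by
  have hx := dotProduct_self_coe x
  have hx0 := coe_sph_ne_zero x
  have hAx := diffMatrix_mulVec_self hu x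
  have hν : unitNormal (fun x => c + ρ • u x) x = u x := by
    have hpos : 0 < ρ ^ d * (coneMatrix u x).det := mul_pos (pow_pos hρ d) hB
    rw [unitNormal, normalVec_const_add_smul hu h1 c hρ x hB.ne', norm_smul, h1, mul_one,
      Real.norm_of_nonneg hpos.le, smul_smul, inv_mul_cancel₀ hpos.ne', one_smul]
  set g := pullbackMetric (fun x => c + ρ • u x) x with hg
  have hgdet : IsUnit g.det := by
    rw [hg, pullbackMetric_const_add_smul hu h1, det_mul, det_transpose,
      det_smul_add_vecMulVec hx hAx hρ, isUnit_iff_ne_zero]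
    have : 0 < ρ ^ d * (coneMatrix u x).det := mul_pos (pow_pos hρ d) hB
    exact (mul_pos this this).ne'
  have hgx : g *ᵥ (x : Amb d) = (x : Amb d) := by
    rw [hg, pullbackMetric_eq, add_mulVec, ← mulVec_mulVec,
      diffMatrix_mulVec_self (isSmooth_const_add_smul c hu ρ), mulVec_zero, zero_add,
      vecMulVec_mulVec, hx]
    simp
  have hS : secondForm (fun x => c + ρ • u x) x =
      (-ρ⁻¹) • (g - vecMulVec (x : Amb d) (x : Amb d)) := by
    ext i j
    have he : (fun y => partialD (fun x => c + ρ • u x) y j) =ᶠ[𝓝 (x : Amb d)]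
        fun y => ρ • partialD u y j := by
      filter_upwards [isOpen_ne.mem_nhds hx0] with y hy using partialD_const_add_smul c hu ρ hy j
    have hp := (contDiffAt_partialD hu hx0 j).differentiableAt (by simp)
    simp only [secondForm, of_apply, hν, he.fderiv_eq]
    rw [fderiv_fun_const_smul hp, _root_.smul_apply, real_inner_smul_left,
      inner_fderiv_partialD hu h1]
    simp only [hg, pullbackMetric, partialD_const_add_smul c hu ρ hx0, real_inner_smul_left,
      real_inner_smul_right, Matrix.smul_apply, Matrix.sub_apply, of_apply, vecMulVec_apply, smul_eq_mul]
    field_simp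
    ring
  have hginv : g⁻¹ *ᵥ (x : Amb d) = (x : Amb d) := by
    conv_lhs => rw [← hgx]
    rw [mulVec_mulVec, nonsing_inv_mul _ hgdet, one_mulVec]
  rw [trL, ← hg, hS, Matrix.mul_smul, mul_sub, nonsing_inv_mul _ hgdet, trace_smul, trace_sub, trace_one,
    mul_vecMulVec, hginv, trace_vecMulVec, hx, Fintype.card_fin]
  push_cast
  simp only [smul_eq_mul, add_sub_cancel_right]
  field_simp

end UnitMap

/-! ### Polar coordinates, cone maps and invariance of the volume -/

theorem finrank_amb : Module.finrank ℝ (Amb d) = d + 1 := finrank_euclideanSpace_fin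

instance : IsFiniteMeasure (surf d) :=
  inferInstanceAs (IsFiniteMeasure (volume : Measure (Amb d)).toSphere)

/-- Integration in polar coordinates of a product of a radial and an angular function. -/
theorem integral_polar (α : ℝ → ℝ) (β : Sph d → ℝ) (F : Amb d → ℝ)
    (hF : ∀ y (hy : y ≠ 0), F y = α ‖y‖ * β (direction y hy)) :
    ∫ y, F y = (∫ r in Ioi (0 : ℝ), r ^ d * α r) * ∫ x, β x ∂(surf d) := by
  calc
    ∫ y, F y = ∫ y : ({(0)}ᶜ : Set (Amb d)), F y ∂((volume : Measure (Amb d)).comap (↑)) := by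
      rw [integral_subtype_comap (measurableSet_singleton _).compl fun x => F x,
        restrict_compl_singleton]
    _ = ∫ p, β p.1 * α p.2 ∂(surf d).prod (.volumeIoiPow (Module.finrank ℝ (Amb d) - 1)) := by
      rw [surf, ← (volume : Measure (Amb d)).measurePreserving_homeomorphUnitSphereProd.integral_comp
        (Homeomorph.measurableEmbedding _) (fun p => β p.1 * α p.2)]
      congr 1
      ext y
      rw [hF y y.2, mul_comm]
      congr 2
      · ext1
        simp [direction]
      · simp
    _ = (∫ x, β x ∂(surf d)) * ∫ r : Ioi (0 : ℝ), α r
          ∂(.volumeIoiPow (Module.finrank ℝ (Amb d) - 1)) :=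
      integral_prod_mul (fun x => β x) fun r : Ioi (0 : ℝ) => α r
    _ = _ := by
      rw [mul_comm]
      congr 1
      rw [finrank_amb, Nat.add_sub_cancel]
      simp only [Measure.volumeIoiPow, ENNReal.ofReal]
      rw [integral_withDensity_eq_integral_smul,
        integral_subtype_comap measurableSet_Ioi fun a ↦ Real.toNNReal (a ^ d) • α a,
        setIntegral_congr_fun measurableSet_Ioi fun x hx ↦ ?_]
      · rw [NNReal.smul_def, Real.coe_toNNReal _ (pow_nonneg (le_of_lt hx) _), smul_eq_mul]
      · exact (measurable_subtype_coe.pow_const _).real_toNNReal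

/-- The extension of `u` to `ℝⁿ` that is positively homogeneous of degree one. -/
def coneMap (u : Sph d → Amb d) (y : Amb d) : Amb d := ‖y‖ • radialExt u y

/-- The derivative of `coneMap u` along the ray through the point `x` of the sphere. -/
def coneDeriv (u : Sph d → Amb d) (x : Sph d) : Amb d →L[ℝ] Amb d :=
  fderiv ℝ (radialExt u) (x : Amb d) + (innerSL ℝ (x : Amb d)).smulRight (u x)

theorem norm_smul_direction (y : Amb d) (hy : y ≠ 0) : ‖y‖ • (direction y hy : Amb d) = y := by
  simp [direction, smul_smul, norm_ne_zero_iff.2 hy]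

theorem hasFDerivAt_norm {y : Amb d} (hy : y ≠ 0) :
    HasFDerivAt (fun z : Amb d => ‖z‖) (innerSL ℝ (direction y hy : Amb d)) y := by
  have h1 : DifferentiableAt ℝ (fun z : Amb d => ‖z‖) y :=
    (contDiffAt_norm ℝ hy (n := 1)).differentiableAt (by simp)
  have h2 := h1.hasFDerivAt
  convert! h2 using 1
  have h3 := (h2.mul h2)
  have h4 : (fun z : Amb d => ‖z‖) * (fun z : Amb d => ‖z‖) = fun z : Amb d => ‖z‖ ^ 2 := by
    ext z; simp [sq]
  have h5 := (hasStrictFDerivAt_norm_sq y).hasFDerivAt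
  rw [h4] at h3
  have h6 := h5.unique h3
  have hn : ‖y‖ ≠ 0 := norm_ne_zero_iff.2 hy
  ext v
  have h7 := congrArg (fun L : Amb d →L[ℝ] ℝ => L v) h6
  simp at h7
  simp only [direction, innerSL_apply_apply, real_inner_smul_left]
  field_simp
  linarith

/-- By homogeneity of degree one the derivative is constant along rays: the factor ‖y‖ cancels the
‖y‖⁻¹ in the derivative of the radial extension. -/
theorem hasFDerivAt_coneMap {u : Sph d → Amb d} (hu : IsSmooth u) {y : Amb d} (hy : y ≠ 0) :
    HasFDerivAt (coneMap u) (coneDeriv u (direction y hy)) y := by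
  have h1 := (hasFDerivAt_norm hy).smul (differentiableAt_radialExt hu hy).hasFDerivAt
  convert! h1 using 1
  have h2 := fderiv_radialExt_smul u (norm_pos_iff.2 hy) (direction y hy : Amb d)
  rw [norm_smul_direction] at h2
  rw [coneDeriv, h2, smul_smul, mul_inv_cancel₀ (norm_ne_zero_iff.2 hy), one_smul,
    radialExt_of_ne _ hy]

theorem coneDeriv_det (u : Sph d → Amb d) (x : Sph d) :
    (coneDeriv u x).det = (coneMatrix u x).det := by
  rw [ContinuousLinearMap.det, ← LinearMap.det_toMatrix (EuclideanSpace.basisFun _ ℝ).toBasis]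
  congr 1
  ext a b
  rw [LinearMap.toMatrix_apply]
  simp [coneDeriv, coneMatrix, diffMatrix, partialD, stdVec, Matrix.vecMulVec, mul_comm,
    EuclideanSpace.inner_single_right]

theorem norm_coneMap {u : Sph d → Amb d} (h1 : ∀ x, ‖u x‖ = 1) (y : Amb d) :
    ‖coneMap u y‖ = ‖y‖ := by
  by_cases hy : y = 0
  · simp [hy, coneMap]
  · rw [coneMap, norm_smul, norm_norm, radialExt_of_ne _ hy, h1, mul_one]

theorem coneMap_comp {φ ψ : Sph d → Sph d} (h : ∀ x, ψ (φ x) = x) (y : Amb d) :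
    coneMap (fun x => (ψ x : Amb d)) (coneMap (fun x => (φ x : Amb d)) y) = y := by
  by_cases hy : y = 0
  · simp [hy, coneMap]
  · rw [coneMap, norm_coneMap fun x => norm_coe_sph _, coneMap,
      radialExt_smul _ (norm_pos_iff.2 hy), radialExt_of_ne _ hy, radialExt_coe, h,
      norm_smul_direction]

theorem isSmooth_coe_comp {φ : Sph d → Sph d} (hφ : ContMDiff (𝓡 d) (𝓡 d) ∞ φ) :
    IsSmooth (fun x => (φ x : Amb d)) :=
  ContMDiff.comp isSmooth_coe hφ

/-- The cone maps of φ and φ⁻¹ are inverse to each other, so by the chain rule the product of their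
Jacobian determinants is 1. -/
theorem coneMatrix_det_ne_zero (φ : Sph d ≃ₘ^∞⟮𝓡 d, 𝓡 d⟯ Sph d) (x : Sph d) :
    (coneMatrix (fun x => (φ x : Amb d)) x).det ≠ 0 := by
  have hx := coe_sph_ne_zero x
  have h1 := hasFDerivAt_coneMap (isSmooth_coe_comp φ.contMDiff) hx
  have hy : coneMap (fun x => (φ x : Amb d)) (x : Amb d) ≠ 0 := by
    rw [← norm_ne_zero_iff, norm_coneMap fun x => norm_coe_sph _]
    exact norm_ne_zero_iff.2 hx
  have h2 := hasFDerivAt_coneMap (isSmooth_coe_comp φ.symm.contMDiff) hy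
  have h3 := h2.comp _ h1
  have h4 : coneMap (fun x => (φ.symm x : Amb d)) ∘ coneMap (fun x => (φ x : Amb d)) = id :=
    funext (coneMap_comp fun x => φ.symm_apply_apply x)
  rw [h4] at h3
  have h5 := h3.unique (hasFDerivAt_id _)
  have h6 := congrArg ContinuousLinearMap.det h5
  rw [direction_coe] at h6
  rw [← coneDeriv_det]
  intro h0
  simp only [ContinuousLinearMap.det, ContinuousLinearMap.toLinearMap_comp, LinearMap.det_comp,
    ContinuousLinearMap.coe_id, LinearMap.det_id] at h6 h0
  rw [h0, mul_zero] at h6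
  exact zero_ne_one h6

/-- The normal vector of φ is det(`coneMatrix`) φ, so preserving the orientation means precisely
that this determinant is positive. -/
theorem coneMatrix_det_pos {φ : Sph d ≃ₘ^∞⟮𝓡 d, 𝓡 d⟯ Sph d} (hφ : IsOrientationPreserving φ)
    (x : Sph d) : 0 < (coneMatrix (fun x => (φ x : Amb d)) x).det := by
  have h := normalVec_const_add_smul (isSmooth_coe_comp φ.contMDiff) (fun x => norm_coe_sph _) 0
    one_pos x (coneMatrix_det_ne_zero φ x)
  simp only [zero_add, one_smul, one_pow, one_mul] at h
  have h2 := hφ x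
  rw [h, real_inner_smul_left, real_inner_self_eq_norm_sq, norm_coe_sph, one_pow, mul_one] at h2
  exact h2

/-- The cone map preserves norms and hence permutes the punctured unit ball. Change of variables
there, written in polar coordinates, has the same nonzero radial factor on both sides; cancelling it
leaves the identity on the sphere. The origin is removed because the cone map need not be
differentiable there. -/
theorem integral_abs_coneMatrix_det (φ : Sph d ≃ₘ^∞⟮𝓡 d, 𝓡 d⟯ Sph d) :
    ∫ x, |(coneMatrix (fun x => (φ x : Amb d)) x).det| ∂(surf d) = (surf d).real univ := by
  set u : Sph d → Amb d := fun x => (φ x : Amb d)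
  have hn : ∀ x, ‖u x‖ = 1 := fun x => norm_coe_sph _
  set s : Set (Amb d) := ball 0 1 \ {0} with hs
  have hsm : MeasurableSet s := measurableSet_ball.diff (measurableSet_singleton _)
  have hleft : ∀ y, coneMap (fun x => (φ.symm x : Amb d)) (coneMap u y) = y :=
    coneMap_comp fun x => φ.symm_apply_apply x
  have hright : ∀ y, coneMap u (coneMap (fun x => (φ.symm x : Amb d)) y) = y :=
    coneMap_comp fun x => φ.apply_symm_apply x
  have hmem : ∀ y z : Amb d, ‖y‖ = ‖z‖ → y ∈ s → z ∈ s := by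
    intro y z h hy
    simp only [hs, Set.mem_sdiff, mem_ball_zero_iff, mem_singleton_iff, ← norm_eq_zero (a := y)] at hy
    simp only [hs, Set.mem_sdiff, mem_ball_zero_iff, mem_singleton_iff, ← norm_eq_zero (a := z)]
    rwa [← h]
  have himg : coneMap u '' s = s := by
    ext y
    constructor
    · rintro ⟨z, hz, rfl⟩
      exact hmem z _ (norm_coneMap hn z).symm hz
    · intro hy
      exact ⟨_, hmem y _ (norm_coneMap (fun x => norm_coe_sph _) y).symm hy, hright y⟩
  have hinj : InjOn (coneMap u) s := (Function.LeftInverse.injective hleft).injOn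
  let D : Amb d → (Amb d →L[ℝ] Amb d) := fun y =>
    if hy : y = 0 then 0 else coneDeriv u (direction y hy)
  have hD : ∀ y ∈ s, HasFDerivWithinAt (coneMap u) (D y) s y := by
    intro y hy
    have hy0 : y ≠ 0 := hy.2
    simp only [D, hy0, dif_neg, not_false_eq_true]
    exact (hasFDerivAt_coneMap (isSmooth_coe_comp φ.contMDiff) hy0).hasFDerivWithinAt
  have hcv := integral_image_eq_integral_abs_det_fderiv_smul volume hsm hD hinj (fun _ => (1 : ℝ))
  rw [himg] at hcv
  let α : ℝ → ℝ := (Iio 1).indicator 1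
  have hα : ∀ y : Amb d, y ≠ 0 → s.indicator (1 : Amb d → ℝ) y = α ‖y‖ := by
    intro y hy
    simp [α, indicator, hs, hy]
  have e1 : ∫ y in s, (1 : ℝ) = (∫ r in Ioi (0 : ℝ), r ^ d * α r) * ∫ x, (1 : ℝ) ∂(surf d) := by
    rw [← integral_indicator hsm]
    refine integral_polar α (fun _ => 1) _ fun y hy => ?_
    rw [mul_one, ← hα y hy]
    rfl
  have e2 : ∫ y in s, |(D y).det| • (1 : ℝ) =
      (∫ r in Ioi (0 : ℝ), r ^ d * α r) * ∫ x, |(coneMatrix u x).det| ∂(surf d) := by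
    rw [← integral_indicator hsm]
    refine integral_polar α (fun x => |(coneMatrix u x).det|) _ fun y hy => ?_
    rw [← hα y hy, ← coneDeriv_det]
    by_cases hys : y ∈ s
    · simp [hys, D, hy]
    · simp [hys]
  have hpos : (∫ r in Ioi (0 : ℝ), r ^ d * α r) ≠ 0 := by
    have : ∀ r : ℝ, r ^ d * α r = (Iio (1 : ℝ)).indicator (fun r => r ^ d) r := by
      intro r; by_cases hr : r < 1 <;> simp [α, hr]
    simp only [this]
    rw [setIntegral_indicator measurableSet_Iio, Ioi_inter_Iio, ← integral_Ioc_eq_integral_Ioo,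
      ← intervalIntegral.integral_of_le zero_le_one, integral_pow]
    have : (0 : ℝ) < d + 1 := by positivity
    simp [this.ne']
  rw [e1, e2] at hcv
  have := mul_left_cancel₀ hpos hcv
  rw [← this]
  simp

theorem continuous_partialD {f : Sph d → Amb d} (hf : IsSmooth f) (i : Fin (d + 1)) :
    Continuous fun x : Sph d => partialD f (x : Amb d) i := by
  rw [continuous_iff_continuousAt]
  intro x
  exact ContinuousAt.comp (f := fun x : Sph d => (x : Amb d))
    (contDiffAt_partialD hf (coe_sph_ne_zero x) i).continuousAt continuous_subtype_val.continuousAt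

theorem continuous_coord {f : Sph d → Amb d} (hf : Continuous f) (i : Fin (d + 1)) :
    Continuous fun x => f x i :=
  (EuclideanSpace.proj (𝕜 := ℝ) i).continuous.comp hf

theorem continuous_coneMatrix_det {u : Sph d → Amb d} (hu : IsSmooth u) :
    Continuous fun x => (coneMatrix u x).det := by
  refine Continuous.matrix_det (continuous_matrix fun a b => ?_)
  simp only [coneMatrix, diffMatrix, Matrix.add_apply, Matrix.of_apply, Matrix.vecMulVec_apply]
  exact (continuous_coord (continuous_partialD hu b) a).add
    ((continuous_coord (isSmooth_continuous hu) a).mul (continuous_coord continuous_subtype_val b))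

theorem coneMatrix_coe (x : Sph d) : coneMatrix (fun x : Sph d => (x : Amb d)) x = 1 := by
  have h1 : coneMap (fun x : Sph d => (x : Amb d)) = id := by
    ext1 y
    by_cases hy : y = 0
    · simp [hy, coneMap]
    · rw [coneMap, radialExt_of_ne _ hy, norm_smul_direction]; rfl
  have h2 := hasFDerivAt_coneMap isSmooth_coe (coe_sph_ne_zero x)
  rw [h1] at h2
  have h3 := h2.unique (hasFDerivAt_id _)
  rw [direction_coe] at h3
  ext a b
  have h4 := congrArg (fun L : Amb d →L[ℝ] Amb d => L (stdVec b) a) h3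
  simp only [coneDeriv, stdVec] at h4
  simpa [coneMatrix, diffMatrix, partialD, stdVec, Matrix.vecMulVec, mul_comm, Matrix.one_apply,
    EuclideanSpace.inner_single_right, Pi.single_apply] using h4

/-! ### Round spheres: volume, tangent map, shape -/

theorem surf_real_univ (d : ℕ) : (surf d).real univ =
    (d + 1) * Real.pi ^ (((d : ℝ) + 1) / 2) / Real.Gamma (1 + ((d : ℝ) + 1) / 2) := by
  rw [surf, Measure.toSphere_real_apply_univ, finrank_amb, measureReal_def,
    EuclideanSpace.volume_ball]
  have hG : 0 < Real.Gamma (((d : ℝ) + 1) / 2 + 1) := Real.Gamma_pos_of_pos (by positivity)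
  have hpi : Real.sqrt Real.pi ^ (d + 1) = Real.pi ^ (((d : ℝ) + 1) / 2) := by
    rw [Real.sqrt_eq_rpow, ← Real.rpow_natCast, ← Real.rpow_mul Real.pi_pos.le]
    congr 1
    push_cast
    ring
  simp only [ENNReal.ofReal_one, one_pow, one_mul, Fintype.card_fin, hpi]
  push_cast
  rw [ENNReal.toReal_ofReal (by positivity), add_comm 1, mul_div_assoc]

theorem sphereVol_eq (d : ℕ) (ρ : ℝ) : sphereVol (d + 1) ρ = (surf d).real univ * ρ ^ d := by
  rw [sphereVol, surf_real_univ, Nat.add_sub_cancel]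
  push_cast
  ring

theorem surf_real_univ_pos (d : ℕ) : 0 < (surf d).real univ := by
  rw [surf_real_univ]
  have hG : 0 < Real.Gamma (1 + ((d : ℝ) + 1) / 2) := Real.Gamma_pos_of_pos (by positivity)
  have := Real.pi_pos
  positivity

theorem sphereVol_pos (d : ℕ) {ρ : ℝ} (hρ : 0 < ρ) : 0 < sphereVol (d + 1) ρ := by
  rw [sphereVol_eq]
  exact mul_pos (surf_real_univ_pos d) (pow_pos hρ d)

theorem mfderiv_roundSphere (x₀ : Amb d) (r : ℝ) (x : Sph d) (X : TangentSpace (𝓡 d) x) :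
    (mfderiv (𝓡 d) 𝓘(ℝ, Amb d) (roundSphere x₀ r) x X : Amb d) =
      r • mvfderiv (𝓡 d) ((↑) : Sph d → Amb d) x X := by
  have hg : HasFDerivAt (fun y : Amb d => x₀ + r • y) (r • ContinuousLinearMap.id ℝ (Amb d)) x :=
    ((hasFDerivAt_id _).const_smul r).const_add x₀
  have h1 : HasMFDerivAt (𝓡 d) 𝓘(ℝ, Amb d) (fun x : Sph d => (x : Amb d)) x _ :=
    (isSmooth_coe.mdifferentiable (by simp) x).hasMFDerivAt
  have h2 := HasMFDerivAt.comp x hg.hasMFDerivAt h1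
  have h3 : roundSphere x₀ r = (fun y : Amb d => x₀ + r • y) ∘ fun x : Sph d => (x : Amb d) := rfl
  rw [h3, h2.mfderiv]
  rfl

theorem isSmooth_roundSphere (x₀ : Amb d) (r : ℝ) : IsSmooth (roundSphere x₀ r) :=
  isSmooth_const_add_smul x₀ isSmooth_coe r

theorem isImm_roundSphere (x₀ : Amb d) {r : ℝ} (hr : 0 < r) : IsImm (roundSphere x₀ r) := by
  refine ⟨isSmooth_roundSphere x₀ r, fun x X Y hXY => ?_⟩
  have := Fact.mk (@finrank_euclideanSpace_fin ℝ _ (d + 1))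
  have h1 : r • mvfderiv (𝓡 d) ((↑) : Sph d → Amb d) x X =
      r • mvfderiv (𝓡 d) ((↑) : Sph d → Amb d) x Y := by
    rw [← mfderiv_roundSphere x₀, ← mfderiv_roundSphere x₀]
    exact hXY
  exact injective_mvfderiv_subtypeVal_sphere x (smul_right_injective _ hr.ne' h1)

theorem inner_mfderiv_roundSphere (x₀ : Amb d) (r : ℝ) (x : Sph d) (X : TangentSpace (𝓡 d) x) :
    inner ℝ (x : Amb d) (mfderiv (𝓡 d) 𝓘(ℝ, Amb d) (roundSphere x₀ r) x X : Amb d) = 0 := by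
  have := Fact.mk (@finrank_euclideanSpace_fin ℝ _ (d + 1))
  have h1 : mvfderiv (𝓡 d) ((↑) : Sph d → Amb d) x X ∈
      (ℝ ∙ (x : Amb d))ᗮ := by
    rw [← range_mvfderiv_subtypeVal (n := d) x]
    exact ⟨X, rfl⟩
  rw [mfderiv_roundSphere, real_inner_smul_right, Submodule.mem_orthogonal_singleton_iff_inner_right.1 h1,
    mul_zero]

theorem range_roundSphere (x₀ : Amb d) {r : ℝ} (hr : 0 < r) :
    range (roundSphere x₀ r) = sphere x₀ r := by
  ext y
  rw [mem_sphere_iff_norm]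
  constructor
  · rintro ⟨x, rfl⟩
    rw [roundSphere, add_sub_cancel_left, norm_smul, norm_coe_sph, mul_one,
      Real.norm_of_nonneg hr.le]
  · intro hy
    have h0 : y - x₀ ≠ 0 := norm_ne_zero_iff.1 (by rw [hy]; exact hr.ne')
    refine ⟨direction (y - x₀) h0, ?_⟩
    have := norm_smul_direction (y - x₀) h0
    rw [hy] at this
    rw [roundSphere, this, add_sub_cancel]

theorem isOrientationPreserving_refl :
    IsOrientationPreserving (Diffeomorph.refl (𝓡 d) (Sph d) ∞) := by
  intro x
  have h := normalVec_const_add_smul isSmooth_coe norm_coe_sph 0 one_pos x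
    (by rw [coneMatrix_coe, Matrix.det_one]; exact one_ne_zero)
  simp only [zero_add, one_smul, one_pow, one_mul, coneMatrix_coe, Matrix.det_one] at h
  have h2 : (fun y => ((Diffeomorph.refl (𝓡 d) (Sph d) ∞ y : Sph d) : Amb d)) =
      fun y : Sph d => (y : Amb d) := rfl
  rw [h2, h]
  simp

theorem sameShape_refl (f : Sph d → Amb d) : SameShape f f :=
  ⟨Diffeomorph.refl (𝓡 d) (Sph d) ∞, isOrientationPreserving_refl, fun _ => rfl⟩

theorem instNonempty_sph : Nonempty (Sph d) :=
  ⟨⟨stdVec 0, by simp [stdVec]⟩⟩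

theorem sameShape_roundSphere_iff (x₀ : Amb d) {r r' : ℝ} (hr : 0 < r) (hr' : 0 < r') :
    SameShape (roundSphere x₀ r) (roundSphere x₀ r') ↔ r = r' := by
  constructor
  · rintro ⟨φ, -, h⟩
    obtain ⟨x⟩ := instNonempty_sph (d := d)
    have h1 := congrArg norm (add_left_cancel (h x))
    simpa [norm_smul, abs_of_pos hr, abs_of_pos hr'] using h1
  · rintro rfl
    exact sameShape_refl _

/-! ### The metric at reparametrized round spheres -/

/-- The value of the weight on round spheres of radius `ρ`. -/
def sphereWeight (Φ : ℝ → ℝ → ℝ) (d : ℕ) (ρ : ℝ) : ℝ := Φ (sphereVol (d + 1) ρ) (-(d : ℝ) / ρ)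

section Reparametrized

variable {φ : Sph d ≃ₘ^∞⟮𝓡 d, 𝓡 d⟯ Sph d}

theorem volDensity_reparametrized (hφ : IsOrientationPreserving φ) (c : Amb d) {ρ : ℝ} (hρ : 0 < ρ)
    (x : Sph d) : volDensity (fun x => c + ρ • (φ x : Amb d)) x =
      ρ ^ d * (coneMatrix (fun x => (φ x : Amb d)) x).det := by
  rw [volDensity_const_add_smul (u := fun x => (φ x : Amb d)) (isSmooth_coe_comp φ.contMDiff)
    (fun x => norm_coe_sph _) c hρ, abs_of_pos (coneMatrix_det_pos hφ x)]

theorem integral_coneMatrix_det (hφ : IsOrientationPreserving φ) :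
    ∫ x, (coneMatrix (fun x => (φ x : Amb d)) x).det ∂(surf d) = (surf d).real univ := by
  rw [← integral_abs_coneMatrix_det φ]
  simp only [abs_of_pos (coneMatrix_det_pos hφ _)]

theorem Vol_reparametrized (hφ : IsOrientationPreserving φ) (c : Amb d) {ρ : ℝ} (hρ : 0 < ρ) :
    Vol (fun x => c + ρ • (φ x : Amb d)) = sphereVol (d + 1) ρ := by
  simp only [Vol, volDensity_reparametrized hφ c hρ]
  rw [integral_const_mul, integral_coneMatrix_det hφ, sphereVol_eq, mul_comm]

theorem trL_reparametrized (hφ : IsOrientationPreserving φ) (c : Amb d) {ρ : ℝ} (hρ : 0 < ρ)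
    (x : Sph d) : trL (fun x => c + ρ • (φ x : Amb d)) x = -(d : ℝ) / ρ :=
  trL_const_add_smul (u := fun x => (φ x : Amb d)) (isSmooth_coe_comp φ.contMDiff)
    (fun _ => norm_coe_sph _) c hρ x (coneMatrix_det_pos hφ x)

theorem G_reparametrized (hφ : IsOrientationPreserving φ) (Φ : ℝ → ℝ → ℝ) (c : Amb d) {ρ : ℝ}
    (hρ : 0 < ρ) (h k : Sph d → Amb d) :
    G Φ (fun x => c + ρ • (φ x : Amb d)) h k = sphereWeight Φ d ρ * ρ ^ d *
      ∫ x, inner ℝ (h x) (k x) * (coneMatrix (fun x => (φ x : Amb d)) x).det ∂(surf d) := by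
  simp only [G, Vol_reparametrized hφ c hρ, trL_reparametrized hφ c hρ,
    volDensity_reparametrized hφ c hρ]
  rw [← integral_const_mul]
  congr 1
  ext x
  rw [sphereWeight]
  ring

/-- The Jacobian of φ enters only through its integral, which is the area of the unit sphere, so the
parametrization drops out. -/
theorem G_reparametrized_normal (hφ : IsOrientationPreserving φ) (Φ : ℝ → ℝ → ℝ) (c : Amb d)
    {ρ : ℝ} (hρ : 0 < ρ) (a b : ℝ) :
    G Φ (fun x => c + ρ • (φ x : Amb d)) (fun x => a • (φ x : Amb d)) (fun x => b • (φ x : Amb d)) =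
      a * b * (sphereWeight Φ d ρ * sphereVol (d + 1) ρ) := by
  rw [G_reparametrized hφ Φ c hρ]
  simp only [real_inner_smul_left, real_inner_smul_right, real_inner_self_eq_norm_sq, norm_coe_sph,
    one_pow, mul_one]
  rw [integral_const_mul, integral_coneMatrix_det hφ, sphereVol_eq]
  ring

end Reparametrized

theorem roundSphere_eq_refl (c : Amb d) (ρ : ℝ) : roundSphere c ρ =
    fun x => c + ρ • ((Diffeomorph.refl (𝓡 d) (Sph d) ∞ x : Sph d) : Amb d) := rfl

theorem Vol_roundSphere (c : Amb d) {ρ : ℝ} (hρ : 0 < ρ) :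
    Vol (roundSphere c ρ) = sphereVol (d + 1) ρ := by
  rw [roundSphere_eq_refl, Vol_reparametrized isOrientationPreserving_refl c hρ]

theorem trL_roundSphere (c : Amb d) {ρ : ℝ} (hρ : 0 < ρ) (x : Sph d) :
    trL (roundSphere c ρ) x = -(d : ℝ) / ρ := by
  rw [roundSphere_eq_refl, trL_reparametrized isOrientationPreserving_refl c hρ]

theorem G_roundSphere (Φ : ℝ → ℝ → ℝ) (c : Amb d) {ρ : ℝ} (hρ : 0 < ρ) (h k : Sph d → Amb d) :
    G Φ (roundSphere c ρ) h k =
      sphereWeight Φ d ρ * ρ ^ d * ∫ x, inner ℝ (h x) (k x) ∂(surf d) := by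
  rw [roundSphere_eq_refl, G_reparametrized isOrientationPreserving_refl Φ c hρ]
  have : ∀ x : Sph d, (coneMatrix (fun x =>
      ((Diffeomorph.refl (𝓡 d) (Sph d) ∞ x : Sph d) : Amb d)) x).det = 1 := fun x => by
    exact (congrArg Matrix.det (coneMatrix_coe x)).trans Matrix.det_one
  simp only [this, mul_one]

/-! ### The divergence theorem on the sphere -/

/-- The divergence `∑ ∂ᵢVᵢ` of a vector field on `ℝⁿ`. -/
def divergence (V : Amb d → Amb d) (y : Amb d) : ℝ := ∑ i, (fderiv ℝ V y (stdVec i)) i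

/-- A smooth bump function of `‖y‖²` that is supported in a shell around the unit sphere. -/
def shellBump : ContDiffBump (1 : ℝ) := ⟨1 / 4, 1 / 2, by norm_num, by norm_num⟩

theorem shellBump_eventuallyEq_zero :
    (fun y : Amb d => shellBump (‖y‖ ^ 2)) =ᶠ[𝓝 0] fun _ => 0 := by
  have : ∀ᶠ y : Amb d in 𝓝 0, ‖y‖ ^ 2 < 1 / 2 := by
    have hc : Continuous fun y : Amb d => ‖y‖ ^ 2 := by fun_prop
    refine hc.continuousAt.eventually_lt continuousAt_const ?_
    norm_num
  filter_upwards [this] with y hy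
  apply shellBump.zero_of_le_dist
  rw [Real.dist_eq, abs_sub_comm]
  refine le_trans ?_ (le_abs_self _)
  simp only [shellBump]
  linarith

theorem hasCompactSupport_shellBump :
    HasCompactSupport (fun y : Amb d => shellBump (‖y‖ ^ 2)) := by
  refine HasCompactSupport.of_support_subset_isCompact (isCompact_closedBall (0 : Amb d) 2) ?_
  intro y hy
  rw [mem_closedBall_zero_iff]
  by_contra h
  refine hy (shellBump.zero_of_le_dist ?_)
  rw [Real.dist_eq]
  refine le_trans ?_ (le_abs_self _)
  simp only [shellBump]
  nlinarith

/-- Fields that are constant on rays are singular at the origin; a cutoff that vanishes near 0 makes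
the products globally continuous, hence integrable. -/
theorem continuous_mul_of_eventuallyEq_zero {η g : Amb d → ℝ} (hη : Continuous η)
    (h0 : η =ᶠ[𝓝 0] fun _ => 0) (hg : ∀ y, y ≠ 0 → ContinuousAt g y) :
    Continuous fun y => η y * g y := by
  rw [continuous_iff_continuousAt]
  intro y
  by_cases hy : y = 0
  · subst hy
    have : (fun y => η y * g y) =ᶠ[𝓝 0] fun _ => 0 := by
      filter_upwards [h0] with z hz
      rw [hz, zero_mul]
    exact continuousAt_const.congr this.symm
  · exact hη.continuousAt.mul (hg y hy)

theorem fderiv_smul_of_homogeneous {V : Amb d → Amb d} (hom : ∀ t : ℝ, 0 < t → ∀ y, V (t • y) = V y)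
    {t : ℝ} (ht : 0 < t) (y : Amb d) : fderiv ℝ V (t • y) = t⁻¹ • fderiv ℝ V y := by
  have h : (fun z => V (t • z)) = V := funext fun z => hom t ht z
  have h2 := fderiv_comp_smul (𝕜 := ℝ) (f := V) (x := y) t
  rw [h] at h2
  rw [h2, smul_smul, inv_mul_cancel₀ ht.ne', one_smul]

theorem divergence_of_homogeneous {V : Amb d → Amb d}
    (hom : ∀ t : ℝ, 0 < t → ∀ y, V (t • y) = V y) {y : Amb d} (hy : y ≠ 0) :
    divergence V y = ‖y‖⁻¹ * divergence V (direction y hy) := by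
  have := fderiv_smul_of_homogeneous hom (norm_pos_iff.2 hy) (direction y hy : Amb d)
  rw [norm_smul_direction] at this
  simp [divergence, this, Finset.mul_sum]

/-- This is integration by parts in each coordinate, with the gradient of the cutoff equal to
2χ'(‖y‖²) y. The derivative of V is needed only on the topological support of the cutoff, which
avoids the origin. -/
theorem integral_shellBump_mul_divergence {V : Amb d → Amb d}
    (hV : ∀ y, y ≠ 0 → ContDiffAt ℝ 1 V y) :
    ∫ y, shellBump (‖y‖ ^ 2) * divergence V y =
      - ∫ y, 2 * deriv shellBump (‖y‖ ^ 2) * inner ℝ y (V y) := by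
  set η : Amb d → ℝ := fun y => shellBump (‖y‖ ^ 2) with hη
  have hηs : ContDiff ℝ ∞ η := shellBump.contDiff.comp (contDiff_norm_sq ℝ)
  have hη0 : η =ᶠ[𝓝 0] fun _ => 0 := shellBump_eventuallyEq_zero
  have hηc : HasCompactSupport η := hasCompactSupport_shellBump
  have hη' : ∀ y, fderiv ℝ η y = (2 * deriv shellBump (‖y‖ ^ 2)) • innerSL ℝ y := by
    intro y
    have h1 : HasDerivAt shellBump (deriv shellBump (‖y‖ ^ 2)) (‖y‖ ^ 2) :=
      ((shellBump.contDiff (n := 1)).differentiable (by simp) _).hasDerivAt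
    have h2 := h1.comp_hasFDerivAt y (hasStrictFDerivAt_norm_sq y).hasFDerivAt
    have h3 : fderiv ℝ η y = _ := h2.fderiv
    rw [h3]
    ext v
    simp
    ring
  have hη'c : ∀ i : Fin (d + 1), Continuous fun y => fderiv ℝ η y (stdVec i) := fun i =>
    (hηs.continuous_fderiv (by simp)).clm_apply continuous_const
  have hη'0 : ∀ i : Fin (d + 1), (fun y => fderiv ℝ η y (stdVec i)) =ᶠ[𝓝 0] fun _ => 0 := by
    intro i
    have := hη0.fderiv (𝕜 := ℝ)
    filter_upwards [this] with y hy
    rw [hy]; simp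
  have hη's : ∀ i : Fin (d + 1), HasCompactSupport fun y => fderiv ℝ η y (stdVec i) := fun i =>
    (hηc.fderiv (𝕜 := ℝ)).comp_left (g := fun L : Amb d →L[ℝ] ℝ => L (stdVec i)) rfl
  have hVd : ∀ y, y ≠ 0 → DifferentiableAt ℝ V y := fun y hy =>
    (hV y hy).differentiableAt (by simp)
  have hVi : ∀ (i : Fin (d + 1)) y, y ≠ 0 →
      HasFDerivAt (fun y => V y i) ((EuclideanSpace.proj i).comp (fderiv ℝ V y)) y := fun i y hy =>
    (EuclideanSpace.proj (𝕜 := ℝ) i).hasFDerivAt.comp y (hVd y hy).hasFDerivAt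
  have hVc : ∀ (i : Fin (d + 1)) y, y ≠ 0 → ContinuousAt (fun y => V y i) y := fun i y hy =>
    (hVi i y hy).continuousAt
  have hVc' : ∀ (i : Fin (d + 1)) y, y ≠ 0 →
      ContinuousAt (fun y => (fderiv ℝ V y (stdVec i)) i) y := by
    intro i y hy
    have h1 : ContinuousAt (fderiv ℝ V) y :=
      ((hV y hy).fderiv_right (m := 0) (by simp)).continuousAt
    exact (EuclideanSpace.proj (𝕜 := ℝ) i).continuous.continuousAt.comp
      (h1.clm_apply continuousAt_const)
  have hts : ∀ y ∈ tsupport η, y ≠ 0 := by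
    rintro y hy rfl
    exact notMem_tsupport_iff_eventuallyEq.2 hη0 hy
  have i1 : ∀ i, Integrable (fun y => fderiv ℝ η y (stdVec i) * V y i) := fun i =>
    (continuous_mul_of_eventuallyEq_zero (hη'c i) (hη'0 i) (hVc i)).integrable_of_hasCompactSupport
      (hη's i).mul_right
  have i2 : ∀ i, Integrable (fun y => η y * (fderiv ℝ V y (stdVec i)) i) := fun i =>
    (continuous_mul_of_eventuallyEq_zero hηs.continuous hη0
      (hVc' i)).integrable_of_hasCompactSupport hηc.mul_right
  have i3 : ∀ i, Integrable (fun y => η y * V y i) := fun i =>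
    (continuous_mul_of_eventuallyEq_zero hηs.continuous hη0
      (hVc i)).integrable_of_hasCompactSupport hηc.mul_right
  have key : ∀ i, ∫ y, η y * (fderiv ℝ V y (stdVec i)) i = - ∫ y, fderiv ℝ η y (stdVec i) * V y i :=
    fun i => integral_bilinear_hasLineDerivAt_right_eq_neg_left_of_integrable
      (B := ContinuousLinearMap.mul ℝ ℝ) (i1 i) (i2 i) (i3 i)
      (fun y _ => ((hηs.differentiable (by simp) y).hasFDerivAt.hasLineDerivAt (stdVec i)))
      (fun y hy => (hVi i y (hts y hy)).hasLineDerivAt (stdVec i))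
  have e1 : ∀ y : Amb d, shellBump (‖y‖ ^ 2) * divergence V y = ∑ i, η y * (fderiv ℝ V y (stdVec i)) i := fun y => by
    rw [divergence, Finset.mul_sum]
  have e2 : ∀ y, 2 * deriv shellBump (‖y‖ ^ 2) * inner ℝ y (V y) =
      ∑ i, fderiv ℝ η y (stdVec i) * V y i := fun y => by
    simp only [hη', inner_eq_dotProduct, dotProduct, Finset.mul_sum]
    refine Finset.sum_congr rfl fun i _ => ?_
    simp [stdVec, EuclideanSpace.inner_single_right]
    ring
  simp only [e1, e2]
  rw [integral_finsetSum _ fun i _ => i2 i, integral_finsetSum _ fun i _ => i1 i,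
    ← Finset.sum_neg_distrib]
  exact Finset.sum_congr rfl fun i _ => key i

theorem divergence_radialExt_coe (x : Sph d) :
    divergence (radialExt fun x : Sph d => (x : Amb d)) (x : Amb d) = d := by
  have h := coneMatrix_coe x
  have h2 : divergence (radialExt fun x : Sph d => (x : Amb d)) (x : Amb d) =
      (diffMatrix (fun x : Sph d => (x : Amb d)) x).trace := rfl
  have h3 := congrArg Matrix.trace h
  rw [coneMatrix, Matrix.trace_add, Matrix.trace_vecMulVec, dotProduct_self_coe, Matrix.trace_one,
    Fintype.card_fin] at h3
  rw [h2]
  push_cast at h3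
  linarith

/-- The divergence theorem on the unit sphere, for the extension that is constant on rays of a
vector field along the sphere. -/
theorem integral_divergence {V : Amb d → Amb d} (hV : ∀ y, y ≠ 0 → ContDiffAt ℝ 1 V y)
    (hom : ∀ t : ℝ, 0 < t → ∀ y, V (t • y) = V y) :
    ∫ x : Sph d, divergence V (x : Amb d) ∂(surf d) =
      d * ∫ x : Sph d, inner ℝ (x : Amb d) (V x) ∂(surf d) := by
  set c₁ : ℝ := ∫ r in Ioi (0 : ℝ), r ^ d * (shellBump (r ^ 2) * r⁻¹) with hc₁
  set c₂ : ℝ := ∫ r in Ioi (0 : ℝ), r ^ d * (2 * deriv shellBump (r ^ 2) * r) with hc₂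
  -- Polar coordinates separate the integration by parts formula into universal radial constants and
  -- integrals over the sphere.
  have main : ∀ W : Amb d → Amb d, (∀ y, y ≠ 0 → ContDiffAt ℝ 1 W y) →
      (∀ t : ℝ, 0 < t → ∀ y, W (t • y) = W y) →
      c₁ * ∫ x : Sph d, divergence W (x : Amb d) ∂(surf d) =
        - (c₂ * ∫ x : Sph d, inner ℝ (x : Amb d) (W x) ∂(surf d)) := by
    intro W hW homW
    have h := integral_shellBump_mul_divergence hW
    rw [integral_polar (fun r => shellBump (r ^ 2) * r⁻¹) (fun x => divergence W (x : Amb d)),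
      integral_polar (fun r => 2 * deriv shellBump (r ^ 2) * r)
        (fun x => inner ℝ (x : Amb d) (W x))] at h
    · exact h
    · intro y hy
      have h1 := homW ‖y‖ (norm_pos_iff.2 hy) (direction y hy : Amb d)
      have h2 : inner ℝ y (W y) =
          ‖y‖ * inner ℝ (direction y hy : Amb d) (W (direction y hy : Amb d)) := by
        rw [← h1, ← real_inner_smul_left, norm_smul_direction]
      rw [h2]
      ring
    · intro y hy
      rw [divergence_of_homogeneous homW hy]
      ring
  have hc₁pos : c₁ ≠ 0 := by
    have h := integral_polar (d := d) (fun r => shellBump (r ^ 2) * r⁻¹) (fun _ => 1)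
      (fun y => shellBump (‖y‖ ^ 2) * ‖y‖⁻¹) (fun y _ => by rw [mul_one])
    have hpos : 0 < ∫ y : Amb d, shellBump (‖y‖ ^ 2) * ‖y‖⁻¹ := by
      obtain ⟨x⟩ := instNonempty_sph (d := d)
      refine Continuous.integral_pos_of_hasCompactSupport_nonneg_nonzero (x := (x : Amb d)) ?_
        hasCompactSupport_shellBump.mul_right ?_ ?_
      · refine continuous_mul_of_eventuallyEq_zero ?_ shellBump_eventuallyEq_zero fun y hy => ?_
        · exact (shellBump.contDiff (n := 1)).continuous.comp (by fun_prop)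
        · exact continuous_norm.continuousAt.inv₀ (norm_ne_zero_iff.2 hy)
      · exact fun y => mul_nonneg shellBump.nonneg (by positivity)
      · rw [norm_coe_sph, one_pow, inv_one, mul_one,
          shellBump.one_of_mem_closedBall (mem_closedBall_self shellBump.rIn_pos.le)]
        exact one_ne_zero
    rw [h] at hpos
    exact left_ne_zero_of_mul hpos.ne'
  -- Instead of evaluating the radial integrals, the ratio of c₂ to c₁ is found from the field
  -- y/‖y‖, whose divergence on the sphere is d.
  have htest := main (radialExt fun x : Sph d => (x : Amb d))
    (fun y hy => (contDiffAt_radialExt isSmooth_coe hy).of_le (by simp))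
    (fun t ht y => radialExt_smul _ ht y)
  simp only [divergence_radialExt_coe, radialExt_coe, real_inner_self_eq_norm_sq, norm_coe_sph,
    one_pow, integral_const, smul_eq_mul, mul_one] at htest
  have hs := surf_real_univ_pos d
  have hc : c₂ = -(d * c₁) := by
    have : (c₂ + d * c₁) * (surf d).real univ = 0 := by linarith
    have := (mul_eq_zero.1 this).resolve_right hs.ne'
    linarith
  have h := main V hV hom
  rw [hc] at h
  apply mul_left_cancel₀ hc₁pos
  rw [h]
  ring

/-! ### Derivatives of determinants and inverse matrices -/

section MatrixCalculus

variable {ι E : Type*} [Fintype ι] [DecidableEq ι] [NormedAddCommGroup E] [NormedSpace ℝ E]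

theorem contDiffAt_det {n : WithTop ℕ∞} {M : E → Matrix ι ι ℝ} {z : E}
    (hM : ∀ i j, ContDiffAt ℝ n (fun z => M z i j) z) : ContDiffAt ℝ n (fun z => (M z).det) z := by
  simp only [Matrix.det_apply]
  exact ContDiffAt.sum fun σ _ => (contDiffAt_prod fun i _ => hM _ _).const_smul _

theorem contDiffAt_matrix_inv {n : WithTop ℕ∞} {M : E → Matrix ι ι ℝ} {z : E}
    (hM : ∀ i j, ContDiffAt ℝ n (fun z => M z i j) z) (hdet : (M z).det ≠ 0) (i j : ι) :
    ContDiffAt ℝ n (fun z => (M z)⁻¹ i j) z := by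
  simp only [Matrix.inv_def, Matrix.smul_apply, Ring.inverse_eq_inv', Matrix.adjugate_apply,
    smul_eq_mul]
  refine ((contDiffAt_det hM).inv hdet).mul (contDiffAt_det fun a b => ?_)
  simp only [Matrix.updateRow_apply]
  split_ifs
  · exact contDiffAt_const
  · exact hM a b

-- Smoothness of the determinant makes the derivative depend on M(t) and M' only, so it can be
-- computed along the line M(t) + sM'. There det(1 + sN) = 1 + s tr N + s² p(s) for a polynomial p.
open Matrix in
theorem hasDerivAt_det {M : ℝ → Matrix ι ι ℝ} {M' : Matrix ι ι ℝ} {t : ℝ}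
    (hM : ∀ i j, HasDerivAt (fun s => M s i j) (M' i j) t) (hdet : (M t).det ≠ 0) :
    HasDerivAt (fun s => (M s).det) ((M t).det * ((M t)⁻¹ * M').trace) t := by
  let D : (ι → ι → ℝ) → ℝ := fun N => (Matrix.of N).det
  have hD : HasFDerivAt D (fderiv ℝ D (M t)) (M t) := by
    refine (ContDiffAt.differentiableAt (n := 1) ?_ (by simp)).hasFDerivAt
    exact contDiffAt_det fun i j => (contDiff_apply_apply ℝ ℝ i j).contDiffAt
  have hMt : HasDerivAt (fun s => (M s : ι → ι → ℝ)) (M' : ι → ι → ℝ) t :=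
    hasDerivAt_pi.2 fun i => hasDerivAt_pi.2 fun j => hM i j
  have h1 : HasDerivAt (fun s => (M s).det) (fderiv ℝ D (M t) M') t := hD.comp_hasDerivAt t hMt
  let N : ι → ι → ℝ := M t
  let N' : ι → ι → ℝ := M'
  have hline : HasDerivAt (fun s : ℝ => N + s • N') N' 0 := by
    simpa using ((hasDerivAt_id' (0 : ℝ)).smul_const N').const_add N
  have h2 : HasDerivAt (fun s : ℝ => (M t + s • M').det) (fderiv ℝ D (M t) M') 0 := by
    have hD0 : HasFDerivAt D (fderiv ℝ D (M t)) (N + (0 : ℝ) • N') := by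
      rw [zero_smul, add_zero]; exact hD
    exact hD0.comp_hasDerivAt (0 : ℝ) hline
  have h3 : ∀ s : ℝ, (M t + s • M').det = (M t).det * (1 + ((M t)⁻¹ * M').trace * s +
      Polynomial.eval s (det (1 + (Polynomial.X : Polynomial ℝ) • ((M t)⁻¹ * M').map Polynomial.C)).divX.divX
        * s ^ 2) := by
    intro s
    rw [← det_one_add_smul, ← det_mul, mul_add, mul_one, Matrix.mul_smul, ← Matrix.mul_assoc,
      mul_nonsing_inv _ (isUnit_iff_ne_zero.2 hdet), Matrix.one_mul]
  set p := (det (1 + (Polynomial.X : Polynomial ℝ) • ((M t)⁻¹ * M').map Polynomial.C)).divX.divX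
  have h4 : HasDerivAt (fun s : ℝ => (M t).det * (1 + ((M t)⁻¹ * M').trace * s +
      Polynomial.eval s p * s ^ 2)) ((M t).det * ((M t)⁻¹ * M').trace) 0 := by
    have := (((hasDerivAt_id' (0 : ℝ)).const_mul (((M t)⁻¹ * M').trace)).const_add 1).add
      ((p.hasDerivAt 0).mul (hasDerivAt_pow 2 (0 : ℝ)))
    simpa using this.const_mul (M t).det
  rw [funext h3] at h2
  rw [h4.unique h2]
  exact h1

-- Differentiability comes from the adjugate formula; the value follows by differentiating M M⁻¹ =
-- 1, which holds for times near t.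
open Matrix in
theorem hasDerivAt_matrix_inv {M : ℝ → Matrix ι ι ℝ} {M' : Matrix ι ι ℝ} {t : ℝ}
    (hM : ∀ i j, HasDerivAt (fun s => M s i j) (M' i j) t) (hdet : (M t).det ≠ 0) (i j : ι) :
    HasDerivAt (fun s => (M s)⁻¹ i j) ((-((M t)⁻¹ * M' * (M t)⁻¹)) i j) t := by
  let R : ι → ι → (ι → ι → ℝ) → ℝ := fun i j N => (Matrix.of N)⁻¹ i j
  have hR : ∀ i j, DifferentiableAt ℝ (R i j) (M t) := fun i j =>
    (contDiffAt_matrix_inv (n := 1) (M := fun N : ι → ι → ℝ => Matrix.of N) (z := M t)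
      (fun i j => (contDiff_apply_apply ℝ ℝ i j).contDiffAt) hdet i j).differentiableAt (by simp)
  have hMt : HasDerivAt (fun s => (M s : ι → ι → ℝ)) (M' : ι → ι → ℝ) t :=
    hasDerivAt_pi.2 fun i => hasDerivAt_pi.2 fun j => hM i j
  let Y : Matrix ι ι ℝ := Matrix.of fun i j => fderiv ℝ (R i j) (M t) M'
  have hY : ∀ i j, HasDerivAt (fun s => (M s)⁻¹ i j) (Y i j) t := fun i j =>
    (hR i j).hasFDerivAt.comp_hasDerivAt t hMt
  have hev : ∀ᶠ s in 𝓝 t, (M s).det ≠ 0 :=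
    (hasDerivAt_det hM hdet).continuousAt.eventually_ne hdet
  have hprod : M' * (M t)⁻¹ + M t * Y = 0 := by
    ext a b
    have h1 : HasDerivAt (fun s => (M s * (M s)⁻¹) a b) ((M' * (M t)⁻¹ + M t * Y) a b) t := by
      simp only [Matrix.mul_apply, Matrix.add_apply, ← Finset.sum_add_distrib]
      exact HasDerivAt.fun_sum fun k _ => (hM a k).mul (hY k b)
    have h2 : (fun s => (M s * (M s)⁻¹) a b) =ᶠ[𝓝 t] fun _ => (1 : Matrix ι ι ℝ) a b := by
      filter_upwards [hev] with s hs
      rw [mul_nonsing_inv _ (isUnit_iff_ne_zero.2 hs)]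
    exact h1.unique ((hasDerivAt_const t _).congr_of_eventuallyEq h2)
  have hYeq : Y = -((M t)⁻¹ * M' * (M t)⁻¹) := by
    have h1 : M t * Y = -(M' * (M t)⁻¹) := eq_neg_of_add_eq_zero_right hprod
    have h2 := congrArg (fun N => (M t)⁻¹ * N) h1
    simpa [← Matrix.mul_assoc, nonsing_inv_mul _ (isUnit_iff_ne_zero.2 hdet)] using h2
  rw [← hYeq]
  exact hY i j

end MatrixCalculus

/-! ### Differentiation under the integral sign -/

/-- Differentiation under the integral sign over a compact space, for an integrand that is `C¹`
near the values it takes. -/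
theorem hasFDerivAt_integral_of_contDiffAt {X P E : Type*} [TopologicalSpace X] [CompactSpace X]
    [SecondCountableTopology X] [MeasurableSpace X] [BorelSpace X] {μ : Measure X}
    [IsFiniteMeasure μ] [NormedAddCommGroup P] [NormedSpace ℝ P] [NormedAddCommGroup E]
    [NormedSpace ℝ E] {Ψ : E → ℝ} {e : X → E} {L : X → P →L[ℝ] E} (he : Continuous e)
    (hL : Continuous L) (hΨ : ∀ x, ContDiffAt ℝ 1 Ψ (e x)) :
    Integrable (fun x => (fderiv ℝ Ψ (e x)).comp (L x)) μ ∧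
    HasFDerivAt (fun p => ∫ x, Ψ (e x + L x p) ∂μ)
      (∫ x, (fderiv ℝ Ψ (e x)).comp (L x) ∂μ) 0 := by
  have hc : Continuous fun q : P × X => e q.2 + L q.2 q.1 :=
    (he.comp continuous_snd).add ((hL.comp continuous_snd).clm_apply continuous_fst)
  have hcd : ∀ x, ∀ᶠ q : P × X in 𝓝 (0, x), ContDiffAt ℝ 1 Ψ (e q.2 + L q.2 q.1) := fun x => by
    have h1 : ∀ᶠ z in 𝓝 (e x + L x 0), ContDiffAt ℝ 1 Ψ z := by
      rw [map_zero, add_zero]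
      exact (hΨ x).eventually (by simp)
    exact hc.continuousAt.eventually h1
  have hfc : ∀ z, ContDiffAt ℝ 1 Ψ z → ContinuousAt (fderiv ℝ Ψ) z := fun z hz =>
    (hz.fderiv_right (m := 0) (by simp)).continuousAt
  have h0c : Continuous fun x => (fderiv ℝ Ψ (e x)).comp (L x) := by
    rw [continuous_iff_continuousAt]
    exact fun x => ((hfc _ (hΨ x)).comp he.continuousAt).clm_comp hL.continuousAt
  obtain ⟨C, hC⟩ := isCompact_univ.exists_bound_of_continuousOn h0c.continuousOn
  have hbd : ∀ x, ∀ᶠ q : P × X in 𝓝 (0, x),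
      ‖(fderiv ℝ Ψ (e q.2 + L q.2 q.1)).comp (L q.2)‖ < C + 1 := fun x => by
    have h1 : ContinuousAt (fun q : P × X => (fderiv ℝ Ψ (e q.2 + L q.2 q.1)).comp (L q.2))
        (0, x) := by
      refine ContinuousAt.clm_comp ?_ (hL.comp continuous_snd).continuousAt
      refine ContinuousAt.comp (g := fderiv ℝ Ψ) ?_ hc.continuousAt
      exact hfc _ (by simpa using hΨ x)
    refine h1.norm.eventually_lt continuousAt_const ?_
    have := hC x (mem_univ x)
    simp only [map_zero, add_zero]
    linarith
  -- C bounds the derivative at p = 0. By compactness of X, the weaker bound C + 1 and the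
  -- regularity of Ψ hold for all x simultaneously once p is near 0.
  have hev : ∀ᶠ p : P in 𝓝 0, ∀ x ∈ (univ : Set X), ContDiffAt ℝ 1 Ψ (e x + L x p) ∧
      ‖(fderiv ℝ Ψ (e x + L x p)).comp (L x)‖ < C + 1 :=
    isCompact_univ.eventually_forall_of_forall_eventually fun x _ => (hcd x).and (hbd x)
  have hcont : ∀ p, (∀ x ∈ (univ : Set X), ContDiffAt ℝ 1 Ψ (e x + L x p) ∧
      ‖(fderiv ℝ Ψ (e x + L x p)).comp (L x)‖ < C + 1) →
      Continuous fun x => Ψ (e x + L x p) := fun p hp => by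
    rw [continuous_iff_continuousAt]
    intro x
    exact ContinuousAt.comp (f := fun x => e x + L x p) (hp x (mem_univ x)).1.continuousAt
      (he.add (hL.clm_apply continuous_const)).continuousAt
  have hint0 : Integrable (fun x => (fderiv ℝ Ψ (e x)).comp (L x)) μ :=
    (integrable_const C).mono' h0c.aestronglyMeasurable (ae_of_all _ fun x => hC x (mem_univ x))
  refine ⟨hint0, ?_⟩
  have hF0 : Continuous fun x => Ψ (e x + L x (0 : P)) := hcont 0 hev.self_of_nhds
  obtain ⟨C', hC'⟩ := isCompact_univ.exists_bound_of_continuousOn hF0.continuousOn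
  have := hasFDerivAt_integral_of_dominated_of_fderiv_le (μ := μ) (𝕜 := ℝ)
    (F := fun p x => Ψ (e x + L x p)) (x₀ := (0 : P))
    (F' := fun p x => (fderiv ℝ Ψ (e x + L x p)).comp (L x)) (bound := fun _ => C + 1) hev
    (hev.mono fun p hp => (hcont p hp).aestronglyMeasurable)
    ((integrable_const C').mono' hF0.aestronglyMeasurable
      (ae_of_all _ fun x => hC' x (mem_univ x)))
    (by simpa using h0c.aestronglyMeasurable)
    (ae_of_all _ fun x p hp => (hp x (mem_univ x)).2.le)
    (integrable_const _)
    (ae_of_all _ fun x p hp => by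
      have h1 := ((hp x (mem_univ x)).1.differentiableAt (by simp)).hasFDerivAt
      exact h1.comp p ((L x).hasFDerivAt.const_add (e x)))
  simpa using this

/-- The curve γ allows a nonlocal quantity such as Vol(f + sm) to enter the integrand as a parameter
beside s. -/
theorem hasDerivAt_integral_of_contDiffAt {X P E : Type*} [TopologicalSpace X] [CompactSpace X]
    [SecondCountableTopology X] [MeasurableSpace X] [BorelSpace X] {μ : Measure X}
    [IsFiniteMeasure μ] [NormedAddCommGroup P] [NormedSpace ℝ P] [NormedAddCommGroup E]
    [NormedSpace ℝ E] {Ψ : E → ℝ} {e : X → E} {L : X → P →L[ℝ] E} (he : Continuous e)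
    (hL : Continuous L) (hΨ : ∀ x, ContDiffAt ℝ 1 Ψ (e x)) {γ : ℝ → P} {γ' : P} {t : ℝ}
    (hγ : HasDerivAt γ γ' t) (hγ0 : γ t = 0) :
    HasDerivAt (fun s => ∫ x, Ψ (e x + L x (γ s)) ∂μ) (∫ x, fderiv ℝ Ψ (e x) (L x γ') ∂μ) t := by
  obtain ⟨h1, h2⟩ := hasFDerivAt_integral_of_contDiffAt (μ := μ) he hL hΨ
  rw [← hγ0] at h2
  have h3 := h2.comp_hasDerivAt t hγ
  rw [ContinuousLinearMap.integral_apply h1] at h3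
  exact h3

theorem trace_mul_eq_sum {ι : Type*} [Fintype ι] (A B : Matrix ι ι ℝ) :
    (A * B).trace = ∑ i, ∑ j, A i j * B j i := by
  simp [Matrix.trace, Matrix.mul_apply]

/-! ### Metric, normal and mean curvature as functions of the 2-jet -/

/-- The space of second order jets at points of the sphere. -/
abbrev Jet (d : ℕ) : Type :=
  Amb d × (Fin (d + 1) → Amb d) × (Fin (d + 1) → Fin (d + 1) → Amb d)

/-- The derivatives of first and second order of the radial extension of `f` at `x`. -/
def derivs (f : Sph d → Amb d) (x : Sph d) :
    (Fin (d + 1) → Amb d) × (Fin (d + 1) → Fin (d + 1) → Amb d) :=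
  (fun i => partialD f (x : Amb d) i,
    fun i j => fderiv ℝ (fun y => partialD f y j) (x : Amb d) (stdVec i))

/-- The second order jet of `f` at `x`. -/
def jet (f : Sph d → Amb d) (x : Sph d) : Jet d := ((x : Amb d), derivs f x)

/-- The pullback metric as a function of the jet. -/
def jetMetric (z : Jet d) : Matrix (Fin (d + 1)) (Fin (d + 1)) ℝ :=
  Matrix.of fun i j => inner ℝ (z.2.1 i) (z.2.1 j) + z.1 i * z.1 j

/-- The volume density as a function of the jet. -/
def jetDensity (z : Jet d) : ℝ := Real.sqrt (jetMetric z).det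

/-- The normal vector as a function of the jet. -/
def jetNormalVec (z : Jet d) : Amb d :=
  WithLp.toLp 2 fun k : Fin (d + 1) =>
    (Matrix.of fun a b : Fin (d + 1) => z.2.1 b a + (if a = k then z.1 b else 0)).det

/-- The unit normal as a function of the jet. -/
def jetNormal (z : Jet d) : Amb d := ‖jetNormalVec z‖⁻¹ • jetNormalVec z

/-- The second fundamental form as a function of the jet. -/
def jetSecondForm (z : Jet d) : Matrix (Fin (d + 1)) (Fin (d + 1)) ℝ :=
  Matrix.of fun i j => inner ℝ (z.2.2 i j) (jetNormal z)

/-- The mean curvature as a function of the jet. -/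
def jetTrL (z : Jet d) : ℝ := ((jetMetric z)⁻¹ * jetSecondForm z).trace

theorem volDensity_eq_jet (f : Sph d → Amb d) (x : Sph d) :
    volDensity f x = jetDensity (jet f x) := rfl

theorem trL_eq_jet (f : Sph d → Amb d) (x : Sph d) : trL f x = jetTrL (jet f x) := rfl

theorem derivs_add_smul {f m : Sph d → Amb d} (hf : IsSmooth f) (hm : IsSmooth m) (s : ℝ)
    (x : Sph d) : derivs (f + s • m) x = derivs f x + s • derivs m x := by
  have hx := coe_sph_ne_zero x
  refine Prod.ext (funext fun i => partialD_add_smul hf hm s hx i) ?_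
  ext1 i
  ext1 j
  have he : (fun y => partialD (f + s • m) y j) =ᶠ[𝓝 (x : Amb d)]
      fun y => partialD f y j + s • partialD m y j := by
    filter_upwards [isOpen_ne.mem_nhds hx] with y hy using partialD_add_smul hf hm s hy j
  have hpf := (contDiffAt_partialD hf hx j).differentiableAt (by simp)
  have hpm := (contDiffAt_partialD hm hx j).differentiableAt (by simp)
  simp only [derivs, he.fderiv_eq, Prod.snd_add, Prod.smul_snd, Pi.add_apply, Pi.smul_apply]
  rw [fderiv_fun_add hpf (hpm.fun_const_smul s), fderiv_fun_const_smul hpm]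
  rfl

theorem jet_add_smul {f m : Sph d → Amb d} (hf : IsSmooth f) (hm : IsSmooth m) (s : ℝ)
    (x : Sph d) : jet (f + s • m) x = jet f x + s • ((0, derivs m x) : Jet d) := by
  simp [jet, derivs_add_smul hf hm]

theorem continuous_derivs {f : Sph d → Amb d} (hf : IsSmooth f) : Continuous (derivs f) := by
  refine Continuous.prodMk (continuous_pi fun i => continuous_partialD hf i)
    (continuous_pi fun i => continuous_pi fun j => ?_)
  rw [continuous_iff_continuousAt]
  intro x
  have h1 := ((contDiffAt_partialD hf (coe_sph_ne_zero x) j).fderiv_right (m := 0)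
    (by simp)).continuousAt
  exact (ContinuousAt.comp (f := fun x : Sph d => (x : Amb d)) h1
    continuous_subtype_val.continuousAt).clm_apply continuousAt_const

theorem continuous_jet {f : Sph d → Amb d} (hf : IsSmooth f) : Continuous (jet f) :=
  continuous_subtype_val.prodMk (continuous_derivs hf)

theorem contDiff_coord (i : Fin (d + 1)) : ContDiff ℝ ∞ (fun v : Amb d => v i) :=
  (EuclideanSpace.proj (𝕜 := ℝ) i).contDiff

theorem contDiff_jet_fst (i : Fin (d + 1)) : ContDiff ℝ ∞ (fun z : Jet d => z.1 i) :=
  (contDiff_coord i).comp contDiff_fst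

theorem contDiff_jet_snd (i : Fin (d + 1)) : ContDiff ℝ ∞ (fun z : Jet d => z.2.1 i) :=
  (contDiff_apply ℝ (Amb d) i).comp (contDiff_fst.comp contDiff_snd)

theorem contDiff_jetMetric (i j : Fin (d + 1)) :
    ContDiff ℝ ∞ (fun z : Jet d => jetMetric z i j) :=
  ((contDiff_jet_snd i).inner ℝ (contDiff_jet_snd j)).add
    ((contDiff_jet_fst i).mul (contDiff_jet_fst j))

theorem contDiff_jetNormalVec : ContDiff ℝ ∞ (jetNormalVec (d := d)) := by
  rw [contDiff_euclidean]
  intro k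
  rw [contDiff_iff_contDiffAt]
  intro z
  refine contDiffAt_det fun a b => ContDiff.contDiffAt ?_
  refine ((contDiff_coord a).comp (contDiff_jet_snd b)).add ?_
  split_ifs
  · exact contDiff_jet_fst b
  · exact contDiff_const

theorem contDiffAt_jetNormal {z : Jet d} (hz : jetNormalVec z ≠ 0) :
    ContDiffAt ℝ ∞ (jetNormal (d := d)) z :=
  ((contDiff_jetNormalVec.contDiffAt.norm ℝ hz).inv (norm_ne_zero_iff.2 hz)).smul
    contDiff_jetNormalVec.contDiffAt

theorem contDiffAt_jetDensity {z : Jet d} (hz : (jetMetric z).det ≠ 0) :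
    ContDiffAt ℝ ∞ (jetDensity (d := d)) z :=
  (contDiffAt_det fun i j => (contDiff_jetMetric i j).contDiffAt).sqrt hz

theorem contDiffAt_jetTrL {z : Jet d} (hz : (jetMetric z).det ≠ 0) (hν : jetNormalVec z ≠ 0) :
    ContDiffAt ℝ ∞ (jetTrL (d := d)) z := by
  have h : jetTrL (d := d) =
      fun z => ∑ i, ∑ j, (jetMetric z)⁻¹ i j * inner ℝ (z.2.2 j i) (jetNormal z) := by
    ext z
    rw [jetTrL, trace_mul_eq_sum]
    rfl
  rw [h]
  refine ContDiffAt.sum fun i _ => ContDiffAt.sum fun j _ => ContDiffAt.mul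
    (contDiffAt_matrix_inv (fun i j => (contDiff_jetMetric i j).contDiffAt) hz i j) ?_
  refine ContDiffAt.inner ℝ (ContDiff.contDiffAt ?_) (contDiffAt_jetNormal hν)
  exact (contDiff_apply_apply ℝ (Amb d) j i).comp (contDiff_snd.comp contDiff_snd)

/-! ### First variations at a round sphere -/

section RoundSphere

variable (c : Amb d) {r : ℝ}

/-- The orthogonal projection to the normal line of the unit sphere at `x`. -/
def radialProj (x : Sph d) : Matrix (Fin (d + 1)) (Fin (d + 1)) ℝ :=
  Matrix.vecMulVec (x : Amb d) (x : Amb d)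

theorem radialProj_mul_self (x : Sph d) : radialProj x * radialProj x = radialProj x := by
  rw [radialProj, Matrix.mul_vecMulVec, Matrix.vecMulVec_mulVec, dotProduct_self_coe]
  simp

theorem radialProj_transpose (x : Sph d) : (radialProj x).transpose = radialProj x :=
  Matrix.transpose_vecMulVec _ _

theorem diffMatrix_mul_radialProj {m : Sph d → Amb d} (hm : IsSmooth m) (x : Sph d) :
    diffMatrix m x * radialProj x = 0 := by
  rw [radialProj, Matrix.mul_vecMulVec, diffMatrix_mulVec_self hm, Matrix.zero_vecMulVec]

theorem diffMatrix_coe (x : Sph d) :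
    diffMatrix (fun x : Sph d => (x : Amb d)) x = 1 - radialProj x :=
  eq_sub_of_add_eq (coneMatrix_coe x)

theorem diffMatrix_roundSphere (x : Sph d) :
    diffMatrix (roundSphere c r) x = r • (1 - radialProj x) := by
  rw [← diffMatrix_coe]
  exact diffMatrix_const_add_smul isSmooth_coe c r x

theorem jetMetric_roundSphere (x : Sph d) : jetMetric (jet (roundSphere c r) x) =
    r ^ 2 • (1 - radialProj x) + radialProj x := by
  have h1 : jetMetric (jet (roundSphere c r) x) = pullbackMetric (roundSphere c r) x := rfl
  have h2 := radialProj_mul_self x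
  rw [h1, pullbackMetric_eq, diffMatrix_roundSphere, Matrix.transpose_smul, Matrix.transpose_sub,
    Matrix.transpose_one, radialProj_transpose, Matrix.smul_mul, Matrix.mul_smul, smul_smul, ← sq,
    sub_mul, one_mul, mul_sub, mul_one, h2, sub_self, sub_zero]
  rfl

theorem jetMetric_roundSphere_det (hr : 0 < r) (x : Sph d) :
    (jetMetric (jet (roundSphere c r) x)).det = (r ^ d) ^ 2 := by
  have h1 : pullbackMetric (roundSphere c r) x = _ :=
    pullbackMetric_const_add_smul isSmooth_coe norm_coe_sph c r x
  have h2 : jetMetric (jet (roundSphere c r) x) = pullbackMetric (roundSphere c r) x := rfl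
  have h3 : (diffMatrix (fun x : Sph d => (x : Amb d)) x +
      Matrix.vecMulVec (x : Amb d) (x : Amb d)).det = 1 :=
    (congrArg Matrix.det (coneMatrix_coe x)).trans Matrix.det_one
  rw [h2, h1, Matrix.det_mul, Matrix.det_transpose, det_smul_add_vecMulVec (dotProduct_self_coe x)
      (diffMatrix_mulVec_self isSmooth_coe x) hr, h3, mul_one, sq]

theorem jetMetric_roundSphere_inv (hr : 0 < r) (x : Sph d) :
    (jetMetric (jet (roundSphere c r) x))⁻¹ = (r ^ 2)⁻¹ • (1 - radialProj x) + radialProj x := by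
  apply Matrix.inv_eq_right_inv
  have h2 := radialProj_mul_self x
  have h3 : (1 - radialProj x) * (1 - radialProj x) = 1 - radialProj x := by
    rw [sub_mul, one_mul, mul_sub, h2]; simp
  have h4 : (1 - radialProj x) * radialProj x = 0 := by rw [sub_mul, h2]; simp
  have h5 : radialProj x * (1 - radialProj x) = 0 := by rw [mul_sub, h2]; simp
  have hr2 : r ^ 2 ≠ 0 := (pow_pos hr 2).ne'
  rw [jetMetric_roundSphere, add_mul, mul_add, mul_add, Matrix.smul_mul, Matrix.mul_smul,
    Matrix.mul_smul, Matrix.smul_mul, h3, h4, h5, h2, smul_smul, mul_inv_cancel₀ hr2]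
  simp

theorem jetNormalVec_roundSphere (hr : 0 < r) (x : Sph d) :
    jetNormalVec (jet (roundSphere c r) x) = r ^ d • (x : Amb d) := by
  have h := normalVec_const_add_smul isSmooth_coe norm_coe_sph c hr x
    (by rw [coneMatrix_coe, Matrix.det_one]; exact one_ne_zero)
  rw [coneMatrix_coe, Matrix.det_one, mul_one] at h
  exact h

theorem jetNormalVec_roundSphere_ne_zero (hr : 0 < r) (x : Sph d) :
    jetNormalVec (jet (roundSphere c r) x) ≠ 0 := by
  rw [jetNormalVec_roundSphere c hr]
  exact smul_ne_zero (pow_pos hr d).ne' (coe_sph_ne_zero x)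

theorem jetNormal_roundSphere (hr : 0 < r) (x : Sph d) :
    jetNormal (jet (roundSphere c r) x) = (x : Amb d) := by
  have hpos := pow_pos hr d
  rw [jetNormal, jetNormalVec_roundSphere c hr, norm_smul, norm_coe_sph, mul_one,
    Real.norm_of_nonneg hpos.le, smul_smul, inv_mul_cancel₀ hpos.ne', one_smul]

theorem jetSecondForm_roundSphere (hr : 0 < r) (x : Sph d) :
    jetSecondForm (jet (roundSphere c r) x) = -r • (1 - radialProj x) := by
  have hx0 := coe_sph_ne_zero x
  have h1 : (1 - radialProj x) =
      (diffMatrix (fun x : Sph d => (x : Amb d)) x).transpose *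
        diffMatrix (fun x : Sph d => (x : Amb d)) x := by
    rw [diffMatrix_coe, Matrix.transpose_sub, Matrix.transpose_one, radialProj_transpose, sub_mul,
      one_mul, mul_sub, mul_one, radialProj_mul_self, sub_self, sub_zero]
  rw [h1]
  ext i j
  have he : (fun y => partialD (roundSphere c r) y j) =ᶠ[𝓝 (x : Amb d)]
      fun y => r • partialD (fun x : Sph d => (x : Amb d)) y j := by
    filter_upwards [isOpen_ne.mem_nhds hx0] with y hy
      using partialD_const_add_smul c isSmooth_coe r hy j
  have hp := (contDiffAt_partialD isSmooth_coe hx0 j).differentiableAt (by simp)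
  have h2 := inner_fderiv_partialD isSmooth_coe norm_coe_sph x i j
  simp only [jetSecondForm, Matrix.of_apply, jetNormal_roundSphere c hr]
  simp only [jet, derivs, he.fderiv_eq, Matrix.smul_apply, Matrix.mul_apply, Matrix.transpose_apply, diffMatrix]
  rw [fderiv_fun_const_smul hp, _root_.smul_apply, real_inner_smul_left, h2, inner_eq_dotProduct]
  simp [dotProduct]

theorem trace_diffMatrix_eq_divergence (m : Sph d → Amb d) (x : Sph d) :
    (diffMatrix m x).trace = divergence (radialExt m) (x : Amb d) := rfl

/-- The derivative of the metric at a round sphere in the direction `m`. -/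
theorem hasDerivAt_jetMetric (m : Sph d → Amb d) (x : Sph d) (i j : Fin (d + 1)) :
    HasDerivAt (fun s : ℝ => jetMetric (jet (roundSphere c r) x + s • ((0, derivs m x) : Jet d)) i j)
      ((r • ((1 - radialProj x) * diffMatrix m x +
        (diffMatrix m x).transpose * (1 - radialProj x))) i j) 0 := by
  have hline : ∀ a b : Amb d, HasDerivAt (fun s : ℝ => a + s • b) b 0 := fun a b => by
    simpa using ((hasDerivAt_id' (0 : ℝ)).smul_const b).const_add a
  have h := ((hline (partialD (roundSphere c r) (x : Amb d) i) (partialD m (x : Amb d) i)).inner ℝ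
    (hline (partialD (roundSphere c r) (x : Amb d) j) (partialD m (x : Amb d) j))).add_const
      ((x : Amb d) i * (x : Amb d) j)
  have hA := diffMatrix_roundSphere c (r := r) x
  have e1 : inner ℝ (partialD (roundSphere c r) (x : Amb d) i) (partialD m (x : Amb d) j) =
      (r • ((1 - radialProj x) * diffMatrix m x)) i j := by
    have : r • ((1 - radialProj x) * diffMatrix m x) =
        (diffMatrix (roundSphere c r) x).transpose * diffMatrix m x := by
      rw [hA, Matrix.transpose_smul, Matrix.transpose_sub, Matrix.transpose_one,
        radialProj_transpose, Matrix.smul_mul]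
    rw [this, inner_eq_dotProduct]
    rfl
  have e2 : inner ℝ (partialD m (x : Amb d) i) (partialD (roundSphere c r) (x : Amb d) j) =
      (r • ((diffMatrix m x).transpose * (1 - radialProj x))) i j := by
    rw [← Matrix.mul_smul, ← hA, inner_eq_dotProduct]
    rfl
  rw [smul_add, Matrix.add_apply, ← e1, ← e2]
  simpa [jetMetric, jet, derivs] using h

/-- Write X for the radial projection and D for the derivative of m. The relation DX = 0 and
cyclicity of the trace reduce each of the two terms to tr D. The value t = r⁻² belongs to the
inverse metric; t = 0 is used in `trace_mul_metricDeriv_mul`. -/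
theorem trace_inv_mul_metricDeriv {m : Sph d → Amb d} (hm : IsSmooth m) (x : Sph d)
    (t : ℝ) :
    ((t • (1 - radialProj x) + radialProj x) * (r • ((1 - radialProj x) * diffMatrix m x +
        (diffMatrix m x).transpose * (1 - radialProj x)))).trace =
      2 * t * r * (diffMatrix m x).trace := by
  set D := diffMatrix m x
  set X := radialProj x
  have hX : X * X = X := radialProj_mul_self x
  have hDX : D * X = 0 := diffMatrix_mul_radialProj hm x
  have h3 : (1 - X) * (1 - X) = 1 - X := by rw [sub_mul, one_mul, mul_sub, hX]; simp
  have h4 : (1 - X) * X = 0 := by rw [sub_mul, hX]; simp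
  have h5 : X * (1 - X) = 0 := by rw [mul_sub, hX]; simp
  have hleft : (t • (1 - X) + X) * (1 - X) = t • (1 - X) := by
    rw [add_mul, h5, Matrix.smul_mul, h3, add_zero]
  have hright : (1 - X) * (t • (1 - X) + X) = t • (1 - X) := by
    rw [mul_add, h4, Matrix.mul_smul, h3, add_zero]
  have ht : ((1 - X) * D).trace = D.trace := by
    rw [Matrix.trace_mul_comm, mul_sub, hDX, mul_one, sub_zero]
  have ht' : (D.transpose * (1 - X)).trace = D.trace := by
    rw [← Matrix.trace_transpose, Matrix.transpose_mul, Matrix.transpose_transpose,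
      Matrix.transpose_sub, Matrix.transpose_one, radialProj_transpose, ht]
  have t1 : ((t • (1 - X) + X) * ((1 - X) * D)).trace = t * D.trace := by
    rw [← mul_assoc, hleft, Matrix.smul_mul, Matrix.trace_smul, ht, smul_eq_mul]
  have t2 : ((t • (1 - X) + X) * (D.transpose * (1 - X))).trace = t * D.trace := by
    rw [Matrix.trace_mul_comm, mul_assoc, hright, Matrix.mul_smul, Matrix.trace_smul, ht',
      smul_eq_mul]
  rw [Matrix.mul_smul, Matrix.trace_smul, mul_add, Matrix.trace_add, t1, t2, smul_eq_mul]
  ring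

/-- The first variation of the volume density at a round sphere. -/
theorem hasDerivAt_jetDensity (hr : 0 < r) {m : Sph d → Amb d} (hm : IsSmooth m) (x : Sph d) :
    HasDerivAt (fun s : ℝ => jetDensity (jet (roundSphere c r) x + s • ((0, derivs m x) : Jet d)))
      (r ^ d * r⁻¹ * divergence (radialExt m) (x : Amb d)) 0 := by
  have hpos := pow_pos hr d
  have e0 : jet (roundSphere c r) x + (0 : ℝ) • ((0, derivs m x) : Jet d) =
      jet (roundSphere c r) x := by rw [zero_smul, add_zero]
  have hdet : (jetMetric (jet (roundSphere c r) x + (0 : ℝ) • ((0, derivs m x) : Jet d))).det =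
      (r ^ d) ^ 2 := by rw [e0, jetMetric_roundSphere_det c hr]
  have hne : (jetMetric (jet (roundSphere c r) x + (0 : ℝ) • ((0, derivs m x) : Jet d))).det ≠ 0 := by
    rw [hdet]; positivity
  have h := (hasDerivAt_det (fun i j => hasDerivAt_jetMetric c (r := r) m x i j) hne).sqrt hne
  convert! h using 1
  rw [hdet, e0, jetMetric_roundSphere_inv c hr, trace_inv_mul_metricDeriv hm,
    Real.sqrt_sq hpos.le, trace_diffMatrix_eq_divergence]
  field_simp

/-- The trace of the Hessian of the radial extension, paired with the position vector. -/
def radialLaplacian (m : Sph d → Amb d) (x : Sph d) : ℝ :=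
  ∑ i, inner ℝ ((derivs m x).2 i i) (x : Amb d)

/-- Differentiating Euler's relation ∑ yⱼ ∂ⱼm = 0 in the direction eᵢ gives ∂ᵢm + ∑ xⱼ ∂ᵢ∂ⱼm = 0;
contracting with xᵢ removes the first order terms by Euler's relation again. -/
theorem sum_hessian_radial {m : Sph d → Amb d} (hm : IsSmooth m) (x : Sph d) :
    ∑ i, ∑ j, ((x : Amb d) i * (x : Amb d) j) • (derivs m x).2 i j = 0 := by
  have hx0 := coe_sph_ne_zero x
  have hp := fun j => (contDiffAt_partialD hm hx0 j).differentiableAt (n := ∞) (by simp)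
  have h1 : ∀ i, partialD m (x : Amb d) i + ∑ j, (x : Amb d) j • (derivs m x).2 i j = 0 := by
    intro i
    have he : (fun y : Amb d => ∑ j, y j • partialD m y j) =ᶠ[𝓝 (x : Amb d)] fun _ => 0 := by
      filter_upwards [isOpen_ne.mem_nhds hx0] with y hy using sum_smul_partialD hm hy
    have hd : HasFDerivAt (fun y : Amb d => ∑ j, y j • partialD m y j) _ (x : Amb d) :=
      HasFDerivAt.fun_sum fun j _ =>
        (EuclideanSpace.proj (𝕜 := ℝ) j).hasFDerivAt.smul (hp j).hasFDerivAt
    have h2 := congrArg (fun L : Amb d →L[ℝ] Amb d => L (stdVec i)) (hd.fderiv.symm.trans he.fderiv_eq)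
    simp [Finset.sum_add_distrib, stdVec, ite_smul] at h2
    rw [add_comm]
    exact h2
  have h2 : ∀ i, ∑ j, ((x : Amb d) i * (x : Amb d) j) • (derivs m x).2 i j =
      - ((x : Amb d) i • partialD m (x : Amb d) i) := by
    intro i
    simp only [mul_smul, ← Finset.smul_sum]
    rw [eq_neg_of_add_eq_zero_right (h1 i), smul_neg]
  simp only [h2]
  rw [Finset.sum_neg_distrib, sum_smul_partialD hm hx0, neg_zero]

theorem partialD_coe {y : Amb d} (hy : y ≠ 0) (j : Fin (d + 1)) :
    partialD (fun x : Sph d => (x : Amb d)) y j = ‖y‖⁻¹ • (stdVec j - (‖y‖⁻¹ * y j) • ‖y‖⁻¹ • y) := by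
  have h1 := fderiv_radialExt_smul (fun x : Sph d => (x : Amb d)) (norm_pos_iff.2 hy)
    (direction y hy : Amb d)
  rw [norm_smul_direction] at h1
  have h2 := diffMatrix_coe (direction y hy)
  rw [partialD, h1, _root_.smul_apply]
  congr 1
  ext a
  have h3 := congrFun (congrFun h2 a) j
  simp only [diffMatrix, partialD, Matrix.of_apply] at h3
  rw [h3]
  simp [stdVec, radialProj, Matrix.vecMulVec, direction, Matrix.one_apply]
  ring

/-- The explicit first derivative of y/‖y‖ is differentiated along x + t eᵢ. Summed over i the
result is -2⟨x, w⟩ = 0, which is why the tilting of the normal does not affect the first variation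
of the mean curvature. -/
theorem inner_hessian_coe (x : Sph d) {w : Amb d} (hw : inner ℝ (x : Amb d) w = 0)
    (i : Fin (d + 1)) :
    inner ℝ ((derivs (fun x : Sph d => (x : Amb d)) x).2 i i) w = -2 * ((x : Amb d) i * w i) := by
  have hx0 := coe_sph_ne_zero x
  have hp := (contDiffAt_partialD isSmooth_coe hx0 i).differentiableAt (by simp)
  have hline : HasDerivAt (fun t : ℝ => (x : Amb d) + t • stdVec i) (stdVec i) 0 := by
    simpa using ((hasDerivAt_id' (0 : ℝ)).smul_const (stdVec (d := d) i)).const_add (x : Amb d)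
  have h0 : (x : Amb d) + (0 : ℝ) • stdVec i = (x : Amb d) := by rw [zero_smul, add_zero]
  have hn : HasDerivAt (fun t : ℝ => ‖(x : Amb d) + t • stdVec i‖) ((x : Amb d) i) 0 := by
    have h1 : HasFDerivAt (fun z : Amb d => ‖z‖) (innerSL ℝ (x : Amb d))
        ((x : Amb d) + (0 : ℝ) • stdVec i) := by
      rw [h0]
      simpa only [direction_coe] using hasFDerivAt_norm hx0
    have h2 := h1.comp_hasDerivAt (0 : ℝ) hline
    convert! h2 using 1
    simp [stdVec, EuclideanSpace.inner_single_right]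
  have hinv : HasDerivAt (fun t : ℝ => ‖(x : Amb d) + t • stdVec i‖⁻¹) (-(x : Amb d) i) 0 := by
    have := hn.fun_inv (by rw [h0, norm_coe_sph]; exact one_ne_zero)
    rw [h0, norm_coe_sph] at this
    simpa using this
  have hcoord : HasDerivAt (fun t : ℝ => ((x : Amb d) + t • stdVec i) i) 1 0 := by
    have h2 := (EuclideanSpace.proj (𝕜 := ℝ) i).hasFDerivAt.comp_hasDerivAt (0 : ℝ) hline
    convert! h2 using 1
    simp [stdVec]
  have hin : HasDerivAt (fun t : ℝ => inner ℝ ((x : Amb d) + t • stdVec i) w) (w i) 0 := by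
    have h2 := hline.inner ℝ (hasDerivAt_const (0 : ℝ) w)
    convert! h2 using 1
    simp [stdVec, EuclideanSpace.inner_single_left]
  have hL : HasDerivAt (fun t : ℝ => inner ℝ
      (partialD (fun x : Sph d => (x : Amb d)) ((x : Amb d) + t • stdVec i) i) w)
      (inner ℝ ((derivs (fun x : Sph d => (x : Amb d)) x).2 i i) w) 0 := by
    have h1 := hp.hasFDerivAt
    rw [← h0] at h1
    have h2 := (h1.comp_hasDerivAt (0 : ℝ) hline).inner ℝ (hasDerivAt_const (0 : ℝ) w)
    convert! h2 using 1
    rw [inner_zero_right, zero_add, h0]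
    rfl
  have hev : (fun t : ℝ => inner ℝ
      (partialD (fun x : Sph d => (x : Amb d)) ((x : Amb d) + t • stdVec i) i) w) =ᶠ[𝓝 0]
      fun t => ‖(x : Amb d) + t • stdVec i‖⁻¹ * (w i - (‖(x : Amb d) + t • stdVec i‖⁻¹ *
        ((x : Amb d) + t • stdVec i) i) * (‖(x : Amb d) + t • stdVec i‖⁻¹ *
          inner ℝ ((x : Amb d) + t • stdVec i) w)) := by
    have hne : ∀ᶠ t : ℝ in 𝓝 0, (x : Amb d) + t • stdVec i ≠ 0 :=
      hline.continuousAt.eventually_ne (by rw [h0]; exact hx0)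
    filter_upwards [hne] with t ht
    rw [partialD_coe ht, real_inner_smul_left, inner_sub_left, real_inner_smul_left,
      real_inner_smul_left]
    congr 2
    simp [stdVec, EuclideanSpace.inner_single_left]
  have hR := hinv.fun_mul (((hinv.fun_mul hcoord).fun_mul (hinv.fun_mul hin)).const_sub (w i))
  have h := (hL.congr_of_eventuallyEq hev.symm).unique hR
  rw [h]
  simp only [h0, norm_coe_sph, hw]
  ring

/-- The inverse metric is r⁻² times the identity plus a multiple of x xᵀ, and the latter contracts
to zero with the Hessian by `sum_hessian_radial`. -/
theorem sum_jetMetric_inv_mul_hessian (hr : 0 < r) {m : Sph d → Amb d} (hm : IsSmooth m)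
    (x : Sph d) (v : Amb d) :
    ∑ i, ∑ j, (jetMetric (jet (roundSphere c r) x))⁻¹ i j * inner ℝ ((derivs m x).2 j i) v =
      (r ^ 2)⁻¹ * ∑ i, inner ℝ ((derivs m x).2 i i) v := by
  have h1 : ∀ i j, (jetMetric (jet (roundSphere c r) x))⁻¹ i j =
      (r ^ 2)⁻¹ * (if i = j then 1 else 0) +
        (1 - (r ^ 2)⁻¹) * ((x : Amb d) j * (x : Amb d) i) := by
    intro i j
    rw [jetMetric_roundSphere_inv c hr]
    simp only [radialProj, Matrix.vecMulVec, Matrix.one_apply, Matrix.add_apply, Matrix.smul_apply,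
      Matrix.sub_apply, Matrix.of_apply, smul_eq_mul]
    ring
  have h2 : ∑ i, ∑ j, ((x : Amb d) j * (x : Amb d) i) * inner ℝ ((derivs m x).2 j i) v = 0 := by
    rw [Finset.sum_comm]
    have := congrArg (fun u => inner ℝ u v) (sum_hessian_radial hm x)
    simpa only [sum_inner, real_inner_smul_left, inner_zero_left] using this
  simp only [h1, add_mul, Finset.sum_add_distrib, mul_assoc, ← Finset.mul_sum] at h2 ⊢
  rw [h2]
  simp

theorem trace_mul_metricDeriv_mul {m : Sph d → Amb d} (hm : IsSmooth m) (x : Sph d) (t : ℝ) :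
    ((t • (1 - radialProj x) + radialProj x) * (r • ((1 - radialProj x) * diffMatrix m x +
        (diffMatrix m x).transpose * (1 - radialProj x))) *
      (1 - radialProj x)).trace = 2 * t * r * (diffMatrix m x).trace := by
  set X := radialProj x
  set g' := r • ((1 - X) * diffMatrix m x + (diffMatrix m x).transpose * (1 - X))
  have hX : X * X = X := radialProj_mul_self x
  -- The tangential part of the inverse metric is a difference of two matrices of the form t(1 - X)
  -- + X, with parameters t and 0, so the preceding trace formula applies to both.
  have h : (1 - X) * (t • (1 - X) + X) = (t • (1 - X) + X) - ((0 : ℝ) • (1 - X) + X) := by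
    rw [zero_smul, zero_add, add_sub_cancel_right, mul_add, Matrix.mul_smul, sub_mul, sub_mul,
      one_mul, one_mul, mul_sub, mul_one, hX]
    simp
  rw [Matrix.trace_mul_comm, ← mul_assoc, h, sub_mul, Matrix.trace_sub,
    trace_inv_mul_metricDeriv hm, trace_inv_mul_metricDeriv hm]
  ring

theorem derivs_roundSphere_snd (x : Sph d) :
    (derivs (roundSphere c r) x).2 = r • (derivs (fun x : Sph d => (x : Amb d)) x).2 := by
  have hx0 := coe_sph_ne_zero x
  ext1 i
  ext1 j
  have he : (fun y => partialD (roundSphere c r) y j) =ᶠ[𝓝 (x : Amb d)]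
      fun y => r • partialD (fun x : Sph d => (x : Amb d)) y j := by
    filter_upwards [isOpen_ne.mem_nhds hx0] with y hy
      using partialD_const_add_smul c isSmooth_coe r hy j
  have hp := (contDiffAt_partialD isSmooth_coe hx0 j).differentiableAt (by simp)
  simp only [derivs, he.fderiv_eq, Pi.smul_apply]
  rw [fderiv_fun_const_smul hp]
  rfl

/-- The first variation of the mean curvature at a round sphere. -/
theorem hasDerivAt_jetTrL (hr : 0 < r) {m : Sph d → Amb d} (hm : IsSmooth m) (x : Sph d) :
    HasDerivAt (fun s : ℝ => jetTrL (jet (roundSphere c r) x + s • ((0, derivs m x) : Jet d)))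
      ((r ^ 2)⁻¹ * (2 * divergence (radialExt m) (x : Amb d) + radialLaplacian m x)) 0 := by
  set z := jet (roundSphere c r) x with hz
  set w : Jet d := (0, derivs m x) with hw
  have e0 : z + (0 : ℝ) • w = z := by rw [zero_smul, add_zero]
  have hline : HasDerivAt (fun s : ℝ => z + s • w) w 0 := by
    simpa using ((hasDerivAt_id' (0 : ℝ)).smul_const w).const_add z
  have hN : jetNormalVec z ≠ 0 := jetNormalVec_roundSphere_ne_zero c hr x
  have hne : (jetMetric (z + (0 : ℝ) • w)).det ≠ 0 := by
    rw [e0, hz, jetMetric_roundSphere_det c hr]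
    have := pow_pos hr d
    positivity
  have hν : HasDerivAt (fun s : ℝ => jetNormal (z + s • w)) (fderiv ℝ jetNormal z w) 0 := by
    have h1 := ((contDiffAt_jetNormal hN).differentiableAt (by simp)).hasFDerivAt
    rw [← e0] at h1
    have h2 := h1.comp_hasDerivAt (0 : ℝ) hline
    rw [e0] at h2
    exact h2
  set ν' := fderiv ℝ jetNormal z w
  have hν0 : jetNormal z = (x : Amb d) := jetNormal_roundSphere c hr x
  -- The normal keeps unit length along the variation, so its derivative is tangential.
  have hνx : inner ℝ (x : Amb d) ν' = 0 := by
    have h1 := hν.inner ℝ hν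
    have h2 : (fun s : ℝ => inner ℝ (jetNormal (z + s • w)) (jetNormal (z + s • w))) =ᶠ[𝓝 0]
        fun _ => (1 : ℝ) := by
      have : ∀ᶠ s : ℝ in 𝓝 0, jetNormalVec (z + s • w) ≠ 0 :=
        (contDiff_jetNormalVec.continuous.continuousAt.comp hline.continuousAt).eventually_ne
          (by rw [Function.comp_apply, e0]; exact hN)
      filter_upwards [this] with s hs
      have hs' := norm_ne_zero_iff.2 hs
      rw [real_inner_self_eq_norm_sq, jetNormal, norm_smul, norm_inv, norm_norm,
        inv_mul_cancel₀ hs', one_pow]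
    have h3 := h1.unique ((hasDerivAt_const (0 : ℝ) (1 : ℝ)).congr_of_eventuallyEq h2)
    rw [e0, hν0, real_inner_comm (x : Amb d) ν'] at h3
    linarith
  have hQ : ∀ i j, HasDerivAt (fun s : ℝ => (z + s • w).2.2 i j) ((derivs m x).2 i j) 0 := by
    intro i j
    simpa [hw] using ((hasDerivAt_id' (0 : ℝ)).smul_const ((derivs m x).2 i j)).const_add (z.2.2 i j)
  have hS : ∀ i j, HasDerivAt (fun s : ℝ => jetSecondForm (z + s • w) i j)
      (inner ℝ ((derivs (roundSphere c r) x).2 i j) ν' + inner ℝ ((derivs m x).2 i j) (x : Amb d))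
      0 := by
    intro i j
    have h := (hQ i j).inner ℝ hν
    rw [e0, hν0] at h
    exact h
  have hI := fun i j =>
    hasDerivAt_matrix_inv (fun i j => hasDerivAt_jetMetric c (r := r) m x i j) hne i j
  have hsum := HasDerivAt.fun_sum (u := Finset.univ) fun i _ =>
    HasDerivAt.fun_sum (u := Finset.univ) fun j _ => (hI i j).fun_mul (hS j i)
  have hfun : (fun s : ℝ => jetTrL (z + s • w)) = fun s =>
      ∑ i, ∑ j, (jetMetric (z + s • w))⁻¹ i j * jetSecondForm (z + s • w) j i := by
    ext s
    rw [jetTrL, trace_mul_eq_sum]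
  rw [hfun]
  convert! hsum using 1
  simp only [Finset.sum_add_distrib, mul_add]
  -- The product rule for tr(g⁻¹s) has three contributions, from g⁻¹, from the normal, and from the
  -- second derivatives of m; they are evaluated in `t1`, `t2`, `t3`.
  have t1 : ∑ i, ∑ j, (-((jetMetric (z + (0 : ℝ) • w))⁻¹ *
        (r • ((1 - radialProj x) * diffMatrix m x +
          (diffMatrix m x).transpose * (1 - radialProj x))) *
        (jetMetric (z + (0 : ℝ) • w))⁻¹)) i j * jetSecondForm (z + (0 : ℝ) • w) j i =
      (r ^ 2)⁻¹ * (2 * (diffMatrix m x).trace) := by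
    have h5 : ((r ^ 2)⁻¹ • (1 - radialProj x) + radialProj x) * (1 - radialProj x) =
        (r ^ 2)⁻¹ • (1 - radialProj x) := by
      have hX := radialProj_mul_self x
      rw [mul_sub, mul_one, add_mul, Matrix.smul_mul, sub_mul, one_mul, hX]
      simp
    have h6 := trace_mul_metricDeriv_mul (r := r) hm x (r ^ 2)⁻¹
    rw [e0, hz, jetMetric_roundSphere_inv c hr, jetSecondForm_roundSphere c hr]
    set g' := r • ((1 - radialProj x) * diffMatrix m x +
          (diffMatrix m x).transpose * (1 - radialProj x))
    set gi := (r ^ 2)⁻¹ • (1 - radialProj x) + radialProj x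
    have h7 : ∑ i, ∑ j, (-(gi * g' * gi)) i j * (-r • (1 - radialProj x)) j i =
        (-(gi * g' * gi) * (-r • (1 - radialProj x))).trace := (trace_mul_eq_sum _ _).symm
    rw [h7, neg_mul, neg_smul, mul_neg, neg_neg, Matrix.mul_smul, mul_assoc, h5, Matrix.mul_smul,
      smul_smul, Matrix.trace_smul, h6, smul_eq_mul]
    field_simp
  have t2 : ∑ i, ∑ j, (jetMetric (z + (0 : ℝ) • w))⁻¹ i j *
      inner ℝ ((derivs (roundSphere c r) x).2 j i) ν' = 0 := by
    rw [e0, hz, sum_jetMetric_inv_mul_hessian c hr (isSmooth_roundSphere c r),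
      derivs_roundSphere_snd]
    have h8 : ∀ i, inner ℝ ((r • (derivs (fun x : Sph d => (x : Amb d)) x).2) i i) ν' =
        r * (-2 * ((x : Amb d) i * ν' i)) := fun i => by
      rw [← inner_hessian_coe x hνx, ← real_inner_smul_left]
      rfl
    simp only [h8, ← Finset.mul_sum]
    rw [inner_eq_dotProduct, dotProduct] at hνx
    rw [hνx]
    simp
  have t3 : ∑ i, ∑ j, (jetMetric (z + (0 : ℝ) • w))⁻¹ i j *
      inner ℝ ((derivs m x).2 j i) (x : Amb d) = (r ^ 2)⁻¹ * radialLaplacian m x := by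
    rw [e0, hz, sum_jetMetric_inv_mul_hessian c hr hm, radialLaplacian]
  rw [t1, t2, t3, trace_diffMatrix_eq_divergence]
  ring

end RoundSphere

/-! ### Integrals of the first variations -/

theorem integrable_of_continuous_sph {f : Sph d → ℝ} (hf : Continuous f) :
    Integrable f (surf d) :=
  hf.integrable_of_hasCompactSupport (HasCompactSupport.of_compactSpace f)

theorem integral_const_add_mul_add_mul {f g : Sph d → ℝ} (hf : Integrable f (surf d))
    (hg : Integrable g (surf d)) (a b c : ℝ) :
    ∫ x, (a + b * f x + c * g x) ∂(surf d) =
      (surf d).real univ * a + b * ∫ x, f x ∂(surf d) + c * ∫ x, g x ∂(surf d) := by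
  have h1 : Integrable (fun x => a + b * f x) (surf d) := (integrable_const a).add (hf.const_mul b)
  rw [integral_add h1 (hg.const_mul c), integral_add (integrable_const a) (hf.const_mul b),
    integral_const_mul, integral_const_mul, integral_const, smul_eq_mul]

theorem continuous_divergence {m : Sph d → Amb d} (hm : IsSmooth m) :
    Continuous fun x : Sph d => divergence (radialExt m) (x : Amb d) :=
  continuous_finsetSum _ fun i _ => continuous_coord (continuous_partialD hm i) i

theorem continuous_radialLaplacian {m : Sph d → Amb d} (hm : IsSmooth m) :
    Continuous (radialLaplacian m) := by
  refine continuous_finsetSum _ fun i _ => Continuous.inner ?_ continuous_subtype_val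
  exact (continuous_apply_apply i i).comp (continuous_snd.comp (continuous_derivs hm))

theorem integral_divergence_radialExt {m : Sph d → Amb d} (hm : IsSmooth m) :
    ∫ x : Sph d, divergence (radialExt m) (x : Amb d) ∂(surf d) =
      d * ∫ x : Sph d, inner ℝ (x : Amb d) (m x) ∂(surf d) := by
  have h := integral_divergence (V := radialExt m)
    (fun y hy => (contDiffAt_radialExt hm hy).of_le (by simp)) fun t ht y => radialExt_smul m ht y
  simpa only [radialExt_coe] using h

/-- The field Vᵢ = ⟨∂ᵢm, y⟩ is constant on rays, tangent to the sphere by Euler's relation, and has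
divergence equal to the radial Laplacian plus div m. The divergence theorem makes its integral zero.
-/
theorem integral_radialLaplacian {m : Sph d → Amb d} (hm : IsSmooth m) :
    ∫ x : Sph d, radialLaplacian m x ∂(surf d) =
      - ∫ x : Sph d, divergence (radialExt m) (x : Amb d) ∂(surf d) := by
  let V : Amb d → Amb d := fun y => WithLp.toLp 2 fun i => inner ℝ (partialD m y i) y
  have hVi : ∀ y i, V y i = inner ℝ (partialD m y i) y := fun y i => rfl
  have hV : ∀ y, y ≠ 0 → ContDiffAt ℝ 1 V y := by
    intro y hy
    rw [contDiffAt_euclidean]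
    exact fun i => ((contDiffAt_partialD hm hy i).of_le (by simp)).inner ℝ contDiffAt_id
  have hom : ∀ t : ℝ, 0 < t → ∀ y, V (t • y) = V y := by
    intro t ht y
    ext i
    rw [hVi, hVi, partialD, fderiv_radialExt_smul m ht, _root_.smul_apply, real_inner_smul_left,
      real_inner_smul_right, ← mul_assoc, inv_mul_cancel₀ ht.ne', one_mul, partialD]
  have hdiv : ∀ x : Sph d, divergence V (x : Amb d) =
      radialLaplacian m x + divergence (radialExt m) (x : Amb d) := by
    intro x
    have hx0 := coe_sph_ne_zero x
    rw [divergence, radialLaplacian, divergence, ← Finset.sum_add_distrib]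
    refine Finset.sum_congr rfl fun i _ => ?_
    have hVd := ((hV _ hx0).differentiableAt (by simp)).hasFDerivAt
    have h1 := (EuclideanSpace.proj (𝕜 := ℝ) i).hasFDerivAt.comp (x : Amb d) hVd
    have hp := (contDiffAt_partialD hm hx0 i).differentiableAt (by simp)
    have h2 := hp.hasFDerivAt.inner ℝ (hasFDerivAt_id (x : Amb d))
    have h3 := congrArg (fun L : Amb d →L[ℝ] ℝ => L (stdVec i)) (h1.unique h2)
    simp [fderivInnerCLM_apply] at h3
    rw [h3, add_comm]
    congr 1
    rw [inner_eq_dotProduct]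
    simp [stdVec, partialD]
  have hin : ∀ x : Sph d, inner ℝ (x : Amb d) (V x) = 0 := by
    intro x
    have h := congrArg (fun v => inner ℝ v (x : Amb d)) (sum_smul_partialD hm (coe_sph_ne_zero x))
    simp only [sum_inner, real_inner_smul_left, inner_zero_left] at h
    rw [inner_eq_dotProduct]
    exact h
  have h := integral_divergence hV hom
  simp only [hdiv, hin, integral_zero, mul_zero] at h
  rw [integral_add (integrable_of_continuous_sph (continuous_radialLaplacian hm))
    (integrable_of_continuous_sph (continuous_divergence hm))] at h
  linarith

theorem clm_prod_apply (P : ℝ × ℝ →L[ℝ] ℝ) (a b : ℝ) : P (a, b) = P (1, 0) * a + P (0, 1) * b := by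
  have : ((a, b) : ℝ × ℝ) = a • (1, 0) + b • (0, 1) := by simp
  rw [this, map_add, map_smul, map_smul, smul_eq_mul, smul_eq_mul]
  ring

/-! ### The gradients H and K at round spheres -/

section Gradients

variable {Φ : ℝ → ℝ → ℝ} (c : Amb d) {r : ℝ}

theorem neg_div_neg (hd : 1 ≤ d) (hr : 0 < r) : -(d : ℝ) / r < 0 := by
  have : (0 : ℝ) < d := by exact_mod_cast hd
  exact div_neg_of_neg_of_pos (by linarith) hr

theorem mem_weight_domain (hd : 1 ≤ d) (hr : 0 < r) :
    (sphereVol (d + 1) r, -(d : ℝ) / r) ∈ (Ioi (0 : ℝ) ×ˢ Iio (0 : ℝ)) :=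
  ⟨sphereVol_pos d hr, neg_div_neg hd hr⟩

theorem IsWeight.contDiffAt (hΦ : IsWeight Φ) {p : ℝ × ℝ} (hp : p ∈ (Ioi (0 : ℝ) ×ˢ Iio (0 : ℝ))) :
    ContDiffAt ℝ ∞ (fun p : ℝ × ℝ => Φ p.1 p.2) p :=
  hΦ.smooth.contDiffAt ((isOpen_Ioi.prod isOpen_Iio).mem_nhds hp)

theorem sphereWeight_pos (hΦ : IsWeight Φ) (hd : 1 ≤ d) (hr : 0 < r) :
    0 < sphereWeight Φ d r :=
  hΦ.pos _ _ (sphereVol_pos d hr) (neg_div_neg hd hr)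

/-- The derivative of the weight at the values of the volume and the mean curvature of a sphere. -/
def weightDeriv (Φ : ℝ → ℝ → ℝ) (d : ℕ) (r : ℝ) : ℝ × ℝ →L[ℝ] ℝ :=
  fderiv ℝ (fun p : ℝ × ℝ => Φ p.1 p.2) (sphereVol (d + 1) r, -(d : ℝ) / r)

theorem hasFDerivAt_weight (hΦ : IsWeight Φ) (hd : 1 ≤ d) (hr : 0 < r) :
    HasFDerivAt (fun p : ℝ × ℝ => Φ p.1 p.2) (weightDeriv Φ d r)
      (sphereVol (d + 1) r, -(d : ℝ) / r) :=
  ((hΦ.contDiffAt (mem_weight_domain hd hr)).differentiableAt (by simp)).hasFDerivAt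

/-- Writing the derivative with r⁻¹ avoids the truncated exponent d - 1 in later algebra. -/
theorem hasDerivAt_pow_inv (d : ℕ) (hr : 0 < r) :
    HasDerivAt (fun ρ : ℝ => ρ ^ d) (d * r ^ d * r⁻¹) r := by
  convert! hasDerivAt_pow d r using 1
  cases d with
  | zero => simp
  | succ k => rw [Nat.add_sub_cancel, pow_succ]; field_simp

theorem hasDerivAt_sphereVol (hr : 0 < r) :
    HasDerivAt (sphereVol (d + 1)) (d * sphereVol (d + 1) r * r⁻¹) r := by
  have h := (hasDerivAt_pow_inv d hr).const_mul ((surf d).real univ)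
  rw [funext (sphereVol_eq d)]
  convert! h using 1
  ring

theorem hasDerivAt_sphereWeight (hΦ : IsWeight Φ) (hd : 1 ≤ d) (hr : 0 < r) :
    HasDerivAt (sphereWeight Φ d)
      (weightDeriv Φ d r (d * sphereVol (d + 1) r * r⁻¹, d * (r ^ 2)⁻¹)) r := by
  have h2 : HasDerivAt (fun ρ : ℝ => -(d : ℝ) / ρ) (d * (r ^ 2)⁻¹) r := by
    have := (hasDerivAt_inv hr.ne').const_mul (-(d : ℝ))
    convert! this using 1
    ring
  exact (hasFDerivAt_weight hΦ hd hr).comp_hasDerivAt r ((hasDerivAt_sphereVol hr).prodMk h2)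

/-- The first variation of the volume at a round sphere. -/
theorem hasDerivAt_Vol (hr : 0 < r) {m : Sph d → Amb d} (hm : IsSmooth m) :
    HasDerivAt (fun s : ℝ => Vol (roundSphere c r + s • m))
      (r ^ d * r⁻¹ * (d * ∫ x : Sph d, inner ℝ (x : Amb d) (m x) ∂(surf d))) 0 := by
  have hf := isSmooth_roundSphere c r
  let L : Sph d → ℝ →L[ℝ] Jet d := fun x =>
    (ContinuousLinearMap.id ℝ ℝ).smulRight ((0, derivs m x) : Jet d)
  have hL : Continuous L := by
    have h1 : Continuous fun x => ((0, derivs m x) : Jet d) :=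
      continuous_const.prodMk (continuous_derivs hm)
    exact (ContinuousLinearMap.smulRightL ℝ ℝ (Jet d) (ContinuousLinearMap.id ℝ ℝ)).continuous.comp h1
  have hne : ∀ x, (jetMetric (jet (roundSphere c r) x)).det ≠ 0 := fun x => by
    rw [jetMetric_roundSphere_det c hr]
    have := pow_pos hr d
    positivity
  have hcd := fun x => (contDiffAt_jetDensity (hne x)).of_le (m := 1) (by simp)
  have h := hasDerivAt_integral_of_contDiffAt (μ := surf d) (continuous_jet hf) hL hcd
    (hasDerivAt_id' (0 : ℝ)) rfl
  have e1 : (fun s : ℝ => Vol (roundSphere c r + s • m)) =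
      fun s => ∫ x, jetDensity (jet (roundSphere c r) x + L x s) ∂(surf d) := by
    ext s
    simp only [Vol, volDensity_eq_jet, jet_add_smul hf hm]
    rfl
  have e2 : ∀ x, fderiv ℝ jetDensity (jet (roundSphere c r) x) (L x 1) =
      r ^ d * r⁻¹ * divergence (radialExt m) (x : Amb d) := by
    intro x
    have h1 := ((hcd x).differentiableAt (by simp)).hasFDerivAt
    have hline : HasDerivAt (fun s : ℝ => jet (roundSphere c r) x + s • ((0, derivs m x) : Jet d))
        (0, derivs m x) 0 := by
      simpa using ((hasDerivAt_id' (0 : ℝ)).smul_const ((0, derivs m x) : Jet d)).const_add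
        (jet (roundSphere c r) x)
    have h2 := HasFDerivAt.comp_hasDerivAt (0 : ℝ) (by rwa [zero_smul, add_zero]) hline
    have h3 := h2.unique (hasDerivAt_jetDensity c hr hm x)
    simpa [L] using h3
  rw [e1]
  convert! h using 1
  simp only [e2]
  rw [integral_const_mul, integral_divergence_radialExt hm]

/-- The first variation of the metric at a round sphere, for constant normal fields. -/
theorem hasDerivAt_G_roundSphere (hΦ : IsWeight Φ) (hd : 1 ≤ d) (hr : 0 < r) (a : ℝ)
    {m : Sph d → Amb d} (hm : IsSmooth m) :
    HasDerivAt (fun s : ℝ => G Φ (roundSphere c r + s • m) (fun x => a • (x : Amb d))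
        (fun x => a • (x : Amb d)))
      (a ^ 2 * (weightDeriv Φ d r (d * sphereVol (d + 1) r * r⁻¹, d * (r ^ 2)⁻¹) +
        sphereWeight Φ d r * d * r⁻¹) * r ^ d *
          ∫ x : Sph d, inner ℝ (x : Amb d) (m x) ∂(surf d)) 0 := by
  have hf := isSmooth_roundSphere c r
  have hrd := pow_pos hr d
  set I := ∫ x : Sph d, inner ℝ (x : Amb d) (m x) ∂(surf d)
  set V' := r ^ d * r⁻¹ * (d * I) with hV'
  -- The integrand depends on f locally through the jet and globally through the volume, so the
  -- volume becomes an extra coordinate and `γ` below records its variation.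
  let Ψ : ℝ × Jet d → ℝ := fun q => Φ q.1 (jetTrL q.2) * jetDensity q.2
  let e : Sph d → ℝ × Jet d := fun x => (sphereVol (d + 1) r, jet (roundSphere c r) x)
  let L : Sph d → ℝ × ℝ →L[ℝ] ℝ × Jet d := fun x =>
    (ContinuousLinearMap.fst ℝ ℝ ℝ).prod
      ((ContinuousLinearMap.snd ℝ ℝ ℝ).smulRight ((0, derivs m x) : Jet d))
  have he : Continuous e := continuous_const.prodMk (continuous_jet hf)
  have hL : Continuous L := by
    have h1 : Continuous fun x => ((0, derivs m x) : Jet d) :=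
      continuous_const.prodMk (continuous_derivs hm)
    have h2 := (ContinuousLinearMap.smulRightL ℝ (ℝ × ℝ) (Jet d)
      (ContinuousLinearMap.snd ℝ ℝ ℝ)).continuous.comp h1
    exact (ContinuousLinearMap.prodₗᵢ ℝ).continuous.comp (continuous_const.prodMk h2)
  have hne : ∀ x, (jetMetric (jet (roundSphere c r) x)).det ≠ 0 := fun x => by
    rw [jetMetric_roundSphere_det c hr]
    positivity
  have hT : ∀ x, jetTrL (jet (roundSphere c r) x) = -(d : ℝ) / r := fun x =>
    trL_roundSphere c hr x
  have hD : ∀ x, jetDensity (jet (roundSphere c r) x) = r ^ d := fun x => by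
    rw [jetDensity, jetMetric_roundSphere_det c hr, Real.sqrt_sq hrd.le]
  have hΨ : ∀ x, ContDiffAt ℝ 1 Ψ (e x) := by
    intro x
    have h1 : ContDiffAt ℝ ∞ (fun q : ℝ × Jet d => jetTrL q.2) (e x) :=
      ContDiffAt.comp (g := jetTrL) (f := fun q : ℝ × Jet d => q.2) (e x) (contDiffAt_jetTrL (hne x) (jetNormalVec_roundSphere_ne_zero c hr x))
        contDiffAt_snd
    have h2 : ContDiffAt ℝ ∞ (fun q : ℝ × Jet d => jetDensity q.2) (e x) :=
      ContDiffAt.comp (g := jetDensity) (f := fun q : ℝ × Jet d => q.2) (e x)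
        (contDiffAt_jetDensity (hne x)) contDiffAt_snd
    have h3 : ContDiffAt ℝ ∞ (fun q : ℝ × Jet d => Φ q.1 (jetTrL q.2)) (e x) := by
      refine ContDiffAt.comp (g := fun p : ℝ × ℝ => Φ p.1 p.2) (e x) ?_
        (contDiffAt_fst.prodMk h1)
      refine hΦ.contDiffAt ?_
      simp only [e, hT]
      exact mem_weight_domain hd hr
    exact (h3.mul h2).of_le (by simp)
  let γ : ℝ → ℝ × ℝ := fun s => (Vol (roundSphere c r + s • m) - sphereVol (d + 1) r, s)
  have hγ : HasDerivAt γ (V', 1) 0 :=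
    ((hasDerivAt_Vol c hr hm).sub_const _).prodMk (hasDerivAt_id' 0)
  have hγ0 : γ 0 = 0 := by simp [γ, Vol_roundSphere c hr]
  have h := hasDerivAt_integral_of_contDiffAt (μ := surf d) he hL hΨ hγ hγ0
  have e1 : (fun s : ℝ => G Φ (roundSphere c r + s • m) (fun x => a • (x : Amb d))
        (fun x => a • (x : Amb d))) =
      fun s => a ^ 2 * ∫ x, Ψ (e x + L x (γ s)) ∂(surf d) := by
    ext s
    rw [G, ← integral_const_mul]
    congr 1
    ext x
    simp only [volDensity_eq_jet, trL_eq_jet, jet_add_smul hf hm,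
      real_inner_self_eq_norm_sq, norm_smul, norm_coe_sph, mul_one, Real.norm_eq_abs, sq_abs,
      Ψ, e, L, γ,
      ContinuousLinearMap.prod_apply, ContinuousLinearMap.smulRight_apply,
      ContinuousLinearMap.coe_fst', ContinuousLinearMap.coe_snd', Prod.fst_add, Prod.snd_add,
      add_sub_cancel]
    ring
  have e2 : ∀ x, fderiv ℝ Ψ (e x) (L x (V', 1)) =
      weightDeriv Φ d r (V', (r ^ 2)⁻¹ * (2 * divergence (radialExt m) (x : Amb d) +
        radialLaplacian m x)) * r ^ d +
      sphereWeight Φ d r * (r ^ d * r⁻¹ * divergence (radialExt m) (x : Amb d)) := by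
    intro x
    have h1 := ((hΨ x).differentiableAt (by simp)).hasFDerivAt
    have hline : HasDerivAt (fun s : ℝ => e x + s • L x (V', 1)) (L x (V', 1)) 0 := by
      simpa using ((hasDerivAt_id' (0 : ℝ)).smul_const (L x (V', 1))).const_add (e x)
    have h2 := HasFDerivAt.comp_hasDerivAt (0 : ℝ) (f := fun s : ℝ => e x + s • L x (V', 1))
      (by rwa [zero_smul, add_zero]) hline
    have hd1 := hasDerivAt_jetDensity c hr hm x
    have hd2 := hasDerivAt_jetTrL c hr hm x
    have hd3 : HasDerivAt (fun s : ℝ => sphereVol (d + 1) r + s * V') V' 0 := by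
      simpa using ((hasDerivAt_id' (0 : ℝ)).mul_const V').const_add (sphereVol (d + 1) r)
    have hw := hasFDerivAt_weight hΦ hd hr
    have hd4 := HasFDerivAt.comp_hasDerivAt (0 : ℝ) (l := fun p : ℝ × ℝ => Φ p.1 p.2)
      (by simpa [hT] using hw) (hd3.prodMk hd2)
    have hd5 := hd4.mul hd1
    have h3 := h2.unique (f := Ψ ∘ fun s : ℝ => e x + s • L x (V', 1)) (by
      convert! hd5 using 1
      ext s
      simp [Ψ, e, L])
    have e0 : jet (roundSphere c r) x + (0 : ℝ) • ((0, derivs m x) : Jet d) =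
        jet (roundSphere c r) x := by rw [zero_smul, add_zero]
    rw [h3]
    simp only [Function.comp_apply, e0, hT, hD, zero_mul, add_zero, sphereWeight]
  have hi1 := integrable_of_continuous_sph (continuous_divergence hm)
  have hi2 := integrable_of_continuous_sph (continuous_radialLaplacian hm)
  have e3 : ∀ x : Sph d, weightDeriv Φ d r (V', (r ^ 2)⁻¹ * (2 * divergence (radialExt m) (x : Amb d) +
        radialLaplacian m x)) * r ^ d +
      sphereWeight Φ d r * (r ^ d * r⁻¹ * divergence (radialExt m) (x : Amb d)) =
      (weightDeriv Φ d r (1, 0) * V' * r ^ d +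
        (weightDeriv Φ d r (0, 1) * (r ^ 2)⁻¹ * r ^ d * 2 + sphereWeight Φ d r * r ^ d * r⁻¹) *
          divergence (radialExt m) (x : Amb d)) +
        weightDeriv Φ d r (0, 1) * (r ^ 2)⁻¹ * r ^ d * radialLaplacian m x := by
    intro x
    rw [clm_prod_apply]
    ring
  rw [e1]
  convert! h.const_mul (a ^ 2) using 1
  simp only [e2, e3]
  -- Since the radial Laplacian integrates to -∫ div m, the curvature variation 2 div m + Laplacian
  -- contributes a single ∫ div m = d∫⟨x, m⟩. Its coefficient d r⁻² is the derivative of -d/ρ at r.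
  rw [integral_const_add_mul_add_mul hi1 hi2,
    integral_radialLaplacian hm, integral_divergence_radialExt hm,
    clm_prod_apply (weightDeriv Φ d r) (_ * _), hV', sphereVol_eq]
  ring

/-- The logarithmic derivative of `ρ ↦ Φ(V(ρ), -d / ρ) V(ρ)`. -/
def logDerivWeight (Φ : ℝ → ℝ → ℝ) (d : ℕ) (r : ℝ) : ℝ :=
  weightDeriv Φ d r (d * sphereVol (d + 1) r * r⁻¹, d * (r ^ 2)⁻¹) / sphereWeight Φ d r + d * r⁻¹

theorem hasDerivAt_sphereWeight_mul_sphereVol (hΦ : IsWeight Φ) (hd : 1 ≤ d) (hr : 0 < r) :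
    HasDerivAt (fun ρ => sphereWeight Φ d ρ * sphereVol (d + 1) ρ)
      (sphereWeight Φ d r * sphereVol (d + 1) r * logDerivWeight Φ d r) r := by
  convert! (hasDerivAt_sphereWeight hΦ hd hr).fun_mul (hasDerivAt_sphereVol hr) using 1
  have := (sphereWeight_pos hΦ hd hr).ne'
  rw [logDerivWeight]
  field_simp

/-- The first variation sees m only through ∫⟨x, m⟩, so it is represented by a constant multiple of
x; division by Φ r^d produces the logarithmic derivative of W. -/
theorem isHGradient_roundSphere (hΦ : IsWeight Φ) (hd : 1 ≤ d) (hr : 0 < r) (a : ℝ) :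
    IsHGradient Φ (roundSphere c r) (fun x => a • (x : Amb d)) (fun x => a • (x : Amb d))
      (fun x => (a ^ 2 * logDerivWeight Φ d r) • (x : Amb d)) := by
  refine ⟨isSmooth_coe.const_smul _, fun m hm => ?_⟩
  convert! hasDerivAt_G_roundSphere c hΦ hd hr a hm using 1
  have := (sphereWeight_pos hΦ hd hr).ne'
  rw [G_roundSphere Φ c hr]
  simp only [real_inner_smul_right, real_inner_comm]
  rw [integral_const_mul, logDerivWeight]
  field_simp

/-- Moving in the direction a x stays among round spheres, so a derivative in the radius alone is
enough here. -/
theorem isKGradient_roundSphere (hΦ : IsWeight Φ) (hd : 1 ≤ d) (hr : 0 < r) (a : ℝ) :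
    IsKGradient Φ (roundSphere c r) (fun x => a • (x : Amb d)) (fun x => a • (x : Amb d))
      (fun x => (a ^ 2 * logDerivWeight Φ d r) • (x : Amb d)) := by
  refine ⟨isSmooth_coe.const_smul _, fun k _ => ?_⟩
  have hline : HasDerivAt (fun s : ℝ => r + s * a) a 0 := by
    simpa using ((hasDerivAt_id' (0 : ℝ)).mul_const a).const_add r
  have hpos : ∀ᶠ s : ℝ in 𝓝 0, 0 < r + s * a :=
    continuousAt_const.eventually_lt hline.continuousAt (by simpa using hr)
  have he : (fun s : ℝ => G Φ (roundSphere c r + s • fun x : Sph d => a • (x : Amb d))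
      (fun x => a • (x : Amb d)) k) =ᶠ[𝓝 0] fun s => sphereWeight Φ d (r + s * a) *
        (r + s * a) ^ d * ∫ x : Sph d, inner ℝ (a • (x : Amb d)) (k x) ∂(surf d) := by
    filter_upwards [hpos] with s hs
    rw [← G_roundSphere Φ c hs]
    congr 1
    ext1 x
    simp only [roundSphere, Pi.add_apply, Pi.smul_apply]
    rw [add_assoc, add_smul, mul_smul]
  have h1 := ((hasDerivAt_sphereWeight hΦ hd hr).mul (hasDerivAt_pow_inv d hr))
  have h2 := (HasDerivAt.scomp (0 : ℝ) (by simpa using h1) hline).mul_const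
    (∫ x : Sph d, inner ℝ (a • (x : Amb d)) (k x) ∂(surf d))
  refine HasDerivAt.congr_of_eventuallyEq ?_ he
  convert! h2 using 1
  have := (sphereWeight_pos hΦ hd hr).ne'
  rw [G_roundSphere Φ c hr]
  simp only [real_inner_smul_left]
  rw [integral_const_mul, integral_const_mul, logDerivWeight]
  simp only [smul_eq_mul]
  field_simp

end Gradients

/-! ### The geodesic equation -/

section GeodesicEquation

variable {Φ : ℝ → ℝ → ℝ} (x₀ : Amb d) {r : ℝ → ℝ} {I : Set ℝ}

theorem hasDerivAt_of_contDiffOn (hI : IsOpen I) (hr : ContDiffOn ℝ ∞ r I) {t : ℝ} (ht : t ∈ I) :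
    HasDerivAt r (deriv r t) t ∧ HasDerivAt (deriv r) (deriv (deriv r) t) t := by
  have h1 : ContDiffAt ℝ ∞ r t := hr.contDiffAt (hI.mem_nhds ht)
  exact ⟨(h1.differentiableAt (by simp)).hasDerivAt,
    (((hr.deriv_of_isOpen hI (m := ∞) (by simp)).contDiffAt (hI.mem_nhds ht)).differentiableAt
      (by simp)).hasDerivAt⟩

/-- The standard parametrizations already form a horizontal path, and H = K there, so ½H - K = -½H
is the prescribed acceleration. -/
theorem isConcentricGeodesic_of_equation (hΦ : IsWeight Φ) (hd : 1 ≤ d) (hI : IsOpen I)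
    (hr : ContDiffOn ℝ ∞ r I) (hpos : ∀ t ∈ I, 0 < r t)
    (heq : ∀ t ∈ I, deriv (deriv r) t = -(1 / 2) * deriv r t ^ 2 * logDerivWeight Φ d (r t)) :
    IsConcentricGeodesic Φ x₀ r I := by
  have h1 : ∀ t ∈ I, timeD (fun t => roundSphere x₀ (r t)) t =
      fun x : Sph d => deriv r t • (x : Amb d) := by
    intro t ht
    ext1 x
    exact (((hasDerivAt_of_contDiffOn hI hr ht).1.smul_const (x : Amb d)).const_add x₀).deriv
  have h2 : ∀ t ∈ I, ∀ x : Sph d, timeD (timeD fun t => roundSphere x₀ (r t)) t x =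
      deriv (deriv r) t • (x : Amb d) := by
    intro t ht x
    have he : (fun τ => timeD (fun t => roundSphere x₀ (r t)) τ x) =ᶠ[𝓝 t]
        fun τ => deriv r τ • (x : Amb d) := by
      filter_upwards [hI.mem_nhds ht] with τ hτ
      rw [h1 τ hτ]
    rw [timeD, he.deriv_eq]
    exact ((hasDerivAt_of_contDiffOn hI hr ht).2.smul_const (x : Amb d)).deriv
  refine ⟨fun t => roundSphere x₀ (r t), ⟨?_, ?_, ?_, ?_⟩, fun t _ => sameShape_refl _⟩
  · have hr' : ContMDiffOn (𝓘(ℝ, ℝ).prod (𝓡 d)) 𝓘(ℝ, ℝ) ∞ (fun p : ℝ × Sph d => r p.1)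
        (I ×ˢ univ) :=
      hr.contMDiffOn.comp contMDiff_fst.contMDiffOn fun p hp => hp.1
    have hx : ContMDiff (𝓘(ℝ, ℝ).prod (𝓡 d)) 𝓘(ℝ, Amb d) ∞ (fun p : ℝ × Sph d => (p.2 : Amb d)) :=
      ContMDiff.comp isSmooth_coe contMDiff_snd
    exact contMDiffOn_const.add (hr'.smul hx.contMDiffOn)
  · exact fun t ht => isImm_roundSphere x₀ (hpos t ht)
  · intro t ht x X
    rw [h1 t ht]
    exact (real_inner_smul_left _ _ _).trans
      (mul_eq_zero_of_right _ (inner_mfderiv_roundSphere x₀ (r t) x X))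
  · intro t ht
    rw [h1 t ht]
    refine ⟨_, _, isHGradient_roundSphere x₀ hΦ hd (hpos t ht) (deriv r t),
      isKGradient_roundSphere x₀ hΦ hd (hpos t ht) (deriv r t), fun x => ?_⟩
    rw [h2 t ht, heq t ht, smul_smul, ← sub_smul]
    congr 1
    ring

-- The hypotheses say that the transposed cone matrix annihilates w, and that matrix is invertible.
open Matrix in
theorem eq_zero_of_orthogonal {φ : Sph d ≃ₘ^∞⟮𝓡 d, 𝓡 d⟯ Sph d} (x : Sph d) {w : Amb d}
    (h1 : inner ℝ w (φ x : Amb d) = 0)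
    (h2 : ∀ i, inner ℝ w (partialD (fun x => (φ x : Amb d)) (x : Amb d) i) = 0) : w = 0 := by
  have hdet := coneMatrix_det_ne_zero φ x
  rw [← det_transpose] at hdet
  have h3 : (coneMatrix (fun x => (φ x : Amb d)) x)ᵀ *ᵥ (w : Fin (d + 1) → ℝ) = 0 := by
    rw [real_inner_comm, inner_eq_dotProduct] at h1
    rw [coneMatrix, transpose_add, add_mulVec, transpose_vecMulVec, vecMulVec_mulVec, h1]
    ext i
    have := h2 i
    rw [real_inner_comm, inner_eq_dotProduct] at this
    simpa [diffMatrix, mulVec] using this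
  have h4 := eq_zero_of_mulVec_eq_zero hdet h3
  ext i
  exact congrFun h4 i

/-- No regularity of φ in time is available, so φ is not differentiated. The component of f_t along
φ comes from ‖f - x₀‖² = r², and the tangential components vanish by horizontality. -/
theorem timeD_of_isHorizontalGeodesic {f : ℝ → Sph d → Amb d} (hf : IsHorizontalGeodesic Φ f I)
    (hI : IsOpen I) (hr : ContDiffOn ℝ ∞ r I) (hpos : ∀ t ∈ I, 0 < r t)
    {φ : ℝ → Sph d ≃ₘ^∞⟮𝓡 d, 𝓡 d⟯ Sph d}
    (hφ : ∀ t ∈ I, ∀ x, f t x = roundSphere x₀ (r t) (φ t x)) {t : ℝ} (ht : t ∈ I) (x : Sph d) :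
    HasDerivAt (fun τ => f τ x) (deriv r t • (φ t x : Amb d)) t := by
  have hfx : ContDiffOn ℝ ∞ (fun τ => f τ x) I := by
    rw [← contMDiffOn_iff_contDiffOn]
    have h : ContMDiff 𝓘(ℝ, ℝ) (𝓘(ℝ, ℝ).prod (𝓡 d)) ∞ (fun τ : ℝ => (τ, x)) :=
      contMDiff_id.prodMk contMDiff_const
    exact hf.smooth.comp h.contMDiffOn fun τ hτ => ⟨hτ, mem_univ _⟩
  have hF : HasDerivAt (fun τ => f τ x) (timeD f t x) t :=
    (((hfx.contDiffAt (hI.mem_nhds ht)).differentiableAt (by simp))).hasDerivAt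
  have hrt := (hasDerivAt_of_contDiffOn hI hr ht).1
  have hr0 := (hpos t ht).ne'
  have hu : ∀ τ ∈ I, f τ x - x₀ = r τ • (φ τ x : Amb d) := fun τ hτ => by
    rw [hφ τ hτ, roundSphere, add_sub_cancel_left]
  have hnorm : inner ℝ (timeD f t x) (φ t x : Amb d) = deriv r t := by
    have h1 := (hF.sub_const x₀).norm_sq
    have h2 : (fun τ => ‖f τ x - x₀‖ ^ 2) =ᶠ[𝓝 t] fun τ => r τ ^ 2 := by
      filter_upwards [hI.mem_nhds ht] with τ hτ
      rw [hu τ hτ, norm_smul, norm_coe_sph, mul_one, Real.norm_eq_abs, sq_abs]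
    have h3 := h1.unique ((hrt.fun_pow 2).congr_of_eventuallyEq h2)
    rw [hu t ht, real_inner_smul_left, real_inner_comm] at h3
    have h4 : r t * (inner ℝ (timeD f t x) (φ t x : Amb d) - deriv r t) = 0 := by
      push_cast at h3
      simp only [pow_one] at h3
      linarith
    have := (mul_eq_zero.1 h4).resolve_left hr0
    linarith
  have hsm := isSmooth_coe_comp (φ t).contMDiff
  have hft : f t = fun x => x₀ + r t • (φ t x : Amb d) := funext fun x => hφ t ht x
  have horth : ∀ i, inner ℝ (timeD f t x) (partialD (fun x => (φ t x : Amb d)) (x : Amb d) i) = 0 := by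
    intro i
    obtain ⟨p, rfl, X, hX⟩ := exists_fderiv_radialExt_eq_mfderiv (hf.imm t ht).1 x (stdVec i)
    have h1 := hf.horizontal t ht p X
    rw [← hX] at h1
    have h2 : fderiv ℝ (radialExt (f t)) (p : Amb d) (stdVec i) =
        r t • partialD (fun x => (φ t x : Amb d)) (p : Amb d) i := by
      rw [hft]
      exact partialD_const_add_smul x₀ hsm (r t) (coe_sph_ne_zero p) i
    rw [h2, real_inner_smul_right] at h1
    exact (mul_eq_zero.1 h1).resolve_left hr0
  have hw : timeD f t x - deriv r t • (φ t x : Amb d) = 0 := by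
    refine eq_zero_of_orthogonal (φ := φ t) x ?_ fun i => ?_
    · rw [inner_sub_left, hnorm, real_inner_smul_left, real_inner_self_eq_norm_sq, norm_coe_sph]
      ring
    · have h1 := inner_partialD_self hsm (fun x => norm_coe_sph _) (coe_sph_ne_zero x) i
      rw [radialExt_coe, real_inner_comm] at h1
      rw [inner_sub_left, horth, real_inner_smul_left, h1, mul_zero, sub_zero]
  rw [sub_eq_zero] at hw
  rwa [← hw]

/-- The geodesic equation is paired with u = φ_t. Both f + su and f + s f_t are spheres in the same
parametrization with a changed radius, so G(u, H) and G(K, u) both equal r'² W'(r), and r'' W = (½ -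
1) r'² W' follows. -/
theorem equation_of_isConcentricGeodesic (hΦ : IsWeight Φ) (hd : 1 ≤ d) (hI : IsOpen I)
    (hr : ContDiffOn ℝ ∞ r I) (hpos : ∀ t ∈ I, 0 < r t) (h : IsConcentricGeodesic Φ x₀ r I) :
    ∀ t ∈ I, deriv (deriv r) t = -(1 / 2) * deriv r t ^ 2 * logDerivWeight Φ d (r t) := by
  obtain ⟨f, hf, hs⟩ := h
  have : ∃ φ : ℝ → Sph d ≃ₘ^∞⟮𝓡 d, 𝓡 d⟯ Sph d, ∀ t ∈ I, IsOrientationPreserving (φ t) ∧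
      ∀ x, f t x = roundSphere x₀ (r t) (φ t x) := by
    have : Nonempty (Sph d ≃ₘ^∞⟮𝓡 d, 𝓡 d⟯ Sph d) := ⟨Diffeomorph.refl (𝓡 d) (Sph d) ∞⟩
    choose! φ hφ using hs
    exact ⟨φ, hφ⟩
  obtain ⟨φ, hφ⟩ := this
  intro t ht
  have hderiv := fun τ hτ x => timeD_of_isHorizontalGeodesic x₀ hf hI hr hpos
    (fun τ hτ => (hφ τ hτ).2) (t := τ) hτ x
  obtain ⟨hr1, hr2⟩ := hasDerivAt_of_contDiffOn hI hr ht
  have hrt := hpos t ht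
  have hr0 := hrt.ne'
  have hor := (hφ t ht).1
  set u : Sph d → Amb d := fun x => (φ t x : Amb d) with hu
  have hus : IsSmooth u := isSmooth_coe_comp (φ t).contMDiff
  have hft : f t = fun x => x₀ + r t • u x := funext fun x => (hφ t ht).2 x
  have hvel : timeD f t = fun x => deriv r t • u x := funext fun x => (hderiv t ht x).deriv
  have hacc : ∀ x, timeD (timeD f) t x = deriv (deriv r) t • u x := by
    intro x
    -- Rewriting the velocity as (r'/r)(f - x₀) eliminates φ_τ, so the acceleration follows from the
    -- known derivatives of r and f.
    have he : (fun τ => timeD f τ x) =ᶠ[𝓝 t] fun τ => (deriv r τ * (r τ)⁻¹) • (f τ x - x₀) := by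
      filter_upwards [hI.mem_nhds ht] with τ hτ
      have h1 : timeD f τ x = deriv r τ • (φ τ x : Amb d) := (hderiv τ hτ x).deriv
      rw [h1, (hφ τ hτ).2 x, roundSphere, add_sub_cancel_left, smul_smul, mul_assoc,
        inv_mul_cancel₀ (hpos τ hτ).ne', mul_one]
    have h2 := (hr2.fun_mul (hr1.fun_inv hr0)).fun_smul ((hderiv t ht x).sub_const x₀)
    have h3 : timeD (timeD f) t x = _ := he.deriv_eq.trans h2.deriv
    rw [h3, (hφ t ht).2 x, roundSphere, add_sub_cancel_left, smul_smul, smul_smul, ← add_smul]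
    congr 1
    field_simp
    ring
  obtain ⟨H, K, ⟨hHs, hH⟩, ⟨hKs, hK⟩, hHK⟩ := hf.equation t ht
  set W : ℝ → ℝ := fun ρ => sphereWeight Φ d ρ * sphereVol (d + 1) ρ with hW
  set W' : ℝ := sphereWeight Φ d (r t) * sphereVol (d + 1) (r t) * logDerivWeight Φ d (r t)
  have hWd : HasDerivAt W W' (r t) := hasDerivAt_sphereWeight_mul_sphereVol hΦ hd hrt
  have hGH : G Φ (f t) u H = deriv r t ^ 2 * W' := by
    have h1 := hH u hus
    have hline : HasDerivAt (fun s : ℝ => r t + s) 1 0 := (hasDerivAt_id' (0 : ℝ)).const_add (r t)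
    have hp : ∀ᶠ s : ℝ in 𝓝 0, 0 < r t + s :=
      continuousAt_const.eventually_lt hline.continuousAt (by simpa using hrt)
    have h2 : (fun s : ℝ => G Φ (f t + s • u) (timeD f t) (timeD f t)) =ᶠ[𝓝 0]
        fun s => deriv r t ^ 2 * W (r t + s) := by
      filter_upwards [hp] with s hs
      rw [hvel, sq, ← G_reparametrized_normal hor Φ x₀ hs]
      congr 1
      ext1 x
      simp only [hft, Pi.add_apply, Pi.smul_apply]
      rw [add_assoc, add_smul]
    have h3 := (HasDerivAt.comp (0 : ℝ) (by simpa using hWd) hline).const_mul (deriv r t ^ 2)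
    rw [mul_one] at h3
    exact h1.unique (h3.congr_of_eventuallyEq h2)
  have hGK : G Φ (f t) K u = deriv r t ^ 2 * W' := by
    have h1 := hK u hus
    have hline : HasDerivAt (fun s : ℝ => r t + s * deriv r t) (deriv r t) 0 := by
      simpa using ((hasDerivAt_id' (0 : ℝ)).mul_const (deriv r t)).const_add (r t)
    have hp : ∀ᶠ s : ℝ in 𝓝 0, 0 < r t + s * deriv r t :=
      continuousAt_const.eventually_lt hline.continuousAt (by simpa using hrt)
    have h2 : (fun s : ℝ => G Φ (f t + s • timeD f t) (timeD f t) u) =ᶠ[𝓝 0]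
        fun s => deriv r t * W (r t + s * deriv r t) := by
      filter_upwards [hp] with s hs
      have h4 := G_reparametrized_normal hor Φ x₀ hs (deriv r t) 1
      rw [mul_one] at h4
      rw [hvel, ← h4]
      congr 1
      · ext1 x
        simp only [hft, Pi.add_apply, Pi.smul_apply]
        rw [add_assoc, add_smul, mul_smul]
      · ext1 x
        rw [one_smul]
    have h3 := (HasDerivAt.comp (0 : ℝ) (by simpa using hWd) hline).const_mul (deriv r t)
    have h5 := h1.unique (h3.congr_of_eventuallyEq h2)
    rw [h5]
    ring
  have hWpos : 0 < W (r t) := mul_pos (sphereWeight_pos hΦ hd hrt) (sphereVol_pos d hrt)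
  have hGacc : G Φ (f t) u (fun x => deriv (deriv r) t • u x) = deriv (deriv r) t * W (r t) := by
    have h4 := G_reparametrized_normal hor Φ x₀ hrt 1 (deriv (deriv r) t)
    simp only [one_smul, one_mul] at h4
    rw [hft]
    exact h4
  have hsplit : G Φ (f t) u (fun x => deriv (deriv r) t • u x) =
      (1 / 2) * G Φ (f t) u H - G Φ (f t) K u := by
    have hcB := continuous_coneMatrix_det hus
    have hcu := isSmooth_continuous hus
    have hiH : Integrable (fun x => inner ℝ (u x) (H x) * (coneMatrix u x).det) (surf d) :=
      integrable_of_continuous_sph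
      ((hcu.inner (𝕜 := ℝ) (isSmooth_continuous hHs)).mul hcB)
    have hiK : Integrable (fun x => inner ℝ (K x) (u x) * (coneMatrix u x).det) (surf d) :=
      integrable_of_continuous_sph
      (((isSmooth_continuous hKs).inner (𝕜 := ℝ) hcu).mul hcB)
    rw [hft]
    simp only [hu, G_reparametrized hor Φ x₀ hrt]
    simp only [← hu]
    have h6 : ∀ x, inner ℝ (φ t x : Amb d) (deriv (deriv r) t • (φ t x : Amb d)) *
        (coneMatrix u x).det = (1 / 2) * (inner ℝ (u x) (H x) * (coneMatrix u x).det) -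
          inner ℝ (K x) (u x) * (coneMatrix u x).det := by
      intro x
      have h7 : deriv (deriv r) t • (φ t x : Amb d) = (1 / 2 : ℝ) • H x - K x := by
        rw [← hHK x, hacc x]
      rw [h7, inner_sub_right, real_inner_smul_right, real_inner_comm (φ t x : Amb d) (K x)]
      ring
    rw [integral_congr_ae (ae_of_all _ h6), integral_sub (hiH.const_mul _) hiK,
      integral_const_mul]
    ring
  rw [hGacc, hGH, hGK] at hsplit
  have h8 : (deriv (deriv r) t + 1 / 2 * deriv r t ^ 2 * logDerivWeight Φ d (r t)) * W (r t) = 0 := by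
    have : W' = W (r t) * logDerivWeight Φ d (r t) := rfl
    rw [this] at hsplit
    linarith
  have := (mul_eq_zero.1 h8).resolve_right hWpos.ne'
  linarith

theorem isConcentricGeodesic_iff (hΦ : IsWeight Φ) (hd : 1 ≤ d) (hI : IsOpen I)
    (hr : ContDiffOn ℝ ∞ r I) (hpos : ∀ t ∈ I, 0 < r t) :
    IsConcentricGeodesic Φ x₀ r I ↔
      ∀ t ∈ I, deriv (deriv r) t = -(1 / 2) * deriv r t ^ 2 * logDerivWeight Φ d (r t) :=
  ⟨equation_of_isConcentricGeodesic x₀ hΦ hd hI hr hpos,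
    isConcentricGeodesic_of_equation x₀ hΦ hd hI hr hpos⟩

theorem logDerivWeight_eq (hΦ : IsWeight Φ) (hd : 1 ≤ d) {ρ : ℝ} (hρ : 0 < ρ) :
    logDerivWeight Φ d ρ = 2 * ((d : ℝ) / Φ (sphereVol (d + 1) ρ) (-(d : ℝ) / ρ)) *
      (1 / (2 * ρ) * Φ (sphereVol (d + 1) ρ) (-(d : ℝ) / ρ) +
        deriv (fun v => Φ v (-(d : ℝ) / ρ)) (sphereVol (d + 1) ρ) / 2 *
          (((d + 1 : ℕ) : ℝ) * Real.pi ^ (((d + 1 : ℕ) : ℝ) / 2) * ρ ^ (d + 1 - 2) /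
            Real.Gamma (1 + ((d + 1 : ℕ) : ℝ) / 2)) +
        1 / (2 * ρ ^ 2) * deriv (fun y => Φ (sphereVol (d + 1) ρ) y) (-(d : ℝ) / ρ)) := by
  have hP := hasFDerivAt_weight hΦ hd hρ
  have h1 : deriv (fun v => Φ v (-(d : ℝ) / ρ)) (sphereVol (d + 1) ρ) =
      weightDeriv Φ d ρ (1, 0) := by
    have h := hP.comp_hasDerivAt (sphereVol (d + 1) ρ)
      ((hasDerivAt_id' (sphereVol (d + 1) ρ)).prodMk
        (hasDerivAt_const (sphereVol (d + 1) ρ) (-(d : ℝ) / ρ)))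
    exact h.deriv
  have h2 : deriv (fun y => Φ (sphereVol (d + 1) ρ) y) (-(d : ℝ) / ρ) =
      weightDeriv Φ d ρ (0, 1) := by
    have h := hP.comp_hasDerivAt (-(d : ℝ) / ρ)
      ((hasDerivAt_const (-(d : ℝ) / ρ) (sphereVol (d + 1) ρ)).prodMk
        (hasDerivAt_id' (-(d : ℝ) / ρ)))
    exact h.deriv
  have h3 : ((d + 1 : ℕ) : ℝ) * Real.pi ^ (((d + 1 : ℕ) : ℝ) / 2) * ρ ^ (d + 1 - 2) /
            Real.Gamma (1 + ((d + 1 : ℕ) : ℝ) / 2) = sphereVol (d + 1) ρ * ρ⁻¹ := by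
    -- Here d ≥ 1 ensures that the natural subtraction n - 2 is not truncated.
    obtain ⟨k, rfl⟩ := Nat.exists_eq_add_of_le' hd
    have e1 : k + 1 + 1 - 2 = k := by omega
    have e2 : k + 1 + 1 - 1 = k + 1 := by omega
    rw [sphereVol, e1, e2, pow_succ]
    field_simp
  have hw := (sphereWeight_pos hΦ hd hρ).ne'
  rw [h1, h2, h3, logDerivWeight, clm_prod_apply]
  have h4 : Φ (sphereVol (d + 1) ρ) (-(d : ℝ) / ρ) = sphereWeight Φ d ρ := rfl
  rw [h4]
  field_simp
  ring

end GeodesicEquation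

/-! ### Completeness and infinite length -/

section Completeness

/-- A curve that runs with constant positive speed through all times covers an infinite length in
both directions. -/
theorem lintegral_eq_top_of_const_speed {l r r' : ℝ → ℝ} {c : ℝ} (hc : 0 < c)
    (hr : ∀ t, HasDerivAt r (r' t) t) (hpos : ∀ t, 0 < r t) (hl : ∀ ρ, 0 < ρ → 0 < l ρ)
    (h : ∀ t, l (r t) * r' t = c) :
    ∫⁻ ρ in Ioo 0 (r 0), ENNReal.ofReal (l ρ) = ⊤ ∧ ∫⁻ ρ in Ioi (r 0), ENNReal.ofReal (l ρ) = ⊤ := by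
  have hr' : ∀ t, 0 < r' t := fun t =>
    pos_of_mul_pos_right (by rw [h t]; exact hc) (hl _ (hpos t)).le
  have hmono : StrictMono r := strictMono_of_hasDerivAt_pos hr hr'
  -- By change of variables the length of r(s) is c times the measure of the time set s; half-lines
  -- of time therefore give infinite length.
  have key : ∀ s : Set ℝ, MeasurableSet s →
      ∫⁻ ρ in r '' s, ENNReal.ofReal (l ρ) = ENNReal.ofReal c * volume s := by
    intro s hs
    rw [lintegral_image_eq_lintegral_abs_deriv_mul hs (fun t _ => (hr t).hasDerivWithinAt)
      hmono.injective.injOn, ← setLIntegral_const]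
    refine lintegral_congr fun t => ?_
    rw [← ENNReal.ofReal_mul (abs_nonneg _), abs_of_pos (hr' t), mul_comm, h]
  have hc' : ENNReal.ofReal c ≠ 0 := by simpa using hc
  constructor
  · refine top_unique ?_
    have h1 := key (Iio 0) measurableSet_Iio
    rw [Real.volume_Iio, ENNReal.mul_top hc'] at h1
    rw [← h1]
    refine lintegral_mono_set ?_
    rintro _ ⟨t, ht, rfl⟩
    exact ⟨hpos t, hmono ht⟩
  · refine top_unique ?_
    have h1 := key (Ioi 0) measurableSet_Ioi
    rw [Real.volume_Ioi, ENNReal.mul_top hc'] at h1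
    rw [← h1]
    refine lintegral_mono_set ?_
    rintro _ ⟨t, ht, rfl⟩
    exact hmono ht

theorem lintegral_ofReal_lt_top_of_integrableOn {m : ℝ → ℝ} {s : Set ℝ} (h : IntegrableOn m s) :
    ∫⁻ u in s, ENNReal.ofReal (m u) < ⊤ :=
  (lintegral_ofReal_le_lintegral_enorm m).trans_lt h.2

/-- If the primitive missed a value by being bounded on one side, the positive function m would be
integrable on the corresponding half-line. -/
theorem surjective_primitive {m : ℝ → ℝ} (hm : Continuous m) (hpos : ∀ u, 0 < m u)
    (h1 : ∫⁻ u in Iio 0, ENNReal.ofReal (m u) = ⊤) (h2 : ∫⁻ u in Ioi 0, ENNReal.ofReal (m u) = ⊤) :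
    Function.Surjective fun s : ℝ => ∫ u in (0 : ℝ)..s, m u := by
  have habs : ∀ u, ‖m u‖ = m u := fun u => Real.norm_of_nonneg (hpos u).le
  have hcont : Continuous fun s : ℝ => ∫ u in (0 : ℝ)..s, m u :=
    intervalIntegral.continuous_primitive (fun a b => hm.intervalIntegrable a b) 0
  intro y
  refine mem_range_of_exists_le_of_exists_ge hcont ?_ ?_
  · by_contra! hy
    refine (lintegral_ofReal_lt_top_of_integrableOn (s := Iio 0) ?_).ne h1
    rw [← integrableOn_Iic_iff_integrableOn_Iio]
    refine integrableOn_Iic_of_intervalIntegral_norm_bounded (-y) 0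
      (fun s : ℝ => (hm.integrableOn_Ioc)) tendsto_id (Eventually.of_forall fun s => ?_)
    simp only [habs, id]
    rw [intervalIntegral.integral_symm]
    linarith [hy s]
  · by_contra! hy
    refine (lintegral_ofReal_lt_top_of_integrableOn (s := Ioi 0) ?_).ne h2
    refine integrableOn_Ioi_of_intervalIntegral_norm_bounded y 0
      (fun s : ℝ => (hm.integrableOn_Ioc)) tendsto_id (Eventually.of_forall fun s => ?_)
    simp only [habs, id]
    exact (hy s).le

/-- If the length is infinite in both directions, there are curves of constant speed that are
defined for all times. -/
theorem exists_const_speed {l : ℝ → ℝ} (hl : ContDiffOn ℝ ∞ l (Ioi 0)) (hpos : ∀ ρ, 0 < ρ → 0 < l ρ)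
    (h1 : ∫⁻ ρ in Ioo 0 1, ENNReal.ofReal (l ρ) = ⊤) (h2 : ∫⁻ ρ in Ioi 1, ENNReal.ofReal (l ρ) = ⊤)
    {r₀ : ℝ} (hr₀ : 0 < r₀) (c : ℝ) :
    -- The proof uses ρ = eᵘ to move the problem to all of ℝ, where arc length M is a smooth
    -- bijection with positive derivative. The curve is r(t) = exp(M⁻¹(M(log r₀) + ct)).
    ∃ r : ℝ → ℝ, ContDiff ℝ ∞ r ∧ (∀ t, 0 < r t) ∧ r 0 = r₀ ∧ ∀ t, l (r t) * deriv r t = c := by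
  set m : ℝ → ℝ := fun u => l (Real.exp u) * Real.exp u with hm
  have hms : ContDiff ℝ ∞ m :=
    (hl.comp_contDiff Real.contDiff_exp fun u => Real.exp_pos u).mul Real.contDiff_exp
  have hmpos : ∀ u, 0 < m u := fun u => mul_pos (hpos _ (Real.exp_pos u)) (Real.exp_pos u)
  have key : ∀ s : Set ℝ, MeasurableSet s →
      ∫⁻ ρ in Real.exp '' s, ENNReal.ofReal (l ρ) = ∫⁻ u in s, ENNReal.ofReal (m u) := by
    intro s hs
    rw [lintegral_image_eq_lintegral_abs_deriv_mul hs
      (fun t _ => (Real.hasDerivAt_exp t).hasDerivWithinAt) Real.exp_injective.injOn]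
    refine lintegral_congr fun t => ?_
    rw [← ENNReal.ofReal_mul (abs_nonneg _), Real.abs_exp, mul_comm]
  have e1 : Real.exp '' Iio 0 = Ioo 0 1 := by
    ext ρ
    constructor
    · rintro ⟨u, hu, rfl⟩
      exact ⟨Real.exp_pos u, Real.exp_zero ▸ Real.exp_lt_exp.2 hu⟩
    · rintro ⟨ha, hb⟩
      exact ⟨Real.log ρ, Real.log_neg ha hb, Real.exp_log ha⟩
  have e2 : Real.exp '' Ioi 0 = Ioi 1 := by
    ext ρ
    constructor
    · rintro ⟨u, hu, rfl⟩
      exact Real.one_lt_exp_iff.2 hu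
    · intro ha
      exact ⟨Real.log ρ, Real.log_pos ha, Real.exp_log (zero_lt_one.trans ha)⟩
  rw [← e1, key _ measurableSet_Iio] at h1
  rw [← e2, key _ measurableSet_Ioi] at h2
  set M : ℝ → ℝ := fun s : ℝ => ∫ u in (0 : ℝ)..s, m u with hM
  have hMd : ∀ s, HasDerivAt M (m s) s := fun s => hms.continuous.integral_hasStrictDerivAt 0 s
    |>.hasDerivAt
  have hMs : ContDiff ℝ ∞ M := by
    rw [contDiff_infty_iff_deriv]
    refine ⟨fun s => (hMd s).differentiableAt, ?_⟩
    rwa [show deriv M = m from funext fun s => (hMd s).deriv]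
  have hmono : StrictMono M := strictMono_of_hasDerivAt_pos hMd hmpos
  have hsurj : Function.Surjective M := surjective_primitive hms.continuous hmpos h1 h2
  set e : ℝ ≃ₜ ℝ := (hmono.orderIsoOfSurjective M hsurj).toHomeomorph
  have he : ∀ y, M (e.symm y) = y := fun y => e.apply_symm_apply y
  have hes : ContDiff ℝ ∞ e.symm :=
    e.contDiff_symm_deriv (f' := m) (fun s => (hmpos s).ne') hMd hMs
  set σ : ℝ → ℝ := fun t => e.symm (M (Real.log r₀) + c * t) with hσ
  have hσs : ContDiff ℝ ∞ σ := hes.comp (contDiff_const.add (contDiff_const.mul contDiff_id))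
  have hσd : ∀ t, HasDerivAt σ (deriv σ t) t := fun t =>
    (hσs.differentiable (by simp) t).hasDerivAt
  have hMσ : ∀ t, m (σ t) * deriv σ t = c := by
    intro t
    have a1 : HasDerivAt (fun t => M (σ t)) (m (σ t) * deriv σ t) t := (hMd (σ t)).comp t (hσd t)
    have a2 : HasDerivAt (fun t => M (σ t)) c t := by
      simp only [hσ, he]
      simpa using ((hasDerivAt_id' t).const_mul c).const_add (M (Real.log r₀))
    exact a1.unique a2
  refine ⟨fun t => Real.exp (σ t), Real.contDiff_exp.comp hσs, fun t => Real.exp_pos _, ?_, ?_⟩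
  · have : σ 0 = Real.log r₀ := by
      simp only [hσ, mul_zero, add_zero]
      exact e.symm_apply_apply _
    simp only [this, Real.exp_log hr₀]
  · intro t
    rw [(hσd t).exp.deriv, ← mul_assoc]
    exact hMσ t

variable {Φ : ℝ → ℝ → ℝ}

theorem lengthDensity_eq (d : ℕ) (ρ : ℝ) : lengthDensity Φ (d + 1) ρ =
    ρ ^ ((d : ℝ) / 2) * √(sphereWeight Φ d ρ) := by
  rw [lengthDensity, sphereWeight]
  push_cast
  rw [add_sub_cancel_right]

theorem lengthDensity_pos (hΦ : IsWeight Φ) (hd : 1 ≤ d) {ρ : ℝ} (hρ : 0 < ρ) :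
    0 < lengthDensity Φ (d + 1) ρ := by
  rw [lengthDensity_eq]
  exact mul_pos (Real.rpow_pos_of_pos hρ _) (Real.sqrt_pos.2 (sphereWeight_pos hΦ hd hρ))

/-- This identifies the integrand of the completeness criterion with √W up to the constant area of
the unit sphere; its logarithmic derivative is thus half that of W. -/
theorem lengthDensity_eq_sqrt (d : ℕ) {ρ : ℝ} (hρ : 0 < ρ) : lengthDensity Φ (d + 1) ρ =
    √(sphereWeight Φ d ρ * sphereVol (d + 1) ρ / (surf d).real univ) := by
  have h := (surf_real_univ_pos d).ne'
  rw [lengthDensity_eq, sphereVol_eq, mul_div_assoc, mul_div_cancel_left₀ _ h,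
    Real.sqrt_mul' _ (pow_nonneg hρ.le d), mul_comm, Real.sqrt_eq_rpow (ρ ^ d),
    ← Real.rpow_natCast, ← Real.rpow_mul hρ.le, mul_one_div]

theorem hasDerivAt_lengthDensity (hΦ : IsWeight Φ) (hd : 1 ≤ d) {ρ : ℝ} (hρ : 0 < ρ) :
    HasDerivAt (lengthDensity Φ (d + 1))
      (lengthDensity Φ (d + 1) ρ * (logDerivWeight Φ d ρ / 2)) ρ := by
  have hW : 0 < sphereWeight Φ d ρ * sphereVol (d + 1) ρ / (surf d).real univ :=
    div_pos (mul_pos (sphereWeight_pos hΦ hd hρ) (sphereVol_pos d hρ)) (surf_real_univ_pos d)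
  have h1 := ((hasDerivAt_sphereWeight_mul_sphereVol hΦ hd hρ).div_const
    ((surf d).real univ)).sqrt hW.ne'
  have h2 : lengthDensity Φ (d + 1) =ᶠ[𝓝 ρ]
      fun ρ => √(sphereWeight Φ d ρ * sphereVol (d + 1) ρ / (surf d).real univ) := by
    filter_upwards [isOpen_Ioi.mem_nhds hρ] with τ hτ
    exact lengthDensity_eq_sqrt d hτ
  convert! h1.congr_of_eventuallyEq h2 using 1
  rw [lengthDensity_eq_sqrt d hρ, mul_div_right_comm _ (logDerivWeight Φ d ρ)]
  have h3 := Real.mul_self_sqrt hW.le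
  rw [eq_div_iff (mul_pos two_pos (Real.sqrt_pos.2 hW)).ne']
  linear_combination logDerivWeight Φ d ρ * h3

theorem contDiffOn_lengthDensity (hΦ : IsWeight Φ) (hd : 1 ≤ d) :
    ContDiffOn ℝ ∞ (lengthDensity Φ (d + 1)) (Ioi 0) := by
  intro ρ hρ
  have hρ' : (ρ : ℝ) ≠ 0 := (mem_Ioi.1 hρ).ne'
  refine ContDiffAt.contDiffWithinAt ?_
  have h1 : ContDiffAt ℝ ∞ (fun ρ => sphereWeight Φ d ρ) ρ := by
    refine ContDiffAt.comp ρ (f := fun ρ => (sphereVol (d + 1) ρ, -(d : ℝ) / ρ))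
      (hΦ.contDiffAt (mem_weight_domain hd hρ)) (ContDiffAt.prodMk ?_ ?_)
    · rw [show sphereVol (d + 1) = _ from funext (sphereVol_eq d)]
      fun_prop
    · exact contDiffAt_const.div contDiffAt_id hρ'
  rw [show lengthDensity Φ (d + 1) = _ from funext (lengthDensity_eq d)]
  exact (Real.contDiffAt_rpow_const_of_ne hρ').mul (h1.sqrt (sphereWeight_pos hΦ hd hρ).ne')

/-- The derivative of l(r) r' is l(r) times the defect r'' + ½ r'² (log W)'(r), and the length
density l is positive. -/
theorem const_speed_iff (hΦ : IsWeight Φ) (hd : 1 ≤ d) {r : ℝ → ℝ} (hr : ContDiff ℝ ∞ r)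
    (hpos : ∀ t, 0 < r t) :
    (∀ t, deriv (deriv r) t = -(1 / 2) * deriv r t ^ 2 * logDerivWeight Φ d (r t)) ↔
      ∃ c, ∀ t, lengthDensity Φ (d + 1) (r t) * deriv r t = c := by
  have hder : ∀ t, HasDerivAt (fun t => lengthDensity Φ (d + 1) (r t) * deriv r t)
      (lengthDensity Φ (d + 1) (r t) * (deriv (deriv r) t -
        -(1 / 2) * deriv r t ^ 2 * logDerivWeight Φ d (r t))) t := by
    intro t
    obtain ⟨h1, h2⟩ := hasDerivAt_of_contDiffOn isOpen_univ hr.contDiffOn (mem_univ t)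
    convert! ((hasDerivAt_lengthDensity hΦ hd (hpos t)).comp t h1).fun_mul h2 using 1
    simp only [Function.comp_apply]
    ring
  constructor
  · intro h
    have hconst := is_const_of_deriv_eq_zero (fun t => (hder t).differentiableAt) fun t => by
      rw [(hder t).deriv, h t, sub_self, mul_zero]
    exact ⟨_, fun t => hconst t 0⟩
  · rintro ⟨c, hc⟩ t
    have h1 := (hder t).unique (by simpa only [hc] using hasDerivAt_const t c)
    exact sub_eq_zero.1 ((mul_eq_zero.1 h1).resolve_left (lengthDensity_pos hΦ hd (hpos t)).ne')

/-- A complete geodesic of nonzero speed traverses infinite length both forwards and backwards;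
conversely infinite length at both ends allows constant speed curves for all times. -/
theorem concentricComplete_iff (x₀ : Amb d) (hΦ : IsWeight Φ) (hd : 1 ≤ d) :
    ConcentricComplete Φ x₀ ↔
      (∀ r₁ : ℝ, 0 < r₁ →
        ∫⁻ r in Ioo 0 r₁, ENNReal.ofReal (lengthDensity Φ (d + 1) r) = ⊤) ∧
      (∀ r₀ : ℝ, 0 < r₀ →
        ∫⁻ r in Ioi r₀, ENNReal.ofReal (lengthDensity Φ (d + 1) r) = ⊤) := by
  have hgeo : ∀ r : ℝ → ℝ, ContDiff ℝ ∞ r → (∀ t, 0 < r t) →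
      (IsConcentricGeodesic Φ x₀ r univ ↔
        ∃ c, ∀ t, lengthDensity Φ (d + 1) (r t) * deriv r t = c) := by
    intro r hr hpos
    rw [isConcentricGeodesic_iff x₀ hΦ hd isOpen_univ hr.contDiffOn fun t _ => hpos t,
      ← const_speed_iff hΦ hd hr hpos]
    simp only [mem_univ, forall_const]
  constructor
  · intro h
    have key : ∀ r₀ : ℝ, 0 < r₀ →
        ∫⁻ r in Ioo 0 r₀, ENNReal.ofReal (lengthDensity Φ (d + 1) r) = ⊤ ∧
        ∫⁻ r in Ioi r₀, ENNReal.ofReal (lengthDensity Φ (d + 1) r) = ⊤ := by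
      intro r₀ hr₀
      -- Any positive initial velocity would do; zero velocity would give no information.
      obtain ⟨r, hr, hpos, rfl, hv, hg⟩ := h r₀ hr₀ 1
      obtain ⟨c, hc⟩ := (hgeo r hr hpos).1 hg
      refine lintegral_eq_top_of_const_speed ?_
        (fun t => (hr.differentiable (by simp) t).hasDerivAt) hpos
        (fun ρ hρ => lengthDensity_pos hΦ hd hρ) hc
      rw [← hc 0, hv, mul_one]
      exact lengthDensity_pos hΦ hd hr₀
    exact ⟨fun r₁ h => (key r₁ h).1, fun r₀ h => (key r₀ h).2⟩
  · rintro ⟨h1, h2⟩ r₀ hr₀ v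
    obtain ⟨r, hr, hpos, hr0, hc⟩ := exists_const_speed (contDiffOn_lengthDensity hΦ hd)
      (fun ρ hρ => lengthDensity_pos hΦ hd hρ) (h1 1 one_pos) (h2 1 one_pos) hr₀
      (lengthDensity Φ (d + 1) r₀ * v)
    refine ⟨r, hr, hpos, hr0, ?_, (hgeo r hr hpos).2 ⟨_, hc⟩⟩
    have := hc 0
    rw [hr0] at this
    exact mul_left_cancel₀ (lengthDensity_pos hΦ hd hr₀).ne' this

end Completeness

/-! ### Special weights -/

section Examples

theorem lintegral_Ioo_rpow_eq_top_iff {s t : ℝ} (ht : 0 < t) :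
    ∫⁻ x in Ioo 0 t, ENNReal.ofReal (x ^ s) = ⊤ ↔ s ≤ -1 := by
  rw [← not_iff_not, ← ne_eq, lintegral_ofReal_ne_top_iff_integrable
    (by fun_prop)
    (ae_restrict_of_forall_mem measurableSet_Ioo fun x hx => Real.rpow_nonneg hx.1.le s), not_le]
  exact intervalIntegral.integrableOn_Ioo_rpow_iff ht

theorem lintegral_Ioi_rpow_eq_top_iff {s t : ℝ} (ht : 0 < t) :
    ∫⁻ x in Ioi t, ENNReal.ofReal (x ^ s) = ⊤ ↔ -1 ≤ s := by
  rw [← not_iff_not, ← ne_eq, lintegral_ofReal_ne_top_iff_integrable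
    (by fun_prop)
    (ae_restrict_of_forall_mem measurableSet_Ioi fun x hx =>
      Real.rpow_nonneg (ht.trans hx).le s), not_le]
  exact integrableOn_Ioi_rpow_iff ht

theorem lintegral_eq_top_of_const_mul_le {f g : ℝ → ℝ} {s : Set ℝ} (hs : MeasurableSet s) {C : ℝ}
    (hC : 0 < C) (h : ∀ x ∈ s, C * f x ≤ g x) (hf : ∫⁻ x in s, ENNReal.ofReal (f x) = ⊤) :
    ∫⁻ x in s, ENNReal.ofReal (g x) = ⊤ := by
  refine top_unique ?_
  have hC' : ENNReal.ofReal C ≠ 0 := by simpa using hC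
  calc ⊤ = ∫⁻ x in s, ENNReal.ofReal C * ENNReal.ofReal (f x) := by
        rw [lintegral_const_mul' _ _ ENNReal.ofReal_ne_top, hf, ENNReal.mul_top hC']
    _ ≤ _ := by
        refine setLIntegral_mono' hs fun x hx => ?_
        rw [← ENNReal.ofReal_mul hC.le]
        exact ENNReal.ofReal_le_ofReal (h x hx)

theorem lintegral_ne_top_of_le_add {f g h : ℝ → ℝ} {s : Set ℝ} (hs : MeasurableSet s) {C D : ℝ}
    (hC : 0 ≤ C) (hD : 0 ≤ D) (hf : Measurable f) (hle : ∀ x ∈ s, h x ≤ C * f x + D * g x)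
    (hf' : ∫⁻ x in s, ENNReal.ofReal (f x) ≠ ⊤) (hg' : ∫⁻ x in s, ENNReal.ofReal (g x) ≠ ⊤) :
    ∫⁻ x in s, ENNReal.ofReal (h x) ≠ ⊤ := by
  refine ne_top_of_le_ne_top (b := (ENNReal.ofReal C * ∫⁻ x in s, ENNReal.ofReal (f x)) +
    ENNReal.ofReal D * ∫⁻ x in s, ENNReal.ofReal (g x)) (ENNReal.add_ne_top.2
      ⟨ENNReal.mul_ne_top ENNReal.ofReal_ne_top hf', ENNReal.mul_ne_top ENNReal.ofReal_ne_top hg'⟩) ?_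
  rw [← lintegral_const_mul' _ _ ENNReal.ofReal_ne_top,
    ← lintegral_const_mul' _ _ ENNReal.ofReal_ne_top,
    ← lintegral_add_left (hf.ennreal_ofReal.const_mul _)]
  refine setLIntegral_mono' hs fun x hx => ?_
  rw [← ENNReal.ofReal_mul hC, ← ENNReal.ofReal_mul hD]
  exact (ENNReal.ofReal_le_ofReal (hle x hx)).trans ENNReal.ofReal_add_le

/-! ### Powers of the volume -/

theorem isWeight_rpow (k : ℝ) : IsWeight fun v _ => v ^ k where
  smooth := contDiff_fst.contDiffOn.rpow_const_of_ne fun _ hp => (mem_Ioi.1 hp.1).ne'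
  pos _ _ hv _ := Real.rpow_pos_of_pos hv k

theorem sphereVol_rpow (d : ℕ) {ρ : ℝ} (hρ : 0 < ρ) (k : ℝ) :
    sphereVol (d + 1) ρ ^ k = (surf d).real univ ^ k * ρ ^ (d * k) := by
  rw [sphereVol_eq, Real.mul_rpow (surf_real_univ_pos d).le (pow_nonneg hρ.le d),
    ← Real.rpow_natCast, ← Real.rpow_mul hρ.le]

theorem sqrt_rpow {x : ℝ} (hx : 0 ≤ x) (a : ℝ) : √(x ^ a) = x ^ (a / 2) := by
  rw [Real.sqrt_eq_rpow, ← Real.rpow_mul hx, mul_one_div]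

theorem lengthDensity_rpow (d : ℕ) {ρ : ℝ} (hρ : 0 < ρ) (k : ℝ) :
    lengthDensity (fun v _ => v ^ k) (d + 1) ρ =
      (surf d).real univ ^ (k / 2) * ρ ^ (d * (1 + k) / 2) := by
  have h := (surf_real_univ_pos d).le
  rw [lengthDensity_eq, sphereWeight, sphereVol_rpow d hρ,
    Real.sqrt_mul (Real.rpow_nonneg h k), sqrt_rpow h, sqrt_rpow hρ.le, mul_left_comm,
    ← Real.rpow_add hρ]
  congr 2
  ring

/-- The length density is a constant times r^s with s = d(1 + k)/2. For s < -1 the length is finite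
towards infinity, for s > -1 it is finite towards 0. -/
theorem not_concentricComplete_rpow (x₀ : Amb d) (hd : 1 ≤ d) {k : ℝ} (hk : d * (1 + k) / 2 ≠ -1) :
    ¬ ConcentricComplete (fun v _ => v ^ k) x₀ := by
  have hC : 0 ≤ (surf d).real univ ^ (k / 2) := Real.rpow_nonneg (surf_real_univ_pos d).le _
  rw [concentricComplete_iff x₀ (isWeight_rpow k) hd]
  rintro ⟨h1, h2⟩
  rcases hk.lt_or_gt with hk | hk
  · refine lintegral_ne_top_of_le_add (f := fun x => x ^ (d * (1 + k) / 2)) (g := fun _ => 0)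
      measurableSet_Ioi hC le_rfl (measurable_id.pow_const _) (fun x hx => ?_) ?_ (by simp)
      (h2 1 one_pos)
    · rw [lengthDensity_rpow d (zero_lt_one.trans hx), mul_zero, add_zero]
    · rw [ne_eq, lintegral_Ioi_rpow_eq_top_iff one_pos]
      exact hk.not_ge
  · refine lintegral_ne_top_of_le_add (f := fun x => x ^ (d * (1 + k) / 2)) (g := fun _ => 0)
      measurableSet_Ioo hC le_rfl (measurable_id.pow_const _) (fun x hx => ?_) ?_ (by simp)
      (h1 1 one_pos)
    · rw [lengthDensity_rpow d hx.1, mul_zero, add_zero]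
    · rw [ne_eq, lintegral_Ioo_rpow_eq_top_iff one_pos]
      exact hk.not_ge

theorem sphereVol_rpow_eq (n : ℕ) (hn : 1 ≤ n) {r : ℝ} (hr : 0 < r) (k : ℝ) :
    sphereVol n r ^ k = (n : ℝ) ^ k * Real.pi ^ (k * n / 2) / Real.Gamma (1 + (n : ℝ) / 2) ^ k
      * r ^ (k * ((n : ℝ) - 1)) := by
  have hG : 0 < Real.Gamma (1 + (n : ℝ) / 2) := Real.Gamma_pos_of_pos (by positivity)
  have hpi := Real.pi_pos
  rw [sphereVol, Real.div_rpow (by positivity) hG.le, Real.mul_rpow (by positivity) (by positivity),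
    Real.mul_rpow (by positivity) (by positivity), ← Real.rpow_natCast r, ← Real.rpow_mul hr.le,
    ← Real.rpow_mul hpi.le, Nat.cast_sub hn, Nat.cast_one,
    show k * n / 2 = n / 2 * k by ring, mul_comm k]
  ring

/-! ### The exponential of the volume -/

theorem isWeight_exp : IsWeight fun v _ => Real.exp v where
  smooth := (Real.contDiff_exp.comp contDiff_fst).contDiffOn
  pos _ _ _ _ := Real.exp_pos _

/-- The density is bounded on (0, 1), so spheres shrink to a point within finite length. -/
theorem not_concentricComplete_exp (x₀ : Amb d) (hd : 1 ≤ d) :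
    ¬ ConcentricComplete (fun v _ => Real.exp v) x₀ := by
  rw [concentricComplete_iff x₀ isWeight_exp hd]
  rintro ⟨h1, -⟩
  refine lintegral_ne_top_of_le_add (f := fun _ => 1) (g := fun _ => 0) measurableSet_Ioo
    (Real.sqrt_nonneg (Real.exp ((surf d).real univ))) le_rfl measurable_const (fun x hx => ?_)
    (by simp) (by simp) (h1 1 one_pos)
  rw [lengthDensity_eq, sphereWeight, mul_one, mul_zero, add_zero, sphereVol_eq]
  refine (mul_le_of_le_one_left (Real.sqrt_nonneg _)
    (Real.rpow_le_one hx.1.le hx.2.le (by positivity))).trans (Real.sqrt_le_sqrt ?_)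
  exact Real.exp_le_exp.2 (mul_le_of_le_one_right (surf_real_univ_pos d).le
    (pow_le_one₀ hx.1.le hx.2.le))

/-! ### Powers of the mean curvature -/

theorem isWeight_one_add {A : ℝ} (hA : 0 < A) (k : ℝ) : IsWeight fun _ y => 1 + A * |y| ^ k where
  smooth := by
    have h : ContDiffOn ℝ ∞ (fun p : ℝ × ℝ => 1 + A * (-p.2) ^ k) (Ioi 0 ×ˢ Iio 0) :=
      contDiffOn_const.add (contDiffOn_const.mul
        (contDiff_snd.neg.contDiffOn.rpow_const_of_ne fun p hp => (neg_pos.2 hp.2).ne'))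
    refine h.congr fun p hp => ?_
    rw [abs_of_neg hp.2]
  pos v y _ hy := by
    have := Real.rpow_pos_of_pos (abs_pos.2 hy.ne) k
    positivity

theorem abs_neg_div_rpow (d : ℕ) {r : ℝ} (hr : 0 < r) (k : ℝ) :
    |-(d : ℝ) / r| ^ k = (d : ℝ) ^ k / r ^ k := by
  rw [abs_div, abs_neg, abs_of_pos hr, abs_of_nonneg d.cast_nonneg, Real.div_rpow d.cast_nonneg hr.le]

theorem rpow_mul_sqrt_meanCurvature {A : ℝ} (hA : 0 < A) (d : ℕ) {ρ : ℝ} (hρ : 0 < ρ) (k : ℝ) :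
    ρ ^ ((d : ℝ) / 2) * √(A * |-(d : ℝ) / ρ| ^ (2 * k)) =
      √A * (d : ℝ) ^ k * ρ ^ ((d : ℝ) / 2 - k) := by
  rw [Real.sqrt_mul hA.le, sqrt_rpow (abs_nonneg _), abs_neg_div_rpow d hρ, Real.rpow_sub hρ,
    mul_div_cancel_left₀ k two_ne_zero]
  ring

/-- Towards infinity Φ ≥ 1 already forces infinite length. Near 0 the bounds √a ≤ √(1 + a) ≤ 1 + √a
compare the density with r^(d/2 - k), up to the integrable term r^(d/2), so divergence means d/2 - k
≤ -1. -/
theorem concentricComplete_one_add_iff (x₀ : Amb d) (hd : 1 ≤ d) {A : ℝ} (hA : 0 < A) (k : ℝ) :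
    ConcentricComplete (fun _ y => 1 + A * |y| ^ (2 * k)) x₀ ↔ (d : ℝ) / 2 + 1 ≤ k := by
  have hd' : (0 : ℝ) < d := by exact_mod_cast hd
  have hC : 0 < √A * (d : ℝ) ^ k := mul_pos (Real.sqrt_pos.2 hA) (Real.rpow_pos_of_pos hd' k)
  have hx : ∀ x : ℝ, 0 ≤ A * |-(d : ℝ) / x| ^ (2 * k) := fun x =>
    mul_nonneg hA.le (Real.rpow_nonneg (abs_nonneg _) _)
  rw [concentricComplete_iff x₀ (isWeight_one_add hA (2 * k)) hd]
  constructor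
  · rintro ⟨h1, -⟩
    by_contra! hk
    refine lintegral_ne_top_of_le_add (f := fun x => x ^ ((d : ℝ) / 2))
      (g := fun x => x ^ ((d : ℝ) / 2 - k)) measurableSet_Ioo zero_le_one hC.le
      (measurable_id.pow_const _) (fun x hx' => ?_) ?_ ?_ (h1 1 one_pos)
    · rw [← rpow_mul_sqrt_meanCurvature hA d hx'.1, lengthDensity_eq, sphereWeight, one_mul]
      nth_rewrite 2 [← mul_one (x ^ ((d : ℝ) / 2))]
      rw [← mul_add]
      refine mul_le_mul_of_nonneg_left ?_ (Real.rpow_nonneg hx'.1.le _)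
      refine Real.sqrt_le_iff.2 ⟨by positivity, ?_⟩
      nlinarith [Real.sq_sqrt (hx x), Real.sqrt_nonneg (A * |-(d : ℝ) / x| ^ (2 * k))]
    · rw [ne_eq, lintegral_Ioo_rpow_eq_top_iff one_pos]
      linarith
    · rw [ne_eq, lintegral_Ioo_rpow_eq_top_iff one_pos]
      linarith
  · intro hk
    refine ⟨fun r hr => ?_, fun r hr => ?_⟩
    · refine lintegral_eq_top_of_const_mul_le (f := fun x => x ^ ((d : ℝ) / 2 - k))
        measurableSet_Ioo hC (fun x hx' => ?_) ?_
      · rw [← rpow_mul_sqrt_meanCurvature hA d hx'.1, lengthDensity_eq, sphereWeight]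
        refine mul_le_mul_of_nonneg_left (Real.sqrt_le_sqrt ?_) (Real.rpow_nonneg hx'.1.le _)
        exact le_add_of_nonneg_left zero_le_one
      · rw [lintegral_Ioo_rpow_eq_top_iff hr]
        linarith
    · refine lintegral_eq_top_of_const_mul_le (f := fun x => x ^ ((d : ℝ) / 2))
        measurableSet_Ioi one_pos (fun x hx' => ?_) ?_
      · rw [lengthDensity_eq, sphereWeight, mul_comm]
        refine mul_le_mul_of_nonneg_left ?_ (Real.rpow_nonneg (hr.trans hx').le _)
        exact Real.one_le_sqrt.2 (le_add_of_nonneg_right (hx x))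
      · rw [lintegral_Ioi_rpow_eq_top_iff hr]
        linarith

/-! ### A scale invariant weight -/

theorem isWeight_scaleInvariant {A : ℝ} (hA : 0 ≤ A) (p : ℝ) :
    IsWeight fun v y => v ^ p + A * (y ^ 2 / v) where
  smooth := (contDiff_fst.contDiffOn.rpow_const_of_ne fun q hq => (mem_Ioi.1 hq.1).ne').add
    (contDiffOn_const.mul ((contDiff_snd.pow 2).contDiffOn.div contDiff_fst.contDiffOn
      fun q hq => (mem_Ioi.1 hq.1).ne'))
  pos v y hv _ := by
    have := Real.rpow_pos_of_pos hv p
    positivity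

/-- Both summands scale like r^(-(d + 2)): the first by the choice of p, the second because Tr(L)²
contributes r⁻² and 1/Vol contributes r^(-d). -/
theorem scaleInvariant_eq {A p : ℝ} (hp : d * p = -(d + 2 : ℝ)) {r : ℝ} (hr : 0 < r) :
    sphereVol (d + 1) r ^ p + A * ((-(d : ℝ) / r) ^ 2 / sphereVol (d + 1) r) =
      ((surf d).real univ ^ p + A * d ^ 2 / (surf d).real univ) / r ^ (d + 2) := by
  have h := (surf_real_univ_pos d).ne'
  rw [sphereVol_rpow d hr, hp, sphereVol_eq, Real.rpow_neg hr.le,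
    show (d + 2 : ℝ) = ((d + 2 : ℕ) : ℝ) by push_cast; rfl, Real.rpow_natCast]
  field_simp
  ring

/-- The length density is exactly a multiple of 1/r, whose integral diverges logarithmically at both
ends. -/
theorem concentricComplete_scaleInvariant (x₀ : Amb d) (hd : 1 ≤ d) {A p : ℝ} (hA : 0 ≤ A)
    (hp : d * p = -(d + 2 : ℝ)) :
    ConcentricComplete (fun v y => v ^ p + A * (y ^ 2 / v)) x₀ := by
  have hc := surf_real_univ_pos d
  have hC : 0 < (surf d).real univ ^ p + A * d ^ 2 / (surf d).real univ := by
    have := Real.rpow_pos_of_pos hc p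
    positivity
  have key : ∀ x : ℝ, 0 < x → √((surf d).real univ ^ p + A * d ^ 2 / (surf d).real univ) *
      x ^ (-1 : ℝ) ≤ lengthDensity (fun v y => v ^ p + A * (y ^ 2 / v)) (d + 1) x := by
    intro x hx
    rw [lengthDensity_eq, sphereWeight, scaleInvariant_eq hp hx, Real.sqrt_div hC.le,
      ← Real.rpow_natCast x, sqrt_rpow hx.le, mul_div_left_comm, ← Real.rpow_sub hx]
    refine le_of_eq ?_
    congr 2
    push_cast
    ring
  rw [concentricComplete_iff x₀ (isWeight_scaleInvariant hA p) hd]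
  refine ⟨fun r hr => ?_, fun r hr => ?_⟩
  · exact lintegral_eq_top_of_const_mul_le measurableSet_Ioo (Real.sqrt_pos.2 hC)
      (fun x hx => key x hx.1) ((lintegral_Ioo_rpow_eq_top_iff hr).2 le_rfl)
  · exact lintegral_eq_top_of_const_mul_le measurableSet_Ioi (Real.sqrt_pos.2 hC)
      (fun x hx => key x (hr.trans hx)) ((lintegral_Ioi_rpow_eq_top_iff hr).2 le_rfl)

end Examples

end AlmostLocal

end

/-! ### The theorem in terms of n -/

theorem mainTheorem6 (n d : ℕ) (hd : 1 ≤ d) (hn : n = d + 1) (x₀ : AlmostLocal.Amb d) :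
    -- spheres with center `x₀` are described by their radius
    (∀ r : ℝ, 0 < r →
      AlmostLocal.IsImm (AlmostLocal.roundSphere x₀ r) ∧
      Set.range (AlmostLocal.roundSphere x₀ r) = Metric.sphere x₀ r ∧
      AlmostLocal.Vol (AlmostLocal.roundSphere x₀ r) = AlmostLocal.sphereVol n r ∧
      ∀ x, AlmostLocal.trL (AlmostLocal.roundSphere x₀ r) x = -((n : ℝ) - 1) / r) ∧
    (∀ r r' : ℝ, 0 < r → 0 < r' →
      (AlmostLocal.SameShape (AlmostLocal.roundSphere x₀ r) (AlmostLocal.roundSphere x₀ r') ↔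
        r = r')) ∧
    -- the geodesic equation and the criterion for completeness
    (∀ Φ : ℝ → ℝ → ℝ, AlmostLocal.IsWeight Φ →
      (∀ (I : Set ℝ) (r : ℝ → ℝ), IsOpen I → ContDiffOn ℝ ∞ r I → (∀ t ∈ I, 0 < r t) →
        (AlmostLocal.IsConcentricGeodesic Φ x₀ r I ↔
          ∀ t ∈ I, deriv (deriv r) t =
            -(deriv r t) ^ 2 *
              (((n : ℝ) - 1) / Φ (AlmostLocal.sphereVol n (r t)) (-((n : ℝ) - 1) / r t)) *
              (1 / (2 * r t) * Φ (AlmostLocal.sphereVol n (r t)) (-((n : ℝ) - 1) / r t)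
                + deriv (fun v => Φ v (-((n : ℝ) - 1) / r t))
                    (AlmostLocal.sphereVol n (r t)) / 2
                  * (n * Real.pi ^ ((n : ℝ) / 2) * r t ^ (n - 2)
                      / Real.Gamma (1 + (n : ℝ) / 2))
                + 1 / (2 * r t ^ 2)
                  * deriv (fun y => Φ (AlmostLocal.sphereVol n (r t)) y)
                      (-((n : ℝ) - 1) / r t)))) ∧
      (AlmostLocal.ConcentricComplete Φ x₀ ↔
        (∀ r₁ : ℝ, 0 < r₁ →
          ∫⁻ r in Set.Ioo 0 r₁, ENNReal.ofReal (AlmostLocal.lengthDensity Φ n r) = ⊤) ∧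
        (∀ r₀ : ℝ, 0 < r₀ →
          ∫⁻ r in Set.Ioi r₀, ENNReal.ofReal (AlmostLocal.lengthDensity Φ n r) = ⊤))) ∧
    -- `Φ = Vol ^ k`
    (∀ k : ℝ,
      (∀ r : ℝ, 0 < r → AlmostLocal.sphereVol n r ^ k =
        (n : ℝ) ^ k * Real.pi ^ (k * n / 2) / Real.Gamma (1 + (n : ℝ) / 2) ^ k
          * r ^ (k * ((n : ℝ) - 1))) ∧
      (k ≠ (1 + (n : ℝ)) / (1 - n) →
        ¬ AlmostLocal.ConcentricComplete (fun v _ => v ^ k) x₀)) ∧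
    -- `Φ = exp Vol`
    ((∀ r : ℝ, 0 < r → Real.exp (AlmostLocal.sphereVol n r) =
        Real.exp (n * Real.pi ^ ((n : ℝ) / 2) / Real.Gamma (1 + (n : ℝ) / 2) * r ^ (n - 1))) ∧
      ¬ AlmostLocal.ConcentricComplete (fun v _ => Real.exp v) x₀) ∧
    -- `Φ = 1 + A Tr(L) ^ (2 k)`
    (∀ A k : ℝ, 0 < A →
      (∀ r : ℝ, 0 < r → 1 + A * |-((n : ℝ) - 1) / r| ^ (2 * k) =
        1 + A * (((n : ℝ) - 1) ^ (2 * k) / r ^ (2 * k))) ∧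
      (AlmostLocal.ConcentricComplete (fun _ y => 1 + A * |y| ^ (2 * k)) x₀ ↔
        ((n : ℝ) + 1) / 2 ≤ k)) ∧
    -- `Φ = Vol ^ ((1 + n) / (1 - n)) + A Tr(L) ^ 2 / Vol`
    (∀ A : ℝ, 0 ≤ A →
      (∃ C : ℝ, 0 < C ∧ ∀ r : ℝ, 0 < r →
        AlmostLocal.sphereVol n r ^ ((1 + (n : ℝ)) / (1 - n))
          + A * ((-((n : ℝ) - 1) / r) ^ 2 / AlmostLocal.sphereVol n r) = C / r ^ (n + 1)) ∧
      AlmostLocal.ConcentricComplete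
        (fun v y => v ^ ((1 + (n : ℝ)) / (1 - n)) + A * (y ^ 2 / v)) x₀) := by
  subst hn
  have hd' : (d : ℝ) ≠ 0 := by exact_mod_cast (by omega : d ≠ 0)
  have hcast : ((d + 1 : ℕ) : ℝ) - 1 = d := by push_cast; ring
  -- The exponent p = (1 + n)/(1 - n) is characterized by d p = -(d + 2). It serves both as the
  -- exceptional power of the volume and as the scale invariant one.
  have hp : (d : ℝ) * ((1 + ((d + 1 : ℕ) : ℝ)) / (1 - ((d + 1 : ℕ) : ℝ))) = -(d + 2 : ℝ) := by
    rw [← neg_sub ((d + 1 : ℕ) : ℝ) 1, hcast]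
    push_cast
    field_simp
    ring
  simp only [hcast]
  refine ⟨fun r hr => ⟨AlmostLocal.isImm_roundSphere x₀ hr, AlmostLocal.range_roundSphere x₀ hr,
    AlmostLocal.Vol_roundSphere x₀ hr, AlmostLocal.trL_roundSphere x₀ hr⟩,
    fun r r' hr hr' => AlmostLocal.sameShape_roundSphere_iff x₀ hr hr',
    fun Φ hΦ => ⟨fun I r hI hr hpos => ?_, AlmostLocal.concentricComplete_iff x₀ hΦ hd⟩,
    fun k => ⟨fun r hr => ?_, fun hk => ?_⟩, ⟨fun r _ => ?_, ?_⟩,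
    fun A k hA => ⟨fun r hr => ?_, ?_⟩, fun A hA => ⟨⟨_, ?_, fun r hr => AlmostLocal.scaleInvariant_eq hp hr⟩, ?_⟩⟩
  · rw [AlmostLocal.isConcentricGeodesic_iff x₀ hΦ hd hI hr hpos]
    refine forall₂_congr fun t ht => ?_
    rw [AlmostLocal.logDerivWeight_eq hΦ hd (hpos t ht), ← mul_assoc, ← mul_assoc,
      mul_assoc (-(1 / 2)) _ (2 : ℝ), mul_comm _ (2 : ℝ), ← mul_assoc]
    norm_num
  · rw [AlmostLocal.sphereVol_rpow_eq _ (Nat.le_add_left 1 d) hr, hcast]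
  · refine AlmostLocal.not_concentricComplete_rpow x₀ hd fun h => hk ?_
    refine mul_left_cancel₀ hd' ?_
    rw [hp]
    linarith
  · rw [AlmostLocal.sphereVol, mul_div_right_comm]
  · exact AlmostLocal.not_concentricComplete_exp x₀ hd
  · rw [AlmostLocal.abs_neg_div_rpow d hr]
  · rw [AlmostLocal.concentricComplete_one_add_iff x₀ hd hA]
    push_cast
    ring_nf
  · have hc := AlmostLocal.surf_real_univ_pos d
    have := Real.rpow_pos_of_pos hc ((1 + ((d + 1 : ℕ) : ℝ)) / (1 - ((d + 1 : ℕ) : ℝ)))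
    positivity
  · exact AlmostLocal.concentricComplete_scaleInvariant x₀ hd hA hp
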